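/- Let $q$ be a prime power, $m\ge 2$, $\lambda\mid q-1$ with $\lambda\ne q-1$, $n=\frac{q^m-1}{\lambda}$, and let $s$ be an integer with $1\le s\le\frac{q-1}{\lambda}-1$. Let $\alpha$ be a primitive element of $\mathbb F_{q^m}$, $\beta=\alpha^{(q^m-1)/n}$, and for $2\le\delta\le n$ let $\mathcal C_\delta$ be the narrow-sense BCH code of length $n$ and designed distance $\delta$ over $\mathbb F_q$, i.e. the cyclic code generated by the least common multiple of the minimal polynomials over $\mathbb F_q$ of $\beta,\beta^2,\dots,\beta^{\delta-1}$. Let $\mathcal C_\delta^\perp$ be its Euclidean dual, let $A=(a_{ij})$ be a nonsingular $2\times2$ matrix over $\mathbb F_q$, and let $$\mathcal C'_\delta=[\mathcal C_\delta,\mathcal C_\delta^\perp]A=\{(a_{11}u+a_{21}v,\;a_{12}u+a_{22}v): u\in\mathcal C_\delta,\ v\in\mathcal C_\delta^\perp\}.$$ Write $d(\cdot)$ for the minimum Hamming distance. Then $\mathcal C'_\delta$ is a $[2n,n]$ code, and the following hold. 1. If $m$ is odd, $q\ge\sqrt{2\lambda q}+\lambda s$ and $\delta=\frac{q^{(m+1)/2}-q}{\lambda}+s+1$,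 then $d(\mathcal C'_\delta)\ge\frac{q^{(m+1)/2}+\lambda-1}{\lambda}-sq^{(m-1)/2}>\sqrt{2n}$. Suppose in addition that both entries $a_{11},a_{12}$ of the first row of $A$ are nonzero. Then: 2. If $m$ is odd, $\lambda s\ge\sqrt{\lambda q/2}$ and $\max\bigl\{\frac{\sqrt{2n}}2,\frac{q^{(m-1)/2}-1}{\lambda}+(s-1)q^{(m-1)/2}\bigr\}<\delta\le\frac{q^{(m-1)/2}-1}{\lambda}+sq^{(m-1)/2}-1$, then $d(\mathcal C'_\delta)\ge\min\{2\delta,d(\mathcal C_\delta^\perp)\}$ with $d(\mathcal C_\delta^\perp)\ge\frac{q^{(m+1)/2}-1}{\lambda}-s+3$, and $\min\bigl\{2\delta,\frac{q^{(m+1)/2}-1}{\lambda}-s+3\bigr\}>\sqrt{2n}$. If $m$ is odd, $\lambda s\ge\sqrt{\lambda q/2}$ and $\delta=\frac{q^{(m-1)/2}-1}{\lambda}+sq^{(m-1)/2}$, the same holds with $-s+3$ replaced by $-s+2$ in both places. 3. If $m$ is odd and $\frac{q^{(m+1)/2}-1}{\lambda}-q^{(m-1)/2}<\delta\le\frac{q^{(m+1)/2}-q}{\lambda}+1$,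 then $d(\mathcal C'_\delta)\ge\frac{q^{(m+1)/2}-q}{\lambda}+2>\sqrt{2n}$. 4. If $m$ is even and $q^{m/2}-q^{(m-2)/2}-1<\delta\le q^{m/2}-q+1$, then $d(\mathcal C'_\delta)\ge2\delta$; moreover $2\delta>\sqrt{2n}$ if $q\ge4$. 5. Let $m$ be odd, $q\ge5$, $\lambda=1$ and $sq^{(m-1)/2}\le\delta\le(s+1)q^{(m-1)/2}-sq^{(m-3)/2}-2$. If $\sqrt{q/2}\le s\le q/2$, then $d(\mathcal C'_\delta)\ge2\delta>\sqrt{2n}$. If $q/2<s<q-2$, then $d(\mathcal C'_\delta)\ge q^{(m+1)/2}-s+3>\sqrt{2n}$. -/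

import Mathlib

open Polynomial

noncomputable section

/-- The polynomial `c₀ + c₁ X + ⋯ + c_{n-1} X^{n-1}` of a vector `c` of length `n`. -/
def codePoly (F : Type*) [Field F] (n : ℕ) : (Fin n → F) →ₗ[F] F[X] :=
  ∑ i : Fin n, (Polynomial.monomial (i : ℕ)) ∘ₗ (LinearMap.proj i)

/-- The cyclic code of length `n` generated by `g`: the vectors whose polynomial lies in the ideal
generated by `g` in `F[X] / (X ^ n - 1)`. -/
def cyclicCode {F : Type*} [Field F] (n : ℕ) (g : F[X]) : Submodule F (Fin n → F) :=
  ((Ideal.span {AdjoinRoot.mk (X ^ n - 1 : F[X]) g}).restrictScalars F).comap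
    ((AdjoinRoot.mkₐ (X ^ n - 1 : F[X])).toLinearMap ∘ₗ codePoly F n)

open Classical in
/-- The (monic) least common multiple of the minimal polynomials over `F` of
`β, β ^ 2, …, β ^ (δ - 1)`. -/
def bchGenerator (F : Type*) {K : Type*} [Field F] [Field K] [Algebra F K] (β : K) (δ : ℕ) :
    F[X] :=
  letI : NormalizedGCDMonoid F[X] := UniqueFactorizationMonoid.toNormalizedGCDMonoid F[X]
  (Finset.Ico 1 δ).lcm fun i => minpoly F (β ^ i)

/-- The narrow-sense BCH code over `F` of length `n` and designed distance `δ` with respect to the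
primitive `n`-th root of unity `β`. -/
def bchCode (F : Type*) {K : Type*} [Field F] [Field K] [Algebra F K] (n : ℕ) (β : K) (δ : ℕ) :
    Submodule F (Fin n → F) :=
  cyclicCode n (bchGenerator F β δ)

/-- The Euclidean dual of a linear code. -/
def dualCode {F ι : Type*} [Field F] [Fintype ι] (C : Submodule F (ι → F)) :
    Submodule F (ι → F) where
  carrier := {b | ∀ c ∈ C, b ⬝ᵥ c = 0}
  zero_mem' := fun c _ => zero_dotProduct c
  add_mem' := fun {a b} ha hb c hc => by rw [add_dotProduct, ha c hc, hb c hc, add_zero]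
  smul_mem' := fun r a ha c hc => by rw [smul_dotProduct, ha c hc, smul_zero]

/-- The minimum Hamming distance of a linear code, that is, the least Hamming weight of a nonzero
codeword (with value `0` for the zero code). -/
def minDist {F ι : Type*} [Field F] [DecidableEq F] [Fintype ι] (C : Submodule F (ι → F)) : ℕ :=
  sInf {w | ∃ c ∈ C, c ≠ 0 ∧ hammingNorm c = w}

/-- The linear map sending `(c₁, …, c_s)` to the concatenation of the `t` blocks
`∑ i, a_{i j} c_i`, where `j = 1, …, t`; the coordinate `(j, l)` is the `l`-th one of block `j`. -/
def matrixProductMap {F : Type*} [Field F] {s t n : ℕ} (A : Matrix (Fin s) (Fin t) F) :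
    (Fin s → Fin n → F) →ₗ[F] (Fin t × Fin n → F) where
  toFun c := fun p => ∑ i, A i p.1 * c i p.2
  map_add' c d := by
    funext p
    simp [mul_add, Finset.sum_add_distrib]
  map_smul' r c := by
    funext p
    simp [Finset.mul_sum, mul_left_comm]

/-- The matrix-product code `[C₁, …, C_s] A`, a linear code of length `t * n`. -/
def matrixProductCode {F : Type*} [Field F] {s t n : ℕ} (C : Fin s → Submodule F (Fin n → F))
    (A : Matrix (Fin s) (Fin t) F) : Submodule F (Fin t × Fin n → F) :=
  (Submodule.pi Set.univ C).map (matrixProductMap A)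

end

/-! ### Power sums, the BCH bound and the spectrum of a word of the dual code. -/

noncomputable section

/-! Since `A` is invertible, the dimensions of a code and its dual add up to the dimension `n` of
`C'`. At each coordinate the two blocks determine both `u` and `v`, so a word of `C'` weighs at
least as much as `u` and as `v`. If the first row of `A` has no zero entry, the words with `v = 0`
weigh exactly twice `u`. The BCH bound gives `δ` for `u`, so everything rests on lower bounds for
the weights of the dual code.

Let `b` be a nonzero word of the dual and call `e`, with `lam ∣ e`, spectral if the power sum `∑ b_l
α ^ (-e l)` is nonzero. By Delsarte duality every spectral exponent is `q`-conjugate to some `lam *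
t` with `1 ≤ t < δ`; modulo `q ^ m - 1`, conjugation is rotation of the `m` base `q` digits. If `p`
is spectral and `p + a_j - a_i` is not, for all `i < j`, then the matrix of power sums at `p + a_j -
a_i` is triangular and invertible and factors through the support of `b`, so the list `a` is at most
as long as the weight. `DualSpectrum` keeps only these facts; the rest is a search for long chains
`a`.

The chain of consecutive multiples of `lam` is the BCH bound for the gap above the largest spectral
exponent (`DualSpectrum.bch`). With the digit description of that gap it gives case 1, case 3, the
exceptional distance of case 2, and case 4 for `lam = 1`.

For the rest of case 2 and for case 5, let `p` be the largest spectral exponent in the leader range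
that is not divisible by `q`. If `p` is small, the BCH bound already improves. If `p` is large,
numbers `V q ^ (h+1) + u` with `V` free and `u` in a set with controlled differences form a long
chain (`odd_not_spec`, `odd_card_le`). In degree three the sets of `u` come from a maximality
argument when `q ≥ 22` and from finite certificates for smaller prime powers.

In case 4 with `lam ≥ 2`, the BCH bound fails only if a particular exponent just below a multiple of
`q ^ h` is spectral (`even_obstacle`). A maximal leader chosen relative to that obstacle starts a
chain made of one digit, `h` digits and `h - 1` digits (`even_card_le`). The hard situation is
degree four with `q = 2 lam + 1`, treated by sets of two-digit residues and, for `q ≤ 11`, by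
eliminating the possible cosets one after another. -/

theorem codePoly_apply {F : Type*} [Field F] {n : ℕ} (c : Fin n → F) :
    codePoly F n c = ∑ i : Fin n, monomial (i : ℕ) (c i) := by
  simp [codePoly]

theorem aeval_codePoly {F K : Type*} [Field F] [Field K] [Algebra F K] {n : ℕ}
    (c : Fin n → F) (x : K) :
    aeval x (codePoly F n c) = ∑ i : Fin n, algebraMap F K (c i) * x ^ (i : ℕ) := by
  simp [codePoly_apply, aeval_monomial]

theorem mem_cyclicCode_iff {F : Type*} [Field F] {n : ℕ} {g : F[X]} {c : Fin n → F} :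
    c ∈ cyclicCode n g ↔ ∃ h, (X ^ n - 1 : F[X]) ∣ codePoly F n c - g * h := by
  have : c ∈ cyclicCode n g ↔ AdjoinRoot.mk (X ^ n - 1 : F[X]) (codePoly F n c) ∈
      Ideal.span {AdjoinRoot.mk (X ^ n - 1 : F[X]) g} := Iff.rfl
  rw [this, Ideal.mem_span_singleton]
  constructor
  · rintro ⟨h, hh⟩
    obtain ⟨h, rfl⟩ := AdjoinRoot.mk_surjective h
    exact ⟨h, by rwa [← AdjoinRoot.mk_eq_mk, map_mul]⟩
  · rintro ⟨h, hh⟩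
    exact ⟨AdjoinRoot.mk _ h, by rwa [← AdjoinRoot.mk_eq_mk, map_mul] at hh⟩

theorem bchGenerator_dvd_iff {F K : Type*} [Field F] [Field K] [Algebra F K] [Finite K] {β : K}
    {δ : ℕ} {f : F[X]} :
    bchGenerator F β δ ∣ f ↔ ∀ t ∈ Finset.Ico 1 δ, aeval (β ^ t) f = 0 := by
  classical
  let _ : NormalizedGCDMonoid F[X] := UniqueFactorizationMonoid.toNormalizedGCDMonoid F[X]
  refine (Finset.lcm_dvd_iff (s := Finset.Ico 1 δ) (f := fun i => minpoly F (β ^ i))).trans ?_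
  refine forall₂_congr fun t _ => ?_
  constructor
  · rintro ⟨h, rfl⟩
    simp
  · exact minpoly.dvd F _

theorem mem_bchCode_iff {F K : Type*} [Field F] [Field K] [Algebra F K] [Finite K] {n δ : ℕ}
    {β : K} (hβ : β ^ n = 1) {c : Fin n → F} :
    c ∈ bchCode F n β δ ↔
      ∀ t ∈ Finset.Ico 1 δ, ∑ l : Fin n, algebraMap F K (c l) * (β ^ t) ^ (l : ℕ) = 0 := by
  rw [bchCode, mem_cyclicCode_iff]
  constructor
  · rintro ⟨h, k, hk⟩ t ht
    have h0 := bchGenerator_dvd_iff.1 (dvd_refl (bchGenerator F β δ)) t ht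
    have h1 := congrArg (aeval (β ^ t)) hk
    rw [← aeval_codePoly]
    have h2 : (β ^ t) ^ n = 1 := by rw [← pow_mul, mul_comm, pow_mul, hβ, one_pow]
    simpa [h0, h2] using h1
  · intro h
    obtain ⟨k, hk⟩ := (bchGenerator_dvd_iff (F := F) (β := β) (δ := δ) (f := codePoly F n c)).2
      fun t ht => by rw [aeval_codePoly]; exact h t ht
    exact ⟨k, by simp [← hk]⟩

/-- A family of spectral conditions satisfied by a nonzero word of weight `w` of the dual of a
BCH code; the exponents refer to a primitive element of the large field. -/
structure DualSpectrum (q m lam D w : ℕ) (Spec : ℕ → Prop) : Prop where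
  dvd : ∀ e, Spec e → lam ∣ e
  ex : ∃ e, Spec e
  add_period : ∀ e, Spec (e + (q ^ m - 1)) ↔ Spec e
  frob : ∀ e, Spec (q * e) ↔ Spec e
  lead : ∀ e, Spec e → ∃ r, 1 ≤ r ∧ r ≤ D ∧ Spec r ∧ ∃ j, r ≡ q ^ j * e [MOD q ^ m - 1]
  chain : ∀ p, Spec p → ∀ l : List ℕ, (∀ a ∈ l, lam ∣ a ∧ a < q ^ m - 1) →
    l.Pairwise (fun a a' => ¬ Spec (p + a' + (q ^ m - 1) - a)) → l.length ≤ w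

theorem sum_pow_eq_zero_of_pow_eq_one {K : Type*} [Field K] {n : ℕ} {x : K} (hx : x ^ n = 1)
    (hx1 : x ≠ 1) : ∑ l : Fin n, x ^ (l : ℕ) = 0 := by
  rw [Fin.sum_univ_eq_sum_range (fun i => x ^ i), geom_sum_eq hx1, hx, sub_self, zero_div]

/-- A triangular array of power sums with nonzero diagonal bounds the size of the support. -/
theorem le_hammingNorm_of_triangular {F K : Type*} [Field F] [DecidableEq F] [Field K]
    [Algebra F K] {n k : ℕ} (b : Fin n → F) {α : K} (hα : α ≠ 0) (p : ℤ)
    (hp : ∑ l : Fin n, algebraMap F K (b l) * α ^ (p * (l : ℕ)) ≠ 0) (a : Fin k → ℤ)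
    (ha : ∀ i j, i < j → ∑ l : Fin n, algebraMap F K (b l) * α ^ ((p + a j - a i) * (l : ℕ)) = 0) :
    k ≤ hammingNorm b := by
  classical
  -- The inner index runs over the support only, so the rank of the product is at most the weight of
  -- `b`.
  let X : Matrix (Fin k) {l : Fin n // b l ≠ 0} K := Matrix.of fun x l =>
    algebraMap F K (b l) * α ^ ((p - a x) * ((l : Fin n) : ℕ))
  let Y : Matrix {l : Fin n // b l ≠ 0} (Fin k) K := Matrix.of fun l y =>
    α ^ (a y * ((l : Fin n) : ℕ))
  have hXY : ∀ x y, (X * Y) x y =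
      ∑ l : Fin n, algebraMap F K (b l) * α ^ ((p + a y - a x) * (l : ℕ)) := by
    intro x y
    rw [Matrix.mul_apply, ← Finset.sum_filter_of_ne (p := fun l => b l ≠ 0),
      Finset.sum_subtype (p := fun l => b l ≠ 0) _ (by simp)]
    · refine Finset.sum_congr rfl fun l _ => ?_
      simp only [X, Y, Matrix.of_apply]
      rw [mul_assoc, ← zpow_add₀ hα]
      congr 2
      ring
    · intro l _ h h0
      exact h (by simp [h0])
  have hlow : (X * Y).IsLowerTriangular := by
    intro i j hij
    rw [hXY]
    exact ha i j hij
  have hdet : (X * Y).det ≠ 0 := by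
    rw [Matrix.det_of_isLowerTriangular _ hlow]
    refine Finset.prod_ne_zero_iff.2 fun i _ => ?_
    rw [hXY]
    simpa using hp
  have h1 := Matrix.rank_of_isUnit _ ((Matrix.isUnit_iff_isUnit_det _).2 hdet.isUnit)
  have h2 := (Matrix.rank_mul_le_left X Y).trans (Matrix.rank_le_card_width X)
  rw [h1, Fintype.card_fin, Fintype.card_subtype] at h2
  exact h2

/-- A support of fewer than `δ` points would make the first vanishing power sums a square
Vandermonde system with distinct nodes; absorbing one factor `β ^ l` into the unknown shifts the
exponents from `1, 2, …` to `0, 1, …`. -/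
theorem hammingNorm_ge_of_mem_bchCode {F K : Type*} [Field F] [DecidableEq F] [Field K]
    [Algebra F K] [Finite K] {n δ : ℕ} {β : K} (hβ : IsPrimitiveRoot β n) {c : Fin n → F}
    (hc : c ∈ bchCode F n β δ) (h0 : c ≠ 0) : δ ≤ hammingNorm c := by
  classical
  by_contra! hlt
  rw [mem_bchCode_iff hβ.pow_eq_one] at hc
  let S := {l : Fin n // c l ≠ 0}
  have hS : Fintype.card S = hammingNorm c := by
    rw [hammingNorm, Fintype.card_subtype]
  have hn : n ≠ 0 := by
    rintro rfl
    exact h0 (Subsingleton.elim _ _)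
  have hβ0 : β ≠ 0 := hβ.ne_zero hn
  let e : Fin (hammingNorm c) ≃ S := (Fintype.equivFinOfCardEq hS).symm
  have := Matrix.eq_zero_of_forall_pow_sum_mul_pow_eq_zero
    (f := fun j => β ^ ((e j : Fin n) : ℕ))
    (v := fun j => algebraMap F K (c (e j)) * β ^ ((e j : Fin n) : ℕ)) ?_ ?_
  · obtain ⟨l, hl⟩ := Function.ne_iff.1 h0
    have h2 := congrFun this (e.symm ⟨l, hl⟩)
    simp [hβ0] at h2
    exact hl h2
  · intro i j hij
    exact e.injective (Subtype.ext (Fin.ext (hβ.pow_inj (Fin.is_lt _) (Fin.is_lt _) hij)))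
  · intro i
    have := hc (i + 1) (by simp; omega)
    rw [← Finset.sum_filter_of_ne (p := fun l => c l ≠ 0),
      Finset.sum_subtype (p := fun l => c l ≠ 0) _ (by simp), ← e.sum_comp] at this
    · rw [← this]
      refine Finset.sum_congr rfl fun j _ => ?_
      rw [mul_assoc, ← pow_succ', ← pow_mul, ← pow_mul, mul_comm ((i : ℕ) + 1)]
    · intro l _ h h0
      exact h (by simp [h0])

theorem dualCode_eq_orthogonal {F ι : Type*} [Field F] [Fintype ι] (C : Submodule F (ι → F)) :
    dualCode C = LinearMap.BilinForm.orthogonal (dotProductBilin F F) C := by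
  ext b
  refine forall₂_congr fun c _ => ?_
  change b ⬝ᵥ c = 0 ↔ c ⬝ᵥ b = 0
  rw [dotProduct_comm]

theorem dotProductBilin_nondegenerate (F ι : Type*) [Field F] [Fintype ι] :
    (dotProductBilin F F : LinearMap.BilinForm F (ι → F)).Nondegenerate := by
  refine ⟨fun v hv => dotProduct_eq_zero v hv, fun v hv => dotProduct_eq_zero v fun w => ?_⟩
  rw [dotProduct_comm]
  exact hv w

theorem finrank_add_finrank_dualCode {F : Type*} [Field F] {n : ℕ} (C : Submodule F (Fin n → F)) :
    Module.finrank F C + Module.finrank F (dualCode C) = n := by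
  rw [dualCode_eq_orthogonal,
    LinearMap.BilinForm.finrank_orthogonal (dotProductBilin_nondegenerate F (Fin n))]
  have := Submodule.finrank_le C
  rw [Module.finrank_fin_fun] at *
  omega

/-- One half of Delsarte duality. Expanding the trace into conjugates turns each check of the BCH
code into geometric sums over `n`-th roots of unity. These vanish because no conjugate of `e` equals
a defining exponent `lam * t`. -/
theorem trace_word_mem_bchCode {F K : Type*} [Field F] [Fintype F] [Field K] [Algebra F K]
    [Finite K] {q m lam n δ : ℕ} {α : K} (hq : Fintype.card F = q)
    (hN : q ^ m - 1 = lam * n) (hα : IsPrimitiveRoot α (q ^ m - 1)) (hN0 : q ^ m - 1 ≠ 0)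
    {e : ℕ} (he : lam ∣ e)
    (h : ∀ j t, 1 ≤ t → t < δ → ¬ lam * t ≡ q ^ j * e [MOD q ^ m - 1]) (g : K) :
    (fun l : Fin n => Algebra.trace F K (g * α⁻¹ ^ (e * (l : ℕ)))) ∈
      bchCode F n (α ^ lam) δ := by
  have hα0 : α ≠ 0 := hα.ne_zero hN0
  rw [mem_bchCode_iff (by rw [← pow_mul, ← hN, hα.pow_eq_one])]
  intro t ht
  rw [Finset.mem_Ico] at ht
  simp_rw [FiniteField.algebraMap_trace_eq_sum_pow, Finset.sum_mul]
  rw [Finset.sum_comm]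
  refine Finset.sum_eq_zero fun k _ => ?_
  rw [Nat.card_eq_fintype_card, hq]
  have h1 : ∀ l : Fin n, (g * α⁻¹ ^ (e * (l : ℕ))) ^ q ^ k * ((α ^ lam) ^ t) ^ (l : ℕ) =
      g ^ q ^ k * (α⁻¹ ^ (q ^ k * e) * α ^ (lam * t)) ^ (l : ℕ) := by
    intro l
    rw [mul_pow, mul_pow, ← pow_mul, ← pow_mul, ← pow_mul, ← pow_mul, ← pow_mul]
    rw [show e * (l : ℕ) * q ^ k = q ^ k * e * l by ring]
    ring
  simp_rw [h1]
  rw [← Finset.mul_sum, sum_pow_eq_zero_of_pow_eq_one, mul_zero]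
  · obtain ⟨c, rfl⟩ := he
    rw [mul_pow, ← pow_mul, ← pow_mul, show q ^ k * (lam * c) * n = (lam * n) * (q ^ k * c) by ring,
      show lam * t * n = lam * n * t by ring, ← hN, pow_mul, pow_mul, inv_pow, hα.pow_eq_one,
      pow_mul, hα.pow_eq_one]
    simp
  · intro h2
    refine h k t ht.1 ht.2 ?_
    rw [inv_pow, inv_mul_eq_one₀ (pow_ne_zero _ hα0)] at h2
    have hfin : IsOfFinOrder α :=
      isOfFinOrder_iff_pow_eq_one.2 ⟨_, Nat.pos_of_ne_zero hN0, hα.pow_eq_one⟩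
    rw [hα.eq_orderOf]
    exact (hfin.pow_eq_pow_iff_modEq.1 h2).symm

/-- The power sum `∑ l, b_l γ ^ (e l)` of a word. -/
def wordSum {F K : Type*} [Field F] [Field K] [Algebra F K] {n : ℕ} (b : Fin n → F) (γ : K) (e : ℕ) : K :=
  ∑ l : Fin n, algebraMap F K (b l) * γ ^ (e * (l : ℕ))

theorem wordSum_congr {F K : Type*} [Field F] [Field K] [Algebra F K] {n : ℕ} (b : Fin n → F) {γ : K} {N e e' : ℕ} (hγ : γ ^ N = 1)
    (h : e ≡ e' [MOD N]) : wordSum b γ e = wordSum b γ e' := by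
  refine Finset.sum_congr rfl fun l _ => ?_
  rw [pow_mul, pow_mul, pow_eq_pow_of_modEq h hγ]

theorem wordSum_mul {F K : Type*} [Field F] [Fintype F] [Field K] [Algebra F K] {q n : ℕ}
    (hq : Fintype.card F = q) (b : Fin n → F) (γ : K) (e : ℕ) :
    wordSum b γ (q * e) = wordSum b γ e ^ q := by
  obtain ⟨p, hp⟩ := CharP.exists F
  have := Fact.mk (CharP.char_is_prime F p)
  have : CharP K p := charP_of_injective_algebraMap (algebraMap F K).injective p
  obtain ⟨k, _, hk⟩ := FiniteField.card F p
  rw [hq] at hk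
  rw [wordSum, wordSum, hk, sum_pow_char_pow]
  refine Finset.sum_congr rfl fun l _ => ?_
  rw [mul_pow, ← map_pow, ← hk, ← hq, FiniteField.pow_card, hq, ← pow_mul]
  congr 2
  ring

theorem exists_wordSum_ne_zero {F K : Type*} [Field F] [Field K] [Algebra F K] {lam n : ℕ} {γ : K} (hγ : IsPrimitiveRoot (γ ^ lam) n) {b : Fin n → F}
    (hb0 : b ≠ 0) : ∃ i, wordSum b γ (lam * i) ≠ 0 := by
  by_contra! h
  refine hb0 ?_
  have := Matrix.eq_zero_of_forall_pow_sum_mul_pow_eq_zero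
    (f := fun j : Fin n => (γ ^ lam) ^ (j : ℕ))
    (v := fun j => algebraMap F K (b j)) ?_ ?_
  · funext l
    simpa using congrFun this l
  · intro i j hij
    exact Fin.ext (hγ.pow_inj i.is_lt j.is_lt hij)
  · intro i
    rw [← h i]
    refine Finset.sum_congr rfl fun l _ => ?_
    rw [← pow_mul, ← pow_mul]
    congr 2
    ring

/-- Orthogonality to the trace words for all `g` says that the power sum is orthogonal to all of `K`
under the trace form, which is nondegenerate. -/
theorem wordSum_eq_zero_of_mem_dualCode {F K : Type*} [Field F] [Fintype F] [Field K]
    [Algebra F K] [Finite K] {q m lam n δ : ℕ} {α : K} (hq : Fintype.card F = q)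
    (hN : q ^ m - 1 = lam * n) (hα : IsPrimitiveRoot α (q ^ m - 1)) (hN0 : q ^ m - 1 ≠ 0)
    {b : Fin n → F} (hb : b ∈ dualCode (bchCode F n (α ^ lam) δ)) {e : ℕ} (he : lam ∣ e)
    (h : ∀ j t, 1 ≤ t → t < δ → ¬ lam * t ≡ q ^ j * e [MOD q ^ m - 1]) :
    wordSum b α⁻¹ e = 0 := by
  have htr : ∀ g : K, Algebra.traceForm F K (wordSum b α⁻¹ e) g = 0 := by
    intro g
    have h1 := hb _ (trace_word_mem_bchCode hq hN hα hN0 he h g)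
    rw [wordSum, Algebra.traceForm_apply, Finset.sum_mul, map_sum, ← h1, dotProduct]
    refine Finset.sum_congr rfl fun l _ => ?_
    rw [mul_assoc, ← Algebra.smul_def, map_smul, smul_eq_mul, mul_comm g]
  exact (traceForm_nondegenerate F K).1 _ htr

theorem length_le_hammingNorm_of_wordSum {F K : Type*} [Field F] [DecidableEq F] [Field K]
    [Algebra F K] {n : ℕ} {γ : K} {N : ℕ} (hγ0 : γ ≠ 0) (hγ : γ ^ N = 1)
    (b : Fin n → F) {p : ℕ} (hp : wordSum b γ p ≠ 0) (L : List ℕ) (hN : ∀ a ∈ L, a < N)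
    (hL : L.Pairwise fun a a' => wordSum b γ (p + a' + N - a) = 0) :
    L.length ≤ hammingNorm b := by
  have hcast : ∀ e : ℕ, wordSum b γ e =
      ∑ l : Fin n, algebraMap F K (b l) * γ ^ ((e : ℤ) * (l : ℕ)) := by
    intro e
    refine Finset.sum_congr rfl fun l _ => ?_
    rw [← zpow_natCast, Nat.cast_mul]
  refine le_hammingNorm_of_triangular b hγ0 p (by rwa [← hcast])
    (fun i : Fin L.length => (L[i] : ℤ)) fun i j hij => ?_
  have h1 := List.pairwise_iff_getElem.1 hL i j i.is_lt j.is_lt hij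
  have hi := hN L[i] (List.getElem_mem _)
  rw [← h1, hcast]
  refine Finset.sum_congr rfl fun l _ => ?_
  congr 1
  have h4 : ((p + L[j] + N - L[i] : ℕ) : ℤ) = ((p : ℤ) + L[j] - L[i]) + (N : ℕ) := by omega
  change _ = γ ^ (((p + L[j] + N - L[i] : ℕ) : ℤ) * ((l : ℕ) : ℤ))
  rw [h4, add_mul, zpow_add₀ hγ0, zpow_mul γ (N : ℤ), zpow_natCast γ N, hγ, one_zpow, mul_one]

/-- The bridge from coding theory to combinatorics. Exponents are kept as multiples of `lam`, with
modulus `q ^ m - 1`, so that conjugation stays a digit rotation although the code has length `n`. -/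
theorem dualSpectrum {F K : Type*} [Field F] [Fintype F] [DecidableEq F] [Field K] [Algebra F K]
    [Finite K] {q m lam n δ : ℕ} {α : K} (hq : Fintype.card F = q) (hlam : lam ∣ q - 1)
    (hN : q ^ m - 1 = lam * n) (hα : IsPrimitiveRoot α (q ^ m - 1)) (hN0 : q ^ m - 1 ≠ 0)
    {b : Fin n → F} (hb : b ∈ dualCode (bchCode F n (α ^ lam) δ)) (hb0 : b ≠ 0) :
    DualSpectrum q m lam (lam * (δ - 1)) (hammingNorm b) fun e =>
      lam ∣ e ∧ wordSum b α⁻¹ e ≠ 0 := by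
  have hα0 : α ≠ 0 := hα.ne_zero hN0
  have hinv : IsPrimitiveRoot α⁻¹ (q ^ m - 1) := hα.inv
  have hq1 : 1 < q := hq ▸ Fintype.one_lt_card
  have hcop : Nat.Coprime lam q := by
    refine Nat.Coprime.coprime_dvd_left hlam ?_
    rw [Nat.coprime_self_sub_left hq1.le]
    exact Nat.coprime_one_left q
  have hdvd : ∀ e e' : ℕ, e ≡ e' [MOD q ^ m - 1] → lam ∣ e → lam ∣ e' := fun e e' h =>
    (h.dvd_iff (hN ▸ dvd_mul_right lam n)).1
  constructor
  · exact fun e he => he.1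
  · obtain ⟨i, hi⟩ := exists_wordSum_ne_zero (lam := lam) (γ := α⁻¹)
      (hinv.pow (Nat.pos_of_ne_zero hN0) hN) hb0
    exact ⟨_, dvd_mul_right _ _, hi⟩
  · intro e
    have h : e + (q ^ m - 1) ≡ e [MOD q ^ m - 1] := by simp [Nat.ModEq]
    rw [wordSum_congr b hinv.pow_eq_one h]
    exact and_congr_left fun _ => ⟨hdvd _ _ h, hdvd _ _ h.symm⟩
  · intro e
    rw [wordSum_mul hq, hcop.dvd_mul_left, Ne, pow_eq_zero_iff (by omega)]
  · rintro e ⟨he, hs⟩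
    by_cases h : ∃ j t, 1 ≤ t ∧ t < δ ∧ lam * t ≡ q ^ j * e [MOD q ^ m - 1]
    · obtain ⟨j, t, h1, h2, h3⟩ := h
      have hlam0 : 0 < lam := Nat.pos_of_ne_zero (by rintro rfl; simp at hN; omega)
      refine ⟨lam * t, Nat.mul_pos hlam0 h1, Nat.mul_le_mul_left _ (by omega),
        ⟨dvd_mul_right _ _, ?_⟩, j, h3⟩
      rw [wordSum_congr b hinv.pow_eq_one h3]
      clear h3
      induction j with
      | zero => simpa using hs
      | succ j ih =>
        rw [pow_succ', mul_assoc, wordSum_mul hq]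
        exact pow_ne_zero _ ih
    · push Not at h
      exact absurd (wordSum_eq_zero_of_mem_dualCode hq hN hα hN0 hb he h) hs
  · rintro p ⟨hp, hps⟩ L hL1 hL2
    refine length_le_hammingNorm_of_wordSum (inv_ne_zero hα0) hinv.pow_eq_one b hps L
      (fun a ha => (hL1 a ha).2) ?_
    refine hL2.imp_of_mem fun {a a'} ha ha' h => ?_
    by_contra h1
    refine h ⟨?_, h1⟩
    exact Nat.dvd_sub (dvd_add (dvd_add hp (hL1 _ ha').1) (hN ▸ dvd_mul_right _ _)) (hL1 _ ha).1

/-! ### Dimension and weights of two-block matrix-product codes. -/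

section MatrixProduct

variable {F : Type*} [Field F] {n : ℕ}

theorem matrixProductMap_two (A : Matrix (Fin 2) (Fin 2) F) (c : Fin 2 → Fin n → F)
    (j : Fin 2) (l : Fin n) :
    matrixProductMap A c (j, l) = A 0 j * c 0 l + A 1 j * c 1 l := by
  simp [matrixProductMap]

theorem eq_zero_of_matrixProductMap_eq_zero {A : Matrix (Fin 2) (Fin 2) F} (hA : A.det ≠ 0)
    {c : Fin 2 → Fin n → F} {l : Fin n} (h : ∀ j, matrixProductMap A c (j, l) = 0) (i : Fin 2) :
    c i l = 0 := by
  refine congrFun (Matrix.eq_zero_of_vecMul_eq_zero (v := fun i => c i l) hA ?_) i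
  funext j
  have := h j
  rw [matrixProductMap_two] at this
  simpa [Matrix.vecMul, dotProduct, mul_comm] using this

theorem matrixProductMap_injective {A : Matrix (Fin 2) (Fin 2) F} (hA : A.det ≠ 0) :
    Function.Injective (matrixProductMap (n := n) A) := by
  rw [← LinearMap.ker_eq_bot, LinearMap.ker_eq_bot']
  intro c hc
  funext i l
  exact eq_zero_of_matrixProductMap_eq_zero hA (fun j => congrFun hc (j, l)) i

theorem mem_matrixProductCode_two {C₁ C₂ : Submodule F (Fin n → F)}
    {A : Matrix (Fin 2) (Fin 2) F} {x : Fin 2 × Fin n → F} :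
    x ∈ matrixProductCode ![C₁, C₂] A ↔
      ∃ u ∈ C₁, ∃ v ∈ C₂, matrixProductMap A ![u, v] = x := by
  rw [matrixProductCode, Submodule.mem_map]
  constructor
  · rintro ⟨c, hc, rfl⟩
    refine ⟨c 0, hc 0 trivial, c 1, hc 1 trivial, ?_⟩
    congr 1
    funext i
    fin_cases i <;> rfl
  · rintro ⟨u, hu, v, hv, rfl⟩
    refine ⟨_, fun i _ => ?_, rfl⟩
    fin_cases i
    · exact hu
    · exact hv

theorem finrank_matrixProductCode {A : Matrix (Fin 2) (Fin 2) F} (hA : A.det ≠ 0)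
    (C₁ C₂ : Submodule F (Fin n → F)) :
    Module.finrank F (matrixProductCode ![C₁, C₂] A) =
      Module.finrank F C₁ + Module.finrank F C₂ := by
  let p : C₁ × C₂ →ₗ[F] (Fin 2 → Fin n → F) := LinearMap.pi
    ![C₁.subtype ∘ₗ LinearMap.fst F C₁ C₂, C₂.subtype ∘ₗ LinearMap.snd F C₁ C₂]
  have hp : ∀ y, p y = ![(y.1 : Fin n → F), y.2] := by
    intro y
    funext i
    fin_cases i <;> rfl
  have hinj : Function.Injective (matrixProductMap A ∘ₗ p) := by
    intro y z h
    have h1 := matrixProductMap_injective hA h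
    rw [hp, hp] at h1
    exact Prod.ext (Subtype.ext (congrFun h1 0)) (Subtype.ext (congrFun h1 1))
  have hrange : LinearMap.range (matrixProductMap A ∘ₗ p) = matrixProductCode ![C₁, C₂] A := by
    ext x
    rw [mem_matrixProductCode_two]
    constructor
    · rintro ⟨y, rfl⟩
      exact ⟨y.1, y.1.2, y.2, y.2.2, by rw [LinearMap.comp_apply, hp]⟩
    · rintro ⟨u, hu, v, hv, rfl⟩
      exact ⟨(⟨u, hu⟩, ⟨v, hv⟩), by rw [LinearMap.comp_apply, hp]⟩
  rw [← hrange, LinearMap.finrank_range_of_inj hinj, Module.finrank_prod]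

variable [DecidableEq F]

theorem hammingNorm_two_blocks (x : Fin 2 × Fin n → F) :
    hammingNorm x = hammingNorm (fun l => x (0, l)) + hammingNorm (fun l => x (1, l)) := by
  simp only [hammingNorm, Finset.card_filter]
  rw [Fintype.sum_prod_type, Fin.sum_univ_two]

/-- A coordinate where both blocks vanish is a zero of every component, as `A` is invertible; the
support of `c i` is thus covered by the supports of the blocks. -/
theorem hammingNorm_le_matrixProductMap {A : Matrix (Fin 2) (Fin 2) F} (hA : A.det ≠ 0)
    (c : Fin 2 → Fin n → F) (i : Fin 2) :
    hammingNorm (c i) ≤ hammingNorm (matrixProductMap A c) := by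
  rw [hammingNorm_two_blocks]
  refine le_trans (Finset.card_le_card ?_) (Finset.card_union_le _ _)
  intro l hl
  rw [Finset.mem_union, Finset.mem_filter_univ, Finset.mem_filter_univ]
  rw [Finset.mem_filter_univ] at hl
  by_contra! h
  refine hl (eq_zero_of_matrixProductMap_eq_zero hA (fun j => ?_) i)
  fin_cases j
  · exact h.1
  · exact h.2

theorem hammingNorm_matrixProductMap_left {A : Matrix (Fin 2) (Fin 2) F} (hA : ∀ j, A 0 j ≠ 0)
    (u : Fin n → F) : hammingNorm (matrixProductMap A ![u, 0]) = 2 * hammingNorm u := by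
  rw [hammingNorm_two_blocks, two_mul]
  congr 1 <;>
  · simp only [hammingNorm]
    congr 1
    ext l
    simp [matrixProductMap_two, hA]

theorem le_minDist {ι : Type*} [Fintype ι] {C : Submodule F (ι → F)} {T : ℕ} (hC : C ≠ ⊥)
    (h : ∀ c ∈ C, c ≠ 0 → T ≤ hammingNorm c) : T ≤ minDist C := by
  obtain ⟨c, hc, h0⟩ := Submodule.exists_mem_ne_zero_of_ne_bot hC
  refine le_csInf ⟨_, c, hc, h0, rfl⟩ ?_
  rintro w ⟨c, hc, h0, rfl⟩
  exact h c hc h0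

theorem minDist_le {ι : Type*} [Fintype ι] {C : Submodule F (ι → F)} {c : ι → F} (hc : c ∈ C)
    (h0 : c ≠ 0) : minDist C ≤ hammingNorm c :=
  Nat.sInf_le ⟨c, hc, h0, rfl⟩

theorem le_minDist_matrixProductCode {A : Matrix (Fin 2) (Fin 2) F} (hA : A.det ≠ 0)
    {C₁ C₂ : Submodule F (Fin n → F)} (hC : matrixProductCode ![C₁, C₂] A ≠ ⊥) {T : ℕ}
    (h₁ : ∀ u ∈ C₁, u ≠ 0 → T ≤ hammingNorm u) (h₂ : ∀ v ∈ C₂, v ≠ 0 → T ≤ hammingNorm v) :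
    T ≤ minDist (matrixProductCode ![C₁, C₂] A) := by
  refine le_minDist hC fun x hx h0 => ?_
  obtain ⟨u, hu, v, hv, rfl⟩ := mem_matrixProductCode_two.1 hx
  by_cases hv0 : v = 0
  · have hu0 : u ≠ 0 := by
      rintro rfl
      refine h0 ?_
      rw [hv0, show (![0, 0] : Fin 2 → Fin n → F) = 0 by funext i; fin_cases i <;> rfl, map_zero]
    exact (h₁ u hu hu0).trans (hammingNorm_le_matrixProductMap hA ![u, v] 0)
  · exact (h₂ v hv hv0).trans (hammingNorm_le_matrixProductMap hA ![u, v] 1)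

/-- The factor two is needed only for words with `v = 0`, where both blocks are nonzero multiples of
`u`; as soon as `v ≠ 0`, the weight of `v` alone suffices. -/
theorem le_minDist_matrixProductCode' {A : Matrix (Fin 2) (Fin 2) F} (hA : A.det ≠ 0)
    (hA0 : ∀ j, A 0 j ≠ 0)
    {C₁ C₂ : Submodule F (Fin n → F)} (hC : matrixProductCode ![C₁, C₂] A ≠ ⊥) {T : ℕ}
    (h₁ : ∀ u ∈ C₁, u ≠ 0 → T ≤ 2 * hammingNorm u) (h₂ : ∀ v ∈ C₂, v ≠ 0 → T ≤ hammingNorm v) :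
    T ≤ minDist (matrixProductCode ![C₁, C₂] A) := by
  refine le_minDist hC fun x hx h0 => ?_
  obtain ⟨u, hu, v, hv, rfl⟩ := mem_matrixProductCode_two.1 hx
  by_cases hv0 : v = 0
  · subst hv0
    have hu0 : u ≠ 0 := by
      rintro rfl
      refine h0 ?_
      rw [show (![0, 0] : Fin 2 → Fin n → F) = 0 by funext i; fin_cases i <;> rfl, map_zero]
    rw [hammingNorm_matrixProductMap_left hA0]
    exact h₁ u hu hu0
  · exact (h₂ v hv hv0).trans (hammingNorm_le_matrixProductMap hA ![u, v] 1)

end MatrixProduct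

/-- A trivial dual would make the BCH code the whole space, but the first unit vector has power sum
`1` at `β`. Nontriviality matters because `minDist` is `0` on the zero code. -/
theorem dualCode_bchCode_ne_bot {F K : Type*} [Field F] [Field K] [Algebra F K] [Finite K]
    {n δ : ℕ} {β : K} (hβ : β ^ n = 1) (hn : 0 < n) (hδ : 2 ≤ δ) :
    dualCode (bchCode F n β δ) ≠ ⊥ := by
  intro h
  have h1 := finrank_add_finrank_dualCode (bchCode F n β δ)
  rw [h, finrank_bot, add_zero] at h1
  have h2 : bchCode F n β δ = ⊤ := Submodule.eq_top_of_finrank_eq (by rw [h1, Module.finrank_fin_fun])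
  have h3 : Pi.single ⟨0, hn⟩ 1 ∈ bchCode F n β δ := h2 ▸ Submodule.mem_top
  rw [mem_bchCode_iff hβ] at h3
  have h4 := h3 1 (by simp; omega)
  rw [Finset.sum_eq_single ⟨0, hn⟩ (fun l _ hl => by simp [Pi.single_eq_of_ne hl]) (by simp)] at h4
  simp at h4
end

/-! ### Consequences of the spectral axioms: rotations, chains and the BCH gap. -/

theorem List.sum_length_filter_mod (lam : ℕ) (hlam : 0 < lam) (L : List ℕ) :
    ∑ c ∈ Finset.range lam, (L.filter fun a => a % lam = c).length = L.length := by
  induction L with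
  | nil => simp
  | cons a L ih =>
    have h : ∀ c, ((a :: L).filter fun a => a % lam = c).length =
        (L.filter fun a => a % lam = c).length + if a % lam = c then 1 else 0 := by
      intro c
      by_cases hc : a % lam = c <;> simp [hc]
    simp_rw [h]
    rw [Finset.sum_add_distrib, ih, Finset.sum_ite_eq]
    simp [Nat.mod_lt _ hlam]

namespace DualSpectrum

variable {q m lam D w : ℕ} {Spec : ℕ → Prop}

theorem congr (h : DualSpectrum q m lam D w Spec) {e e' : ℕ} (he : e ≡ e' [MOD q ^ m - 1]) :
    Spec e ↔ Spec e' := by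
  have key : ∀ k e, Spec (e + (q ^ m - 1) * k) ↔ Spec e := by
    intro k
    induction k with
    | zero => intro e; simp
    | succ k ih =>
      intro e
      rw [Nat.mul_succ, ← add_assoc, h.add_period, ih]
  have h2 : ∀ e, Spec e ↔ Spec (e % (q ^ m - 1)) := by
    intro e
    conv_lhs => rw [← Nat.mod_add_div e (q ^ m - 1)]
    rw [key]
  rw [h2 e, h2 e', he]

theorem pow_mul (h : DualSpectrum q m lam D w Spec) (k e : ℕ) : Spec (q ^ k * e) ↔ Spec e := by
  induction k with
  | zero => simp
  | succ k ih => rw [pow_succ', mul_assoc, h.frob, ih]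

/-- Multiplication by `q ^ (m - k)` modulo `q ^ m - 1` moves the `k` lowest digits to the top. So
each spectral exponent has a rotation, with explicit digits, that is at most `D`. -/
theorem lead_rot (h : DualSpectrum q m lam D w Spec) (hq : 2 ≤ q) (hm : 0 < m)
    (hD : D < q ^ m - 1) {e : ℕ} (he : Spec e) (heN : e < q ^ m - 1) :
    ∃ k, 1 ≤ k ∧ k ≤ m ∧ 1 ≤ (e % q ^ k) * q ^ (m - k) + e / q ^ k ∧
      (e % q ^ k) * q ^ (m - k) + e / q ^ k ≤ D ∧
      Spec ((e % q ^ k) * q ^ (m - k) + e / q ^ k) := by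
  obtain ⟨r, hr1, hrD, hr, j, hj⟩ := h.lead e he
  have hpow : q ^ m ≡ 1 [MOD q ^ m - 1] :=
    ((Nat.modEq_iff_dvd' (Nat.one_le_pow _ _ (by omega))).2 (dvd_refl _)).symm
  have hjm : j % m < m := Nat.mod_lt _ hm
  have hj' : r ≡ q ^ (j % m) * e [MOD q ^ m - 1] := by
    refine hj.trans ?_
    refine Nat.ModEq.mul_right _ ?_
    conv_lhs => rw [← Nat.div_add_mod j m, pow_add, _root_.pow_mul]
    simpa using (hpow.pow (j / m)).mul_right (q ^ (j % m))
  have hkm : m - (m - j % m) = j % m := by omega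
  refine ⟨m - j % m, by omega, by omega, ?_⟩
  rw [hkm]
  set k := m - j % m with hk
  set r' := e % q ^ k * q ^ (j % m) + e / q ^ k with hr'
  have hmk : q ^ m = q ^ k * q ^ (j % m) := by rw [← pow_add]; congr 1; omega
  have hrr : r' ≡ q ^ (j % m) * e [MOD q ^ m - 1] := by
    have : q ^ (j % m) * e = e % q ^ k * q ^ (j % m) + q ^ m * (e / q ^ k) := by
      conv_lhs => rw [← Nat.mod_add_div e (q ^ k)]
      rw [hmk]; ring
    rw [this, hr']
    refine Nat.ModEq.add_left _ ?_
    simpa using (hpow.mul_right (e / q ^ k)).symm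
  -- A rotation consists only of digits `q - 1` exactly when the original does, and `e < q ^ m - 1`
  -- excludes this. The rotated number is therefore the reduced residue and equals `r`.
  have hlt : r' < q ^ m - 1 := by
    have h1 : e % q ^ k < q ^ k := Nat.mod_lt _ (by positivity)
    have h2 : e / q ^ k < q ^ (j % m) := by
      rw [Nat.div_lt_iff_lt_mul (by positivity)]
      rw [hmk] at heN
      have := Nat.sub_le (q ^ k * q ^ (j % m)) 1
      rw [mul_comm]
      omega
    have h3 : r' ≠ q ^ m - 1 := by
      intro h4
      have h8 := Nat.div_add_mod e (q ^ k)
      rw [hr', hmk] at h4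
      rw [hmk] at heN
      obtain ⟨c, hc⟩ := Nat.exists_eq_add_of_lt h1
      obtain ⟨d, hd⟩ := Nat.exists_eq_add_of_lt h2
      generalize e % q ^ k = x at *
      generalize e / q ^ k = y at *
      rw [hc, hd] at h4
      have h5 : (x + c + 1) * (y + d + 1) - 1 = x * (y + d + 1) + y + (d + c * (y + d + 1)) := by
        rw [show (x + c + 1) * (y + d + 1) = x * (y + d + 1) + y + (d + c * (y + d + 1)) + 1 by ring,
          Nat.add_sub_cancel]
      have h6 : d + c * (y + d + 1) = 0 := by omega
      have hd0 : d = 0 := by omega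
      have hc0 : c = 0 := by
        rw [hd0, zero_add] at h6
        rcases Nat.mul_eq_zero.1 h6 with h | h <;> omega
      subst hd0 hc0
      rw [hc, hd, ← h8, hc, show (x + 0 + 1) * (y + 0 + 1) = (x + 0 + 1) * y + x + 1 by ring] at heN
      omega
    have h4 : r' < q ^ m := by
      have := Nat.mul_le_mul_right (q ^ (j % m)) h1
      rw [← hmk, Nat.succ_mul] at this
      omega
    omega
  have heq : r' = r := by
    have := (hrr.trans hj'.symm)
    rwa [Nat.ModEq, Nat.mod_eq_of_lt hlt, Nat.mod_eq_of_lt (by omega)] at this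
  rw [heq]
  exact ⟨hr1, hrD, hr⟩

theorem not_zero (h : DualSpectrum q m lam D w Spec) (hD : D < q ^ m - 1) : ¬ Spec 0 := by
  intro h0
  obtain ⟨r, hr1, hrD, -, j, hj⟩ := h.lead 0 h0
  rw [mul_zero, Nat.ModEq, Nat.mod_eq_of_lt (by omega), Nat.zero_mod] at hj
  omega

/-- Splitting an arbitrary list by residues modulo `lam` and subtracting the residue leaves `lam`
chains of multiples of `lam`, each of length at most `w`. This frees later constructions from
divisibility conditions, at the price of bounding `lam * w`. -/
theorem list_length_le (h : DualSpectrum q m lam D w Spec) (hlam : 0 < lam) {p : ℕ} (hp : Spec p)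
    (L : List ℕ) (hL : ∀ a ∈ L, a < q ^ m - 1)
    (hL' : L.Pairwise fun a a' => a % lam = a' % lam → ¬ Spec (p + a' + (q ^ m - 1) - a)) :
    L.length ≤ lam * w := by
  rw [← List.sum_length_filter_mod lam hlam L]
  refine (Finset.sum_le_card_nsmul _ _ w fun c _ => ?_).trans (by simp)
  have h1 := h.chain p hp ((L.filter fun a => a % lam = c).map fun a => a - c) ?_ ?_
  · simpa using h1
  · intro a ha
    simp only [List.mem_map, List.mem_filter, decide_eq_true_eq] at ha
    obtain ⟨a, ⟨ha, rfl⟩, rfl⟩ := ha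
    exact ⟨Nat.dvd_sub_mod a, (Nat.sub_le _ _).trans_lt (hL a ha)⟩
  · rw [List.pairwise_map]
    refine (hL'.filter _).imp_of_mem fun {a a'} ha ha' h2 => ?_
    simp only [List.mem_filter, decide_eq_true_eq] at ha ha'
    have h3 := h2 (ha.2.trans ha'.2.symm)
    have h4 : p + (a' - c) + (q ^ m - 1) - (a - c) = p + a' + (q ^ m - 1) - a := by
      have := Nat.mod_le a lam
      have := Nat.mod_le a' lam
      omega
    rwa [h4]

theorem card_le (h : DualSpectrum q m lam D w Spec) (hlam : 0 < lam) {p : ℕ} (hp : Spec p)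
    (A : Finset ℕ) (hA : ∀ a ∈ A, a < q ^ m - 1)
    (hA' : ∀ a ∈ A, ∀ a' ∈ A, a' < a → a % lam = a' % lam → ¬ Spec (p + (a - a'))) :
    A.card ≤ lam * w := by
  rw [← Finset.length_sort (· ≤ ·) (s := A)]
  refine h.list_length_le hlam hp _ (fun a ha => hA a (by simpa using ha)) ?_
  have h1 : (A.sort (· ≤ ·)).Pairwise (· < ·) := (Finset.sortedLT_sort A).pairwise
  refine h1.imp_of_mem fun {a a'} ha ha' hlt hmod => ?_
  have h2 := hA' a' (by simpa using ha') a (by simpa using ha) hlt hmod.symm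
  rwa [show p + a' + (q ^ m - 1) - a = p + (a' - a) + (q ^ m - 1) by omega, h.add_period]

/-- The BCH bound applied to the gap above the largest exponent of the spectrum. -/
theorem bch (h : DualSpectrum q m lam D w Spec) (hlam : 0 < lam) (hlamN : lam ∣ q ^ m - 1)
    (hD : D < q ^ m - 1) {g : ℕ}
    (hg : ∀ e, Spec e → e < q ^ m - 1 → e + g ≤ q ^ m - 1) : g + lam ≤ lam * w := by
  classical
  obtain ⟨e, he⟩ := h.ex
  have hN0 : 0 < q ^ m - 1 := by omega
  have hex : ∃ e, e < q ^ m - 1 ∧ Spec e :=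
    ⟨e % (q ^ m - 1), Nat.mod_lt _ hN0, (h.congr (Nat.mod_modEq _ _)).2 he⟩
  obtain ⟨e₀, he₀, he₀'⟩ := hex
  set p := Nat.findGreatest (fun e => e < q ^ m - 1 ∧ Spec e) (q ^ m - 1) with hpdef
  have hp : p < q ^ m - 1 ∧ Spec p :=
    Nat.findGreatest_spec (P := fun e => e < q ^ m - 1 ∧ Spec e) he₀.le ⟨he₀, he₀'⟩
  have hmax : ∀ e, p < e → e < q ^ m - 1 → ¬ Spec e := fun e h1 h2 h3 =>
    absurd ⟨h2, h3⟩ (Nat.findGreatest_is_greatest h1 h2.le)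
  have hpg := hg p hp.2 hp.1
  have hdvd : lam ∣ q ^ m - 1 - p := Nat.dvd_sub hlamN (h.dvd p hp.2)
  obtain ⟨k, hk⟩ := hdvd
  -- The last term reaches exponent `q ^ m - 1`, that is `0`, which is not spectral either. This
  -- extra step is the summand `lam` in the bound.
  have h1 := h.chain p hp.2 ((List.range (k + 1)).map (lam * ·)) ?_ ?_
  · rw [List.length_map, List.length_range] at h1
    have := Nat.mul_le_mul_left lam h1
    rw [Nat.mul_succ] at this
    omega
  · intro a ha
    simp only [List.mem_map, List.mem_range] at ha
    obtain ⟨i, hi, rfl⟩ := ha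
    refine ⟨dvd_mul_right _ _, ?_⟩
    have := Nat.mul_le_mul_left lam (Nat.lt_succ_iff.1 hi)
    have : p ≠ 0 := by
      intro h0
      exact h.not_zero hD (h0 ▸ hp.2)
    omega
  · rw [List.pairwise_map]
    refine List.pairwise_lt_range.imp_of_mem fun {i j} hi hj hij => ?_
    rw [List.mem_range] at hi hj
    have h2 : lam * j ≤ lam * k := Nat.mul_le_mul_left lam (Nat.lt_succ_iff.1 hj)
    have h3 : lam * i < lam * j := Nat.mul_lt_mul_of_pos_left hij hlam
    rw [show p + lam * j + (q ^ m - 1) - lam * i = p + (lam * j - lam * i) + (q ^ m - 1) by omega,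
      h.add_period]
    rcases (show p + (lam * j - lam * i) < q ^ m - 1 ∨
      p + (lam * j - lam * i) = 0 + (q ^ m - 1) by omega) with h4 | h4
    · exact hmax _ (by omega) h4
    · rw [h4, h.add_period]
      exact h.not_zero hD

end DualSpectrum

/-! ### Bounds from the gap above the largest spectral exponent. -/

namespace DualSpectrum

variable {q m lam D w h : ℕ} {Spec : ℕ → Prop}

/-- An exponent whose shift by `k` digits is small vanishes or is large. -/
theorem le_or_add_le_of_rot_le {q m k e D : ℕ} (hq : 0 < q) (hkm : k ≤ m) (he : e < q ^ m) 
    (hr : (e % q ^ k) * q ^ (m - k) + e / q ^ k ≤ D) :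
    (D < q ^ (m - k) → e ≤ D * q ^ k) ∧ e + q ^ k ≤ q ^ m + D / q ^ (m - k) := by
  constructor
  · intro hD
    have h0 : e % q ^ k = 0 := by
      by_contra h0
      have h1 := Nat.le_mul_of_pos_left (q ^ (m - k)) (Nat.pos_of_ne_zero h0)
      have h2 := (Nat.le_add_right _ _).trans hr
      omega
    have h1 := Nat.div_add_mod e (q ^ k)
    rw [h0, zero_mul, zero_add] at hr
    rw [h0, add_zero, mul_comm] at h1
    rw [← h1]
    exact Nat.mul_le_mul_right _ hr
  · have h1 := Nat.div_add_mod e (q ^ k)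
    have hmk : q ^ m = q ^ k * q ^ (m - k) := by rw [← pow_add]; congr 1; omega
    have h2 : e / q ^ k + 1 ≤ q ^ (m - k) := by
      rw [Nat.succ_le_iff, Nat.div_lt_iff_lt_mul (by positivity), mul_comm, ← hmk]
      exact he
    have h3 := Nat.mul_le_mul_left (q ^ k) h2
    have h4 : e % q ^ k ≤ D / q ^ (m - k) := by
      rw [Nat.le_div_iff_mul_le (by positivity)]
      exact (Nat.le_add_right _ _).trans hr
    rw [Nat.mul_add, mul_one, ← hmk] at h3
    omega

/-- The three cases are the positions of the rotation point `k` relative to `h + 1`. Moving at most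
`h` digits forces these to vanish; moving more than `h + 1` digits makes the corresponding lower
block small and leaves a large gap; only `k = h + 1` keeps both digit blocks `A` and `B` in play. -/
theorem odd_trichotomy (H : DualSpectrum q m lam D w Spec) (hq : 2 ≤ q) (hm : m = 2 * h + 1)
    (hh : 1 ≤ h) (hD : D < q ^ (h + 1)) {e : ℕ} (he : Spec e) (heN : e < q ^ m - 1) :
    e ≤ D * q ^ h ∨ (∃ A B, e = A * q ^ (h + 1) + B ∧ A < q ^ h ∧ B * q ^ h + A ≤ D) ∨
      e + q ^ (h + 2) + 1 ≤ q ^ m + q ^ 2 := by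
  have hDN : D < q ^ m - 1 := by
    have h1 : q ^ (h + 1) < q ^ m := Nat.pow_lt_pow_right (by omega) (by omega)
    omega
  obtain ⟨k, hk1, hkm, -, hr, -⟩ := H.lead_rot hq (by omega) hDN he heN
  obtain ⟨h1, h2⟩ := le_or_add_le_of_rot_le (by omega) hkm (by omega) hr
  rcases lt_trichotomy k (h + 1) with hk | rfl | hk
  · left
    refine (h1 (hD.trans_le (Nat.pow_le_pow_right (by omega) (by omega)))).trans ?_
    exact Nat.mul_le_mul_left _ (Nat.pow_le_pow_right (by omega) (by omega))
  · right; left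
    refine ⟨e / q ^ (h + 1), e % q ^ (h + 1), ?_, ?_, ?_⟩
    · rw [mul_comm, Nat.div_add_mod]
    · rw [Nat.div_lt_iff_lt_mul (by positivity), ← pow_add, show h + (h + 1) = m by omega]
      omega
    · rwa [show m - (h + 1) = h by omega] at hr
  · right; right
    obtain ⟨j, rfl⟩ := Nat.exists_eq_add_of_le (show h + 2 ≤ k from hk)
    have h3 : D / q ^ (m - (h + 2 + j)) < q ^ (2 + j) := by
      rw [Nat.div_lt_iff_lt_mul (by positivity), ← pow_add]
      refine hD.trans_le (Nat.pow_le_pow_right (by omega) (by omega))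
    have h4 : q ^ (h + 2) + q ^ (2 + j) ≤ q ^ (h + 2 + j) + q ^ 2 := by
      have h5 := Nat.one_le_pow h q (by omega)
      have h6 := Nat.one_le_pow j q (by omega)
      obtain ⟨a, ha⟩ := Nat.exists_eq_add_of_le h5
      obtain ⟨b, hb⟩ := Nat.exists_eq_add_of_le h6
      rw [pow_add, pow_add, pow_add, pow_add, ha, hb]
      linarith [Nat.zero_le (a * b * q ^ 2)]
    omega

/-- The BCH bound for odd extension degree, with the gap as a parameter. -/
theorem odd_bch (H : DualSpectrum q m lam D w Spec) (hq : 2 ≤ q) (hm : m = 2 * h + 1)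
    (hh : 1 ≤ h) (hlam : lam ∣ q - 1) (hlam0 : 0 < lam) {Q g : ℕ} (hQ : q ^ h = Q)
    (hD : D < q * Q) (h1 : D * Q + g + 1 ≤ q * Q * Q)
    (h2 : ∀ A B, lam ∣ A * (q * Q) + B → A + 1 ≤ Q → B * Q + A ≤ D →
      A * (q * Q) + B + g + 1 ≤ q * Q * Q)
    (h3 : g + q ^ 2 ≤ q ^ 2 * Q) : g + lam ≤ lam * w := by
  subst hQ
  have hN : q ^ m = q * q ^ h * q ^ h := by rw [hm]; ring
  rw [← pow_succ'] at hD
  refine H.bch hlam0 (hlam.trans (by simpa using Nat.sub_dvd_pow_sub_pow q 1 m)) ?_ ?_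
  · have h1 : q ^ (h + 1) < q ^ m := Nat.pow_lt_pow_right (by omega) (by omega)
    omega
  · intro e he heN
    rcases H.odd_trichotomy hq hm hh hD he heN with h4 | ⟨A, B, rfl, hA, hB⟩ | h4
    · omega
    · have := h2 A B (by have := H.dvd _ he; rwa [pow_succ'] at this) hA hB
      rw [pow_succ']
      omega
    · rw [pow_add, mul_comm] at h4
      omega

/-- First range of designed distances. -/
theorem weight_ge_of_large (H : DualSpectrum q m lam D w Spec) (hq : 3 ≤ q) (hm : m = 2 * h + 1)
    (hh : 1 ≤ h) (hlam : lam ∣ q - 1) (hlam0 : 0 < lam) {x Q : ℕ} (hQ : q ^ h = Q) (hs : 1 ≤ x)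
    (hs' : x + 1 ≤ q) (hD : D + q = q * Q + x) :
    q * Q + lam ≤ lam * w + x * Q + 1 := by
  have hqQ : q ≤ Q := hQ ▸ Nat.le_self_pow (by omega) q
  have hxQ : (x + 1) * Q ≤ q * Q := Nat.mul_le_mul_right _ hs'
  rw [Nat.succ_mul] at hxQ
  -- This gap is dictated by the exponent `D * Q`: the first condition of `odd_bch` is then an
  -- equality.
  obtain ⟨g, hg⟩ : ∃ g, g + 1 + x * Q = q * Q := ⟨q * Q - 1 - x * Q, by omega⟩
  have := H.odd_bch (g := g) (by omega) hm hh hlam hlam0 hQ (by omega) ?_ ?_ ?_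
  · omega
  · have h1 : (D + q) * Q = (q * Q + x) * Q := by rw [hD]
    linarith
  · intro A B _ hA hB
    have hBq : B < q := by
      by_contra! h
      have := Nat.mul_le_mul_right Q h
      omega
    rcases Nat.lt_or_ge B (q - 1) with h | h
    · have h1 := Nat.mul_le_mul_right (q * Q) hA
      have h2 : B ≤ x * Q := by
        have := Nat.le_mul_of_pos_left Q hs
        omega
      linarith
    · have h1 : B + 1 = q := by omega
      have h2 : A + q ≤ Q + x := by
        have h3 : (B + 1) * Q = B * Q + Q := Nat.succ_mul B Q
        rw [h1] at h3
        omega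
      have h3 := Nat.mul_le_mul_right (q * Q) h2
      have h4 : (q - x) * (q * Q) + x * (q * Q) = q * (q * Q) := by rw [← Nat.add_mul]; congr 1; omega
      have h5 : (q - x) * Q + x * Q = q * Q := by rw [← Nat.add_mul]; congr 1; omega
      have h6 : (q - x) * Q * q = (q - x) * (q * Q) := by ring
      have h7 : (q - x) * Q ≥ 1 := Nat.mul_pos (by omega) (by omega)
      obtain ⟨y, hy⟩ := Nat.exists_eq_add_of_le h7
      have h8 : y ≤ y * q := Nat.le_mul_of_pos_right _ (by omega)
      rw [hy] at h5 h6
      linarith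
  · have h1 : q * q ≤ q * Q := Nat.mul_le_mul_left _ hqQ
    have h2 : 3 * (q * Q) ≤ q * (q * Q) := Nat.mul_le_mul_right _ hq
    have h3 := Nat.zero_le (x * Q)
    linarith

/-- Second range of designed distances, weak form. -/
theorem weight_ge_of_le (H : DualSpectrum q m lam D w Spec) (hq : 3 ≤ q) (hm : m = 2 * h + 1)
    (hh : 1 ≤ h) (hlam : lam ∣ q - 1) (hlam0 : 0 < lam) {s Q : ℕ} (hQ : q ^ h = Q)
    (hs' : lam * s + lam + 1 ≤ q) (hD : D + 1 + lam ≤ (lam * s + 1) * Q) :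
    q * Q + 2 * lam ≤ lam * w + lam * s + 1 := by
  have hqQ : q ≤ Q := hQ ▸ Nat.le_self_pow (by omega) q
  have hmod : lam ∣ q * Q - 1 := by
    rw [← hQ, ← pow_succ']
    exact hlam.trans (by simpa using Nat.sub_dvd_pow_sub_pow q 1 (h + 1))
  have hmod2 : lam ∣ q * Q * Q - 1 := by
    rw [← hQ, ← pow_succ', ← pow_add]
    exact hlam.trans (by simpa using Nat.sub_dvd_pow_sub_pow q 1 (h + 1 + h))
  have hqQ' : q ≤ q * Q := Nat.le_mul_of_pos_right _ (by omega)
  obtain ⟨g, hg⟩ : ∃ g, g + 1 + lam * s = q * Q + lam := ⟨q * Q + lam - 1 - lam * s, by omega⟩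
  have hx : (lam * s + lam + 1) * Q ≤ q * Q := Nat.mul_le_mul_right _ hs'
  have := H.odd_bch (g := g) (by omega) hm hh hlam hlam0 hQ ?_ ?_ ?_ ?_
  · omega
  · have h1 : (lam * s + 1) * Q ≤ (lam * s + lam + 1) * Q := Nat.mul_le_mul_right _ (by omega)
    omega
  · have h1 := Nat.mul_le_mul_right Q hx
    have h2 := Nat.mul_le_mul_right Q hD
    have h3 : q * Q ≤ Q * Q := Nat.mul_le_mul_right _ hqQ
    have h4 : Q * Q ≤ lam * (Q * Q) := Nat.le_mul_of_pos_left _ hlam0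
    have h5 : lam ≤ lam * Q := Nat.le_mul_of_pos_right _ (by omega)
    have h6 := Nat.zero_le (lam * s)
    linarith
  · intro A B hdvd hA hB
    have hBx : B ≤ lam * s := by
      by_contra! h
      have := Nat.mul_le_mul_right Q (show lam * s + 1 ≤ B from h)
      omega
    rcases hBx.eq_or_lt with h | h
    · have h1 : A + 1 + lam ≤ Q := by
        rw [h] at hB
        rw [Nat.add_mul, one_mul] at hD
        omega
      have h2 := Nat.mul_le_mul_right (q * Q) h1
      have h3 : lam ≤ lam * (q * Q) := Nat.le_mul_of_pos_right _ (by omega)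
      linarith
    -- The critical block is `A = Q - 1`. Since `q ≡ 1` modulo `lam`, divisibility of the exponent
    -- forces `lam ∣ B`, so `B < lam * s` improves to `B ≤ lam * (s - 1)`.
    · rcases hA.eq_or_lt with h1 | h1
      · obtain ⟨y, hy⟩ := hdvd
        obtain ⟨z, hz⟩ := hmod
        obtain ⟨t, ht⟩ := hmod2
        have h2 : A * (q * Q) + q * Q = q * Q * Q := by rw [← h1]; ring
        have h4 : q * Q * Q ≥ q * Q := Nat.le_mul_of_pos_right _ (by omega)
        have h3 : q * Q = lam * z + 1 := by omega
        have h5 : q * Q * Q = lam * t + 1 := by omega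
        have h6 : y + z < t + s := by
          by_contra! h
          have := Nat.mul_le_mul_left lam h
          rw [mul_add, mul_add] at this
          omega
        have := Nat.mul_le_mul_left lam (Nat.succ_le_of_lt h6)
        rw [mul_add, Nat.mul_succ, mul_add] at this
        omega
      · have h2 := Nat.mul_le_mul_right (q * Q) h1
        linarith
  · have h1 : q * q ≤ q * Q := Nat.mul_le_mul_left _ hqQ
    have h2 : 3 * (q * Q) ≤ q * (q * Q) := Nat.mul_le_mul_right _ hq
    have h3 := Nat.zero_le (lam * s)
    linarith

/-- Third range of designed distances. -/
theorem weight_ge_of_medium (H : DualSpectrum q m lam D w Spec) (hq : 3 ≤ q)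
    (hm : m = 2 * h + 1) (hh : 1 ≤ h) (hlam : lam ∣ q - 1) (hlam0 : 0 < lam) (hlam2 : lam + 1 < q)
    {Q : ℕ} (hQ : q ^ h = Q) (hD : D + q ≤ q * Q) :
    q * Q + 2 * lam ≤ lam * w + q := by
  have hqQ : q ≤ Q := hQ ▸ Nat.le_self_pow (by omega) q
  have hmod : lam ∣ q * Q - q := by
    rw [← hQ, ← Nat.mul_sub_one]
    exact Dvd.dvd.mul_left (hlam.trans (by simpa using Nat.sub_dvd_pow_sub_pow q 1 h)) q
  have hmod2 : lam ∣ q * Q * Q - 1 := by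
    rw [← hQ, ← pow_succ', ← pow_add]
    exact hlam.trans (by simpa using Nat.sub_dvd_pow_sub_pow q 1 (h + 1 + h))
  have hqQ' : q ≤ q * Q := Nat.le_mul_of_pos_right _ (by omega)
  obtain ⟨g, hg⟩ : ∃ g, g + q = q * Q + lam := ⟨q * Q + lam - q, by omega⟩
  have := H.odd_bch (g := g) (by omega) hm hh hlam hlam0 hQ (by omega) ?_ ?_ ?_
  · omega
  · have h1 := Nat.mul_le_mul_right Q hD
    linarith
  · intro A B hdvd hA hB
    have hBq : B < q := by
      by_contra! h
      have := Nat.mul_le_mul_right Q h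
      omega
    rcases Nat.lt_or_ge B (q - 1) with h | h
    -- For `A = Q - 1` both `B` and `q - 1` are divisible by `lam`, hence `B ≤ q - 1 - lam`; this
    -- gains the additional `lam` in the gap.
    · rcases hA.eq_or_lt with h1 | h1
      · obtain ⟨y, hy⟩ := hdvd
        obtain ⟨z, hz⟩ := hmod
        obtain ⟨t, ht⟩ := hmod2
        have h2 : A * (q * Q) + q * Q = q * Q * Q := by rw [← h1]; ring
        have h4 : q * Q * Q ≥ q * Q := Nat.le_mul_of_pos_right _ (by omega)
        have h3 : q * Q = lam * z + q := by omega
        have h5 : q * Q * Q = lam * t + 1 := by omega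
        have h6 : y + z < t := by
          by_contra! h
          have := Nat.mul_le_mul_left lam h
          rw [mul_add] at this
          omega
        have := Nat.mul_le_mul_left lam (Nat.succ_le_of_lt h6)
        rw [Nat.mul_succ, mul_add] at this
        omega
      · have h2 := Nat.mul_le_mul_right (q * Q) h1
        linarith
    · have h1 : B + 1 = q := by omega
      have h2 : A + q ≤ Q := by
        have h3 : (B + 1) * Q = B * Q + Q := Nat.succ_mul B Q
        rw [h1] at h3
        omega
      have h3 := Nat.mul_le_mul_right (q * Q) h2
      have h4 : 3 * (q * Q) ≤ q * (q * Q) := Nat.mul_le_mul_right _ hq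
      linarith
  · have h1 : q * q ≤ q * Q := Nat.mul_le_mul_left _ hqQ
    have h2 : 3 * (q * Q) ≤ q * (q * Q) := Nat.mul_le_mul_right _ hq
    linarith

/-- Even extension degree and a primitive BCH code. -/
theorem weight_ge_of_even (H : DualSpectrum q m 1 D w Spec) (hq : 3 ≤ q)
    (hm : m = 2 * h) (hh : 2 ≤ h) (hD : D + q ≤ q ^ h) : q ^ (h + 1) + 1 ≤ w + q := by
  have hpow : q ^ (h + 1) = q * q ^ h := pow_succ' q h
  have hN : q ^ m = q ^ h * q ^ h := by rw [hm, two_mul, pow_add]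
  have hqh : q ≤ q ^ h := Nat.le_self_pow (by omega) q
  have hqQ' : q ≤ q * q ^ h := Nat.le_mul_of_pos_right _ (by omega)
  have hDN : D < q ^ m - 1 := by
    rw [hN]
    have : q ^ h * 3 ≤ q ^ h * q ^ h := Nat.mul_le_mul_left _ (by omega)
    omega
  have := H.bch (g := q ^ (h + 1) - q) one_pos (one_dvd _) hDN ?_
  · omega
  · intro e he heN
    obtain ⟨k, hk1, hkm, -, hr, -⟩ := H.lead_rot (by omega) (by omega) hDN he heN
    obtain ⟨h1, h2⟩ := le_or_add_le_of_rot_le (by omega) hkm (by omega) hr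
    rcases Nat.lt_or_ge h k with hk | hk
    · obtain ⟨j, rfl⟩ := Nat.exists_eq_add_of_le (show h + 1 ≤ k from hk)
      have h3 : D / q ^ (m - (h + 1 + j)) < q ^ (1 + j) := by
        rw [Nat.div_lt_iff_lt_mul (by positivity), ← pow_add,
          show 1 + j + (m - (h + 1 + j)) = h by omega]
        omega
      have h4 : q ^ (h + 1) + q ^ (1 + j) ≤ q ^ (h + 1 + j) + q := by
        have h5 := Nat.one_le_pow h q (by omega)
        have h6 := Nat.one_le_pow j q (by omega)
        obtain ⟨a, ha⟩ := Nat.exists_eq_add_of_le h5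
        obtain ⟨b, hb⟩ := Nat.exists_eq_add_of_le h6
        rw [pow_add, pow_add, pow_add, ha, hb]
        nlinarith [Nat.zero_le (a * b * q)]
      omega
    · have h3 := h1 ((show D < q ^ h by omega).trans_le
        (Nat.pow_le_pow_right (by omega) (by omega)))
      have h4 : D * q ^ k ≤ D * q ^ h := Nat.mul_le_mul_left _ (Nat.pow_le_pow_right (by omega) hk)
      have h5 := Nat.mul_le_mul_right (q ^ h) hD
      rw [← hN, Nat.add_mul, ← hpow] at h5
      omega

end DualSpectrum

/-! ### Odd degree: chains with a free block of upper digits. -/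

namespace DualSpectrum

variable {q m lam D w h p : ℕ} {Spec : ℕ → Prop}

/-- A leader divisible by `q` can be divided by `q` without leaving its conjugacy class, and the
process stops. -/
theorem lead_not_dvd (H : DualSpectrum q m lam D w Spec) (hq : 2 ≤ q) (hm : 0 < m) {e : ℕ}
    (he : Spec e) : ∃ r, 1 ≤ r ∧ r ≤ D ∧ Spec r ∧ ¬ q ∣ r ∧ ∃ j, r ≡ q ^ j * e [MOD q ^ m - 1] := by
  obtain ⟨r, h1, h2, h3, h4⟩ := H.lead e he
  induction r using Nat.strong_induction_on with
  | _ r ih =>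
    by_cases hr : q ∣ r
    · obtain ⟨c, rfl⟩ := hr
      have hc : 1 ≤ c := Nat.pos_of_ne_zero (by rintro rfl; simp at h1)
      have hlt : c < q * c := by nlinarith
      obtain ⟨j, hj⟩ := h4
      refine ih c hlt hc (hlt.le.trans h2) ((H.frob c).1 h3) ⟨m - 1 + j, ?_⟩
      have hpow : q ^ m ≡ 1 [MOD q ^ m - 1] :=
        ((Nat.modEq_iff_dvd' (Nat.one_le_pow _ _ (by omega))).2 (dvd_refl _)).symm
      have h5 := hj.mul_left (q ^ (m - 1))
      have h6 : q ^ (m - 1) * (q * c) = q ^ m * c := by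
        rw [← mul_assoc, ← pow_succ]; congr 2; omega
      rw [h6] at h5
      rw [pow_add, mul_assoc]
      refine Nat.ModEq.trans ?_ h5
      simpa using (hpow.mul_right c).symm
    · exact ⟨r, h1, h2, h3, hr, h4⟩

/-- The largest exponent prime to the cardinality that bounds the leaders of the spectrum. -/
theorem exists_max_not_dvd (H : DualSpectrum q m lam D w Spec) (hq : 2 ≤ q) (hm : 0 < m) :
    ∃ p, 1 ≤ p ∧ p ≤ D ∧ Spec p ∧ ¬ q ∣ p ∧ DualSpectrum q m lam p w Spec := by
  classical
  obtain ⟨e, he⟩ := H.ex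
  obtain ⟨r, h1, h2, h3, h4, -⟩ := H.lead_not_dvd hq hm he
  have hs := Nat.findGreatest_spec (P := fun r => Spec r ∧ ¬ q ∣ r) h2 ⟨h3, h4⟩
  refine ⟨Nat.findGreatest (fun r => Spec r ∧ ¬ q ∣ r) D,
    h1.trans (Nat.le_findGreatest h2 ⟨h3, h4⟩), Nat.findGreatest_le _, hs.1, hs.2, ?_⟩
  exact { H with
    lead := fun e he => by
      obtain ⟨r, h1, h2, h3, h4, h5⟩ := H.lead_not_dvd hq hm he
      exact ⟨r, h1, Nat.le_findGreatest h2 ⟨h3, h4⟩, h3, h5⟩ }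

/-- An exponent above the leaders whose lower digits are large and prime to `q`. -/
theorem odd_not_spec (H : DualSpectrum q m lam p w Spec) (hq : 2 ≤ q) (hm : m = 2 * h + 1)
    (hh : 1 ≤ h) {Q : ℕ} (hQ : q ^ h = Q) (hp : p < q * Q) {V B : ℕ} (hV : V < Q)
    (hB : B < q * Q) (hqB : ¬ q ∣ B) (hpB : (p / Q + 1) * q ^ (h - 1) ≤ B)
    (hlt : p < V * (q * Q) + B) : ¬ Spec (V * (q * Q) + B) := by
  intro hs
  have hQ0 : 0 < Q := by omega
  have hN : q ^ m = q * Q * Q := by rw [hm, ← hQ]; ring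
  have hpN : p < q ^ m - 1 := by
    rw [hN]
    have h1 : 2 ≤ Q := by
      rw [← hQ]; exact hq.trans (Nat.le_self_pow (by omega) q)
    have := Nat.mul_le_mul_left (q * Q) h1
    omega
  have heN : V * (q * Q) + B < q ^ m - 1 := by
    have h1 : (V + 1) * (q * Q) ≤ Q * (q * Q) := Nat.mul_le_mul_right _ hV
    rw [Nat.succ_mul, mul_comm Q] at h1
    have h2 : V * (q * Q) + B ≠ q ^ m - 1 := by
      intro h2
      rw [h2, show q ^ m - 1 = 0 + (q ^ m - 1) by omega, H.add_period] at hs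
      exact H.not_zero hpN hs
    omega
  obtain ⟨k, hk1, hkm, -, hr, -⟩ := H.lead_rot hq (by omega) hpN hs heN
  have hpt : p < (p / Q + 1) * Q := by
    have := Nat.lt_div_mul_add (a := p) hQ0
    rw [Nat.succ_mul]; exact this
  have hlow : ∀ j, h + 1 ≤ j → B ≤ (V * (q * Q) + B) % q ^ j := by
    intro j hj
    have h1 : (V * (q * Q) + B) % q ^ j % q ^ (h + 1) = B := by
      rw [Nat.mod_mod_of_dvd _ (Nat.pow_dvd_pow q hj), pow_succ', hQ, Nat.mul_add_mod_self_right,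
        Nat.mod_eq_of_lt hB]
    calc B = (V * (q * Q) + B) % q ^ j % q ^ (h + 1) := h1.symm
      _ ≤ _ := Nat.mod_le _ _
  -- Rotating at most `h` digits would require them to vanish, against `¬ q ∣ B`. Rotating between
  -- `h + 1` and `m - 1` digits puts at least `B * q ≥ (p / Q + 1) * Q > p` on top. Rotating all `m`
  -- digits leaves the exponent itself, which exceeds `p`.
  rcases Nat.lt_or_ge h k with hk | hk
  · rcases hkm.eq_or_lt with rfl | hkm
    · rw [Nat.sub_self, pow_zero, mul_one, Nat.mod_eq_of_lt (heN.trans_le (Nat.sub_le _ _))] at hr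
      exact absurd ((Nat.le_add_right _ _).trans hr) (by omega)
    · have h1 := hlow k hk
      have h2 : B * q ^ (m - k) ≤ p :=
        (Nat.mul_le_mul_right _ h1).trans ((Nat.le_add_right _ _).trans hr)
      have h3 := (Nat.mul_le_mul_right (q ^ (m - k)) hpB).trans h2
      rw [mul_assoc, ← pow_add] at h3
      have h4 : Q ≤ q ^ (h - 1 + (m - k)) := by
        rw [← hQ]; exact Nat.pow_le_pow_right (by omega) (by omega)
      have h5 := (Nat.mul_le_mul_left (p / Q + 1) h4).trans h3
      omega
  · have h0 : (V * (q * Q) + B) % q ^ k = 0 := by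
      by_contra h0
      have h1 := Nat.le_mul_of_pos_left (q ^ (m - k)) (Nat.pos_of_ne_zero h0)
      have h2 := (Nat.le_add_right _ _).trans hr
      have h3 : q * Q ≤ q ^ (m - k) := by
        rw [← hQ, ← pow_succ']; exact Nat.pow_le_pow_right (by omega) (by omega)
      omega
    refine hqB ?_
    have h1 := (dvd_pow_self q (by omega : k ≠ 0)).trans (Nat.dvd_of_mod_eq_zero h0)
    exact (Nat.dvd_add_right (Dvd.intro _ (mul_left_comm _ _ _))).1 h1

/-- The chain consists of all `V * (q * Q) + u` with `V < Q` and `u ∈ U`. Since `p + u - u'` never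
leaves the interval `[0, q * Q)`, there is no carry into the upper block, which is therefore
unrestricted. -/
theorem odd_card_le (H : DualSpectrum q m lam p w Spec) (hq : 2 ≤ q) (hm : m = 2 * h + 1)
    (hh : 1 ≤ h) (hlam0 : 0 < lam) {Q : ℕ} (hQ : q ^ h = Q) (hp : p < q * Q) (hps : Spec p)
    (U : Finset ℕ) (hU : ∀ u ∈ U, u + 1 < q * Q)
    (hU' : ∀ u ∈ U, ∀ u' ∈ U, (p / Q + 1) * q ^ (h - 1) + u' ≤ p + u ∧ p + u < q * Q + u' ∧
      ¬ p + u ≡ u' [MOD q]) : Q * U.card ≤ lam * w := by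
  have hQ0 : 0 < Q := by rw [← hQ]; positivity
  have hN : q ^ m = q * Q * Q := by rw [hm, ← hQ]; ring
  have hinj : Set.InjOn (fun x : ℕ × ℕ => x.1 * (q * Q) + x.2)
      (Finset.range Q ×ˢ U : Finset (ℕ × ℕ)) := by
    rintro ⟨v, u⟩ hx ⟨v', u'⟩ hx' hxx
    simp only [Finset.coe_product, Set.mem_prod, Finset.mem_coe] at hx hx' hxx
    have h1 := hU u hx.2
    have h2 := hU u' hx'.2
    have h3 : v = v' := by
      have := congrArg (· / (q * Q)) hxx
      simpa [Nat.add_comm, Nat.add_mul_div_right _ _ (show 0 < q * Q by omega),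
        Nat.div_eq_of_lt (show u < q * Q by omega), Nat.div_eq_of_lt (show u' < q * Q by omega)] using this
    subst h3
    exact Prod.ext rfl (by simpa using hxx)
  have h1 := H.card_le hlam0 hps ((Finset.range Q ×ˢ U).image fun x => x.1 * (q * Q) + x.2) ?_ ?_
  · rwa [Finset.card_image_of_injOn hinj, Finset.card_product, Finset.card_range] at h1
  · intro a ha
    simp only [Finset.mem_image, Finset.mem_product, Finset.mem_range, Prod.exists] at ha
    obtain ⟨v, u, ⟨hv, hu⟩, rfl⟩ := ha
    have h1 : (v + 1) * (q * Q) ≤ Q * (q * Q) := Nat.mul_le_mul_right _ hv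
    rw [Nat.succ_mul, mul_comm Q] at h1
    have := hU u hu
    omega
  · intro a ha a' ha' hlt _
    simp only [Finset.mem_image, Finset.mem_product, Finset.mem_range, Prod.exists] at ha ha'
    obtain ⟨v, u, ⟨hv, hu⟩, rfl⟩ := ha
    obtain ⟨v', u', ⟨hv', hu'⟩, rfl⟩ := ha'
    obtain ⟨h2, h3, h4⟩ := hU' u hu u' hu'
    have h5 := hU u hu
    have h6 := hU u' hu'
    have hvv : v' ≤ v := by
      by_contra! h
      have := Nat.mul_le_mul_right (q * Q) h
      rw [Nat.succ_mul] at this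
      omega
    have h7 := Nat.mul_le_mul_right (q * Q) hvv
    have h8 : p + (v * (q * Q) + u - (v' * (q * Q) + u')) = (v - v') * (q * Q) + (p + u - u') := by
      rw [Nat.sub_mul]; omega
    rw [h8]
    refine H.odd_not_spec hq hm hh hQ hp (by omega) (by omega) ?_ (by omega) (by omega)
    intro h9
    exact h4 ((Nat.modEq_iff_dvd' (by omega)).2 h9).symm

/-- Weight bound when the largest leader is prime to `q` and of moderate size. -/
theorem odd_weight_ge (H : DualSpectrum q m lam p w Spec) (hq : 4 ≤ q) (hm : m = 2 * h + 1)
    (hh : 1 ≤ h) (hlam0 : 0 < lam) {Q : ℕ} (hQ : q ^ h = Q) (hps : Spec p) (hqp : ¬ q ∣ p)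
    (h1 : (p / Q + 1) * q ^ (h - 1) + (q / 2 * q + 2) ≤ p) (h2 : p + (q / 2 * q + 2) < q * Q) :
    (q + 1) * Q ≤ lam * w := by
  -- An offset with `p ≢ ±j`: take `1`, or `2` when `p ≡ ±1`. The latter works because `q ≥ 4`.
  obtain ⟨j, hj0, hj2, hj⟩ : ∃ j, 0 < j ∧ j ≤ 2 ∧ ¬ p + j ≡ 0 [MOD q] ∧ ¬ p ≡ j [MOD q] := by
    have hpq : p % q < q := Nat.mod_lt _ (by omega)
    have hp0 : p % q ≠ 0 := fun h => hqp (Nat.dvd_of_mod_eq_zero h)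
    by_cases hcase : p % q = 1 ∨ p % q + 1 = q
    · refine ⟨2, by omega, by omega, ?_, ?_⟩
      · rw [Nat.ModEq, Nat.add_mod, Nat.mod_eq_of_lt (show 2 < q by omega), Nat.zero_mod]
        rcases hcase with h | h
        · rw [h, Nat.mod_eq_of_lt (by omega)]; omega
        · rw [show p % q + 2 = 1 + q by omega, Nat.add_mod_right, Nat.mod_eq_of_lt (by omega)]
          omega
      · rw [Nat.ModEq, Nat.mod_eq_of_lt (show 2 < q by omega)]
        omega
    · refine ⟨1, by omega, by omega, ?_, ?_⟩
      · rw [Nat.ModEq, Nat.add_mod, Nat.mod_eq_of_lt (show 1 < q by omega), Nat.zero_mod,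
          Nat.mod_eq_of_lt (by omega)]
        omega
      · rw [Nat.ModEq, Nat.mod_eq_of_lt (show 1 < q by omega)]
        omega
  -- Differences in `U` are `0` or `±j` modulo `q`, so adding `p` never gives a multiple of `q`; the
  -- size `2 * (q / 2 + 1)` is at least `q + 1` for either parity.
  set U := (Finset.range (q / 2 + 1) ×ˢ {0, j}).image fun x : ℕ × ℕ => x.1 * q + x.2 with hU
  have hUcard : U.card = 2 * (q / 2 + 1) := by
    rw [hU, Finset.card_image_of_injOn, Finset.card_product, Finset.card_range,
      Finset.card_pair (by omega), mul_comm]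
    rintro ⟨i, c⟩ hx ⟨i', c'⟩ hx' hxx
    simp only [Finset.coe_product, Set.mem_prod, Finset.coe_insert, Finset.coe_singleton,
      Set.mem_insert_iff, Set.mem_singleton_iff] at hx hx' hxx
    have hc : c < q := by omega
    have hc' : c' < q := by omega
    have h3 := congrArg (· / q) hxx
    have h4 := congrArg (· % q) hxx
    simp only [Nat.mul_add_mod_self_right, Nat.mod_eq_of_lt hc, Nat.mod_eq_of_lt hc'] at h4
    subst h4
    have h5 : i * q = i' * q := by omega
    exact Prod.ext (Nat.eq_of_mul_eq_mul_right (by omega) h5) rfl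
  have hmem : ∀ u ∈ U, u ≤ q / 2 * q + 2 ∧ ∃ c, (c = 0 ∨ c = j) ∧ u ≡ c [MOD q] := by
    intro u hu
    rw [hU] at hu
    simp only [Finset.mem_image, Finset.mem_product, Finset.mem_range, Prod.exists,
      Finset.mem_insert, Finset.mem_singleton] at hu
    obtain ⟨i, c, ⟨hi, hc⟩, rfl⟩ := hu
    refine ⟨?_, c, hc, by simp [Nat.ModEq]⟩
    have := Nat.mul_le_mul_right q (Nat.lt_succ_iff.1 hi)
    omega
  have h3 := H.odd_card_le (by omega) hm hh hlam0 hQ (by omega) hps U ?_ ?_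
  · rw [hUcard] at h3
    refine le_trans ?_ h3
    rw [mul_comm]
    exact Nat.mul_le_mul_left _ (by omega)
  · intro u hu
    have := (hmem u hu).1
    have h5 : 1 ≤ (p / Q + 1) * q ^ (h - 1) := Nat.mul_pos (Nat.succ_pos _) (by positivity)
    omega
  · intro u hu u' hu'
    obtain ⟨h4, c, hc, h5⟩ := hmem u hu
    obtain ⟨h6, c', hc', h7⟩ := hmem u' hu'
    refine ⟨by omega, by omega, fun h8 => ?_⟩
    have h9 : p + c ≡ c' [MOD q] := ((h5.add_left p).symm.trans h8).trans h7
    rcases hc with rfl | rfl <;> rcases hc' with rfl | rfl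
    · exact hqp ((Nat.modEq_zero_iff_dvd).1 (by simpa using h9))
    · exact hj.2 (by simpa using h9)
    · exact hj.1 h9
    · exact hqp ((Nat.modEq_zero_iff_dvd).1 (Nat.ModEq.add_right_cancel' (b := 0) c' (by rwa [zero_add])))

end DualSpectrum

/-! ### Bit masks and first-fit searches. -/

/-- First-fit count: starting from the candidates `al`, repeatedly take the lowest candidate `s`
and keep the later candidates `s + 1 + i` with `i` a bit of `G`. -/
def greedyCount (G : ℕ) : ℕ → ℕ → ℕ
  | 0, _ => 0
  | _ + 1, 0 => 0
  | f + 1, a + 1 =>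
    bif Nat.testBit (a + 1) (Nat.log2 ((a + 1) ^^^ a)) then
      greedyCount G f (((a + 1) >>> (Nat.log2 ((a + 1) ^^^ a) + 1)) &&& G) + 1
    else 0

theorem exists_list_of_greedyCount (G f al : ℕ) :
    ∃ L : List ℕ, L.length = greedyCount G f al ∧ (∀ x ∈ L, al.testBit x) ∧
      L.Pairwise fun x y => x < y ∧ G.testBit (y - x - 1) := by
  induction f generalizing al with
  | zero => exact ⟨[], by simp [greedyCount]⟩
  | succ f ih =>
    cases al with
    | zero => exact ⟨[], by simp [greedyCount]⟩
    | succ a =>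
      rw [greedyCount]
      -- `(a + 1) ^^^ a` is a block of ones ending at the lowest set bit of `a + 1`. Soundness does
      -- not depend on this, only on the test that bit `s` is set.
      set s := Nat.log2 ((a + 1) ^^^ a)
      cases hs : Nat.testBit (a + 1) s with
      | false => exact ⟨[], by simp⟩
      | true =>
        obtain ⟨L, h1, h2, h3⟩ := ih (((a + 1) >>> (s + 1)) &&& G)
        refine ⟨s :: L.map (· + (s + 1)), by simp [h1], ?_, ?_⟩
        · intro x hx
          simp only [List.mem_cons, List.mem_map] at hx
          rcases hx with rfl | ⟨y, hy, rfl⟩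
          · exact hs
          · have := h2 y hy
            rw [Nat.testBit_land, Nat.testBit_shiftRight, Bool.and_eq_true] at this
            rw [add_comm y]
            exact this.1
        · rw [List.pairwise_cons, List.pairwise_map]
          refine ⟨?_, h3.imp fun {x y} h => ⟨by omega, ?_⟩⟩
          · intro x hx
            simp only [List.mem_map] at hx
            obtain ⟨y, hy, rfl⟩ := hx
            have := h2 y hy
            rw [Nat.testBit_land, Bool.and_eq_true] at this
            exact ⟨by omega, by rw [show y + (s + 1) - s - 1 = y by omega]; exact this.2⟩
          · rw [show y + (s + 1) - (x + (s + 1)) - 1 = y - x - 1 by omega]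
            exact h.2

/-- Cyclic shift of a mask of length `M`, truncated to length `M - 1`; bit `i` is bit
`(s + i) % M` of `X`. -/
def rotMask (M X s : ℕ) : ℕ := ((X >>> s) ||| (X <<< (M - s))) &&& (2 ^ (M - 1) - 1)

theorem testBit_rotMask {M X s i : ℕ} (hX : X < 2 ^ M) (hs : s ≤ M)
    (h : (rotMask M X s).testBit i) : i < M - 1 ∧ X.testBit ((s + i) % M) := by
  rw [rotMask, Nat.testBit_land, Nat.testBit_two_pow_sub_one, Bool.and_eq_true,
    decide_eq_true_eq, Nat.testBit_lor, Nat.testBit_shiftRight, Nat.testBit_shiftLeft,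
    Bool.or_eq_true, Bool.and_eq_true, decide_eq_true_eq] at h
  refine ⟨h.2, ?_⟩
  rcases h.1 with h1 | ⟨h1, h2⟩
  · have : s + i < M := by
      by_contra! h3
      rw [Nat.testBit_lt_two_pow (hX.trans_le (Nat.pow_le_pow_right (by omega) h3))] at h1
      exact absurd h1 (by simp)
    rwa [Nat.mod_eq_of_lt this]
  · have : (s + i) % M = i - (M - s) := by
      rw [show s + i = (i - (M - s)) + M by omega, Nat.add_mod_right, Nat.mod_eq_of_lt (by omega)]
    rwa [this]

/-- The mask of the positions below `M` where `f` holds. -/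
def maskOf (f : ℕ → Bool) : ℕ → ℕ
  | 0 => 0
  | M + 1 => maskOf f M + bif f M then 2 ^ M else 0

theorem maskOf_lt (f : ℕ → Bool) (M : ℕ) : maskOf f M < 2 ^ M := by
  induction M with
  | zero => simp [maskOf]
  | succ M ih =>
    rw [maskOf, pow_succ]
    cases f M <;> simp <;> omega

theorem testBit_maskOf (f : ℕ → Bool) (M i : ℕ) :
    (maskOf f M).testBit i = (decide (i < M) && f i) := by
  induction M with
  | zero => simp [maskOf]
  | succ M ih =>
    have hlt := maskOf_lt f M
    rw [maskOf]
    cases hf : f M with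
    | false =>
      rw [cond_false, add_zero, ih]
      rcases lt_trichotomy i M with h | rfl | h
      · simp [h, h.trans (Nat.lt_succ_self _)]
      · simp [hf]
      · simp [show ¬ i < M by omega, show ¬ i < M + 1 by omega]
    | true =>
      rw [cond_true, add_comm]
      rcases lt_trichotomy i M with h | rfl | h
      · rw [Nat.testBit_two_pow_add_gt h, ih]
        simp [h, h.trans (Nat.lt_succ_self _)]
      · rw [Nat.testBit_two_pow_add_eq, Nat.testBit_lt_two_pow hlt]
        simp [hf]
      · rw [Nat.testBit_lt_two_pow]
        · simp [show ¬ i < M + 1 by omega]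
        · have : 2 ^ (M + 1) ≤ 2 ^ i := Nat.pow_le_pow_right (by omega) h
          rw [pow_succ] at this
          omega

/-- First-fit count of a set of residues modulo `M` all of whose differences, shifted by `p`, have
the property with mask `O`; the mask `R` is the reversal of `O`. -/
def twoSidedCount (M O R fuel p : ℕ) : ℕ :=
  greedyCount (rotMask M O (p + 1) &&& rotMask M R (M + 1 - p)) fuel
    (rotMask M O (p + 1) &&& rotMask M R (M + 1 - p)) + 1

/-- Bit `i` of the mask `G` records that both `p + (i + 1)` and `p - (i + 1)` are admissible. A list
whose increasing differences lie in `G` is therefore admissible in either order, and `0` can always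
be put in front. -/
theorem exists_finset_of_twoSidedCount {M : ℕ} (ok : ℕ → Bool) {p : ℕ} (hp : p < M) (hp0 : 0 < p)
    (hpok : ok p) (fuel : ℕ) :
    ∃ U : Finset ℕ, U.card =
        twoSidedCount M (maskOf ok M) (maskOf (fun i => ok ((M - i) % M)) M) fuel p ∧
      (∀ u ∈ U, u < M) ∧ ∀ u ∈ U, ∀ u' ∈ U, ok ((p + u + M - u') % M) := by
  rw [twoSidedCount]
  set G := rotMask M (maskOf ok M) (p + 1) &&&
    rotMask M (maskOf (fun i => ok ((M - i) % M)) M) (M + 1 - p) with hG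
  have hGbit : ∀ i, G.testBit i → i + 1 < M ∧ ok ((p + (i + 1)) % M) ∧ ok ((p + M - (i + 1)) % M) := by
    intro i hi
    rw [hG, Nat.testBit_land, Bool.and_eq_true] at hi
    obtain ⟨h1, h2⟩ := testBit_rotMask (maskOf_lt _ _) (by omega) hi.1
    obtain ⟨-, h3⟩ := testBit_rotMask (maskOf_lt _ _) (by omega) hi.2
    rw [testBit_maskOf, Bool.and_eq_true] at h2 h3
    refine ⟨by omega, ?_, ?_⟩
    · rw [show p + (i + 1) = p + 1 + i by omega]
      exact h2.2
    · convert h3.2 using 2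
      rcases Nat.lt_or_ge i (p - 1) with h4 | h4
      · rw [Nat.mod_eq_of_lt (show M + 1 - p + i < M by omega),
          show M - (M + 1 - p + i) = p - (i + 1) by omega,
          show p + M - (i + 1) = (p - (i + 1)) + M by omega, Nat.add_mod_right]
      · rw [show M + 1 - p + i = (i + 1 - p) + M by omega, Nat.add_mod_right,
          Nat.mod_eq_of_lt (show i + 1 - p < M by omega)]
        congr 1
        omega
  obtain ⟨L, h1, h2, h3⟩ := exists_list_of_greedyCount G fuel G
  have hnodup : (0 :: L.map (· + 1)).Pairwise fun x y => x < y ∧ G.testBit (y - x - 1) := by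
    rw [List.pairwise_cons, List.pairwise_map]
    refine ⟨?_, h3.imp fun {x y} h => ⟨by omega, ?_⟩⟩
    · intro x hx
      simp only [List.mem_map] at hx
      obtain ⟨y, hy, rfl⟩ := hx
      exact ⟨by omega, by simpa using h2 y hy⟩
    · rw [show y + 1 - (x + 1) - 1 = y - x - 1 by omega]
      exact h.2
  have hlt : ∀ u ∈ (0 :: L.map (· + 1)), u < M := by
    intro u hu
    simp only [List.mem_cons, List.mem_map] at hu
    rcases hu with rfl | ⟨y, hy, rfl⟩
    · omega
    · exact (hGbit y (h2 y hy)).1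
  have hmem : ∀ u ∈ (0 :: L.map (· + 1)), ∀ u' ∈ (0 :: L.map (· + 1)), u ≠ u' →
      (u < u' ∧ G.testBit (u' - u - 1)) ∨ (u' < u ∧ G.testBit (u - u' - 1)) := by
    intro u hu u' hu' hne
    have hpw := List.pairwise_iff_getElem.1 hnodup
    obtain ⟨i, hi, rfl⟩ := List.getElem_of_mem hu
    obtain ⟨j, hj, rfl⟩ := List.getElem_of_mem hu'
    rcases lt_trichotomy i j with h | rfl | h
    · exact Or.inl (hpw i j hi hj h)
    · exact absurd rfl hne
    · exact Or.inr (hpw j i hj hi h)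
  refine ⟨(0 :: L.map (· + 1)).toFinset, ?_, ?_, ?_⟩
  · rw [List.toFinset_card_of_nodup (hnodup.imp fun h => h.1.ne)]
    simp [h1]
  · intro u hu
    exact hlt u (by simpa using hu)
  · intro u hu u' hu'
    rw [List.mem_toFinset] at hu hu'
    have hu1 := hlt u hu
    have hu2 := hlt u' hu'
    rcases eq_or_ne u u' with rfl | hne
    · rw [show p + u + M - u = p + M by omega, Nat.add_mod_right, Nat.mod_eq_of_lt hp]
      exact hpok
    · rcases hmem u hu u' hu' hne with ⟨h4, h5⟩ | ⟨h4, h5⟩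
      · obtain ⟨-, -, h6⟩ := hGbit _ h5
        rw [show p + u + M - u' = p + M - (u' - u - 1 + 1) by omega]
        exact h6
      · obtain ⟨-, h6, -⟩ := hGbit _ h5
        rw [show p + u + M - u' = p + (u - u' - 1 + 1) + M by omega, Nat.add_mod_right]
        exact h6

/-! ### Difference-avoiding sets and the degree three reduction. -/

/-- A large set avoiding prescribed differences. -/
theorem exists_sub_notMem {G : Type*} [AddCommGroup G] [Fintype G] [DecidableEq G] (S : Finset G)
    (h0 : (0 : G) ∉ S) : ∃ X : Finset G, (∀ x ∈ X, ∀ y ∈ X, x - y ∉ S) ∧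
      Fintype.card G ≤ X.card * (2 * S.card + 1) := by
  classical
  obtain ⟨X, hX, hmax⟩ := Finset.exists_max_image
    (Finset.univ.filter fun X : Finset G => ∀ x ∈ X, ∀ y ∈ X, x - y ∉ S) Finset.card ⟨∅, by simp⟩
  rw [Finset.mem_filter_univ] at hX
  refine ⟨X, hX, ?_⟩
  -- By maximality every element outside `X` has a forbidden difference with some element of `X`, so
  -- `X`, `X + S` and `X - S` cover the group.
  have hcover : (Finset.univ : Finset G) ⊆
      X ∪ ((X ×ˢ S).image (fun z => z.1 + z.2) ∪ (X ×ˢ S).image fun z => z.1 - z.2) := by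
    intro g _
    by_contra hg
    simp only [Finset.mem_union, Finset.mem_image, Finset.mem_product, Prod.exists, not_or,
      not_exists, not_and, and_imp] at hg
    obtain ⟨h1, h2, h3⟩ := hg
    have h4 := hmax (insert g X) ?_
    · rw [Finset.card_insert_of_notMem h1] at h4
      omega
    · rw [Finset.mem_filter_univ]
      intro x hx y hy hxy
      rw [Finset.mem_insert] at hx hy
      rcases hx with rfl | hx <;> rcases hy with rfl | hy
      · simp [h0] at hxy
      · exact h2 y _ hy hxy (by abel)
      · exact h3 x _ hx hxy (by abel)
      · exact hX x hx y hy hxy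
  have h5 := Finset.card_le_card hcover
  have h6 : ((X ×ˢ S).image (fun z => z.1 + z.2)).card ≤ X.card * S.card :=
    Finset.card_image_le.trans (by rw [Finset.card_product])
  have h7 : ((X ×ˢ S).image (fun z => z.1 - z.2)).card ≤ X.card * S.card :=
    Finset.card_image_le.trans (by rw [Finset.card_product])
  have h8 := Finset.card_union_le X
    ((X ×ˢ S).image (fun z => z.1 + z.2) ∪ (X ×ˢ S).image fun z => z.1 - z.2)
  have h9 := Finset.card_union_le ((X ×ˢ S).image (fun z => z.1 + z.2))
    ((X ×ˢ S).image fun z => z.1 - z.2)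
  rw [Finset.card_univ] at h5
  calc Fintype.card G ≤ X.card + (X.card * S.card + X.card * S.card) := by omega
    _ = X.card * (2 * S.card + 1) := by ring

namespace DualSpectrum

variable {q lam w p : ℕ} {Spec : ℕ → Prop}

/-- Here the differences of `U` are taken cyclically modulo `q * q`, so the top digit can receive a
carry. Restricting it to `q - 1` values leaves room for that carry, whence the factor `q - 1`. -/
theorem three_card_le (H : DualSpectrum q 3 lam p w Spec) (hq : 2 ≤ q) (hlam0 : 0 < lam)
    (hp : p < q * q) (hps : Spec p) (U : Finset ℕ) (hU : ∀ u ∈ U, u < q * q)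
    (hU' : ∀ u ∈ U, ∀ u' ∈ U, ¬ q ∣ (p + u + q * q - u') % (q * q) ∧
      p / q < (p + u + q * q - u') % (q * q)) : (q - 1) * U.card ≤ lam * w := by
  have hN : q ^ 3 = q * (q * q) := by ring
  have hinj : Set.InjOn (fun x : ℕ × ℕ => x.1 * (q * q) + x.2)
      (Finset.range (q - 1) ×ˢ U : Finset (ℕ × ℕ)) := by
    rintro ⟨v, u⟩ hx ⟨v', u'⟩ hx' hxx
    simp only [Finset.coe_product, Set.mem_prod, Finset.mem_coe] at hx hx' hxx
    have h1 := hU u hx.2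
    have h2 := hU u' hx'.2
    have h3 : v = v' := by
      have := congrArg (· / (q * q)) hxx
      simpa [Nat.add_comm, Nat.add_mul_div_right _ _ (show 0 < q * q by omega),
        Nat.div_eq_of_lt h1, Nat.div_eq_of_lt h2] using this
    subst h3
    exact Prod.ext rfl (by simpa using hxx)
  have h1 := H.card_le hlam0 hps
    ((Finset.range (q - 1) ×ˢ U).image fun x => x.1 * (q * q) + x.2) ?_ ?_
  · rwa [Finset.card_image_of_injOn hinj, Finset.card_product, Finset.card_range] at h1
  · intro a ha
    simp only [Finset.mem_image, Finset.mem_product, Finset.mem_range, Prod.exists] at ha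
    obtain ⟨v, u, ⟨hv, hu⟩, rfl⟩ := ha
    have h1 : (v + 2) * (q * q) ≤ q * (q * q) := Nat.mul_le_mul_right _ (by omega)
    rw [Nat.add_mul] at h1
    have := hU u hu
    omega
  · intro a ha a' ha' hlt _
    simp only [Finset.mem_image, Finset.mem_product, Finset.mem_range, Prod.exists] at ha ha'
    obtain ⟨v, u, ⟨hv, hu⟩, rfl⟩ := ha
    obtain ⟨v', u', ⟨hv', hu'⟩, rfl⟩ := ha'
    obtain ⟨h2, h3⟩ := hU' u hu u' hu'
    have h5 := hU u hu
    have h6 := hU u' hu'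
    have h9 := Nat.div_add_mod (p + u + q * q - u') (q * q)
    have hBlt : (p + u + q * q - u') % (q * q) < q * q := Nat.mod_lt _ (by omega)
    have hc : (p + u + q * q - u') / (q * q) < 3 := by
      rw [Nat.div_lt_iff_lt_mul (by omega)]
      omega
    generalize (p + u + q * q - u') % (q * q) = B at *
    generalize (p + u + q * q - u') / (q * q) = c at *
    have hvv : v' ≤ v := by
      by_contra! h
      have := Nat.mul_le_mul_right (q * q) h
      rw [Nat.succ_mul] at this
      omega
    have h7 := Nat.mul_le_mul_right (q * q) hvv
    -- The carry into the top digit is `c - 1`. A borrow with equal top digits would make the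
    -- difference of the two chain elements negative.
    have hV : v' + 1 ≤ v + c := by
      by_contra! h
      have hvv : v = v' := by omega
      subst hvv
      have hc0 : c = 0 := by omega
      rw [hc0] at h9
      omega
    have h8 : p + (v * (q * q) + u - (v' * (q * q) + u')) = (v + c - v' - 1) * (q * q) + B := by
      have e1 : (v + c - v' - 1) * (q * q) + (v' + 1) * (q * q) = (v + c) * (q * q) := by
        rw [← Nat.add_mul]; congr 1; omega
      rw [Nat.add_mul, Nat.add_mul] at e1
      rw [mul_comm] at h9
      omega
    rw [h8]
    refine H.odd_not_spec (h := 1) hq (by rfl) le_rfl (pow_one q) hp (by omega) hBlt h2 ?_ ?_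
    · simpa using h3
    · rw [← h8]; omega

end DualSpectrum

/-! ### Two-digit sets for `q ≥ 22`. -/

/-- Subtraction with borrow on two base `q` digits. -/
theorem two_digit_sub {q t w x x' j j' B : ℕ} (hw : w < q) (hx' : x' < q)
    (hj : j < q) (hj' : j' < q)
    (hB : B = ((t * q + w) + (x * q + j) + q * q - (x' * q + j')) % (q * q)) :
    ∃ ε : ℤ, -1 ≤ ε ∧ ε ≤ 1 ∧ ((B % q : ℕ) : ℤ) = w + j - j' - ε * q ∧
      ((B / q : ℕ) : ZMod q) = t + x - x' + (ε : ZMod q) := by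
  have hq0 : 0 < q := by omega
  have hle : x' * q + j' ≤ q * q := by
    have := Nat.mul_le_mul_right q (Nat.succ_le_of_lt hx')
    rw [Nat.succ_mul] at this
    omega
  have h1 := Nat.div_add_mod ((t * q + w) + (x * q + j) + q * q - (x' * q + j')) (q * q)
  rw [← hB] at h1
  set k := ((t * q + w) + (x * q + j) + q * q - (x' * q + j')) / (q * q)
  have h2 : (q : ℤ) * q * k + B = (t * q + w) + (x * q + j) + q * q - (x' * q + j') := by
    rw [← Nat.cast_mul, ← Nat.cast_mul, ← Nat.cast_add, h1]
    push_cast [Nat.cast_sub (show x' * q + j' ≤ (t * q + w) + (x * q + j) + q * q by omega)]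
    ring
  have h3 : (B : ℤ) = q * (B / q : ℕ) + (B % q : ℕ) := by
    exact_mod_cast (Nat.div_add_mod B q).symm
  have hl : B % q < q := Nat.mod_lt _ hq0
  generalize B % q = l at *
  generalize B / q = c at *
  have h4 : (w : ℤ) + j - j' - l = q * (c + q * k - t - x - q + x') := by
    rw [h3] at h2
    linear_combination -h2
  refine ⟨c + q * k - t - x - q + x', ?_, ?_, by linear_combination -h4, ?_⟩
  · by_contra! h
    have : (q : ℤ) * (c + q * k - t - x - q + x') ≤ q * (-2) :=
      mul_le_mul_of_nonneg_left (by omega) (by omega)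
    omega
  · by_contra! h
    have : (q : ℤ) * 2 ≤ q * (c + q * k - t - x - q + x') :=
      mul_le_mul_of_nonneg_left (by omega) (by omega)
    omega
  · push_cast
    simp

/-- Two-sided sets of two-digit numbers for `q ≥ 22`. -/
theorem exists_two_digit_set {q t w : ℕ} (hq : 22 ≤ q) (hw0 : 0 < w) (hw : w < q)
    (ht : t + 2 ≤ q) : ∃ U : Finset ℕ, q + 2 ≤ U.card ∧ (∀ u ∈ U, u < q * q) ∧
      ∀ u ∈ U, ∀ u' ∈ U, ¬ q ∣ (t * q + w + u + q * q - u') % (q * q) ∧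
        t < (t * q + w + u + q * q - u') % (q * q) := by
  have : NeZero q := ⟨by omega⟩
  have hcast : ∀ n : ℕ, 0 < n → n < q → (n : ZMod q) ≠ 0 := by
    intro n h1 h2 h3
    rw [ZMod.natCast_eq_zero_iff] at h3
    exact absurd (Nat.le_of_dvd h1 h3) (by omega)
  have hval : ∀ z : ZMod q, ((z.val : ℕ) : ZMod q) = z := fun z => ZMod.natCast_zmod_val z
  -- reduction to digit sets
  suffices h : ∃ X J : Finset (ZMod q), q + 2 ≤ X.card * J.card ∧
      (∀ j ∈ J, ∀ j' ∈ J, j - j' ≠ (w : ZMod q)) ∧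
      ∀ x ∈ X, ∀ x' ∈ X, ∀ j ∈ J, ∀ j' ∈ J, ∀ ε : ℤ, -1 ≤ ε → ε ≤ 1 →
        (t : ZMod q) + x - x' + (ε : ZMod q) = 0 → 
        ∀ l : ℕ, (l : ℤ) = w + j.val - j'.val - ε * q → 0 < l → t < l by
    obtain ⟨X, J, h1, h2, h3⟩ := h
    have hinj : Set.InjOn (fun z : ZMod q × ZMod q => z.1.val * q + z.2.val)
        (X ×ˢ J : Finset (ZMod q × ZMod q)) := by
      rintro ⟨x, j⟩ - ⟨x', j'⟩ - hxx
      have hj := ZMod.val_lt j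
      have hj' := ZMod.val_lt j'
      have h5 : (x.val * q + j.val) / q = (x'.val * q + j'.val) / q := congrArg (· / q) hxx
      have h6 := congrArg (· % q) hxx
      simp only [Nat.mul_add_mod_self_right, Nat.mod_eq_of_lt hj, Nat.mod_eq_of_lt hj'] at h6
      have hq0 : 0 < q := by omega
      rw [mul_comm x.val, mul_comm x'.val, Nat.mul_add_div hq0, Nat.mul_add_div hq0,
        Nat.div_eq_of_lt hj, Nat.div_eq_of_lt hj', add_zero, add_zero] at h5
      exact Prod.ext (ZMod.val_injective q h5) (ZMod.val_injective q h6)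
    refine ⟨(X ×ˢ J).image fun z => z.1.val * q + z.2.val, ?_, ?_, ?_⟩
    · rwa [Finset.card_image_of_injOn hinj, Finset.card_product]
    · intro u hu
      simp only [Finset.mem_image, Finset.mem_product, Prod.exists] at hu
      obtain ⟨x, j, -, rfl⟩ := hu
      have h5 := Nat.mul_le_mul_right q (Nat.succ_le_of_lt (ZMod.val_lt x))
      have := ZMod.val_lt j
      rw [Nat.succ_mul] at h5
      omega
    · intro u hu u' hu'
      simp only [Finset.mem_image, Finset.mem_product, Prod.exists] at hu hu'
      obtain ⟨x, j, ⟨hx, hj⟩, rfl⟩ := hu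
      obtain ⟨x', j', ⟨hx', hj'⟩, rfl⟩ := hu'
      obtain ⟨B, hB⟩ : ∃ B, B = (t * q + w + (x.val * q + j.val) + q * q -
        (x'.val * q + j'.val)) % (q * q) := ⟨_, rfl⟩
      rw [← hB]
      obtain ⟨ε, e1, e2, e3, e4⟩ := two_digit_sub hw (ZMod.val_lt x') (ZMod.val_lt j)
        (ZMod.val_lt j') hB
      rw [hval, hval] at e4
      have hl0 : B % q ≠ 0 := by
        intro h0
        have h5 := congrArg (Int.cast : ℤ → ZMod q) e3
        rw [h0] at h5
        push_cast at h5
        rw [hval, hval, ZMod.natCast_self, mul_zero, sub_zero] at h5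
        exact h2 j' hj' j hj (by linear_combination h5)
      refine ⟨fun h0 => hl0 (Nat.mod_eq_zero_of_dvd h0), ?_⟩
      have hBd := Nat.div_add_mod B q
      rcases Nat.eq_zero_or_pos (B / q) with h0 | h0
      · have := h3 x hx x' hx' j hj j' hj' ε e1 e2 (by rw [← e4, h0, Nat.cast_zero]) _ e3
          (Nat.pos_of_ne_zero hl0)
        rw [h0] at hBd
        omega
      · have := Nat.mul_le_mul_left q h0
        omega
  have hcard : Fintype.card (ZMod q) = q := ZMod.card q
  have huniv : (Finset.univ : Finset (ZMod q)).card = q := by rw [Finset.card_univ, hcard]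
  rcases Nat.lt_trichotomy t 1 with ht1 | rfl | ht1
  · obtain ⟨J, hJ, hJc⟩ := exists_sub_notMem {(w : ZMod q)} (by simpa using (hcast w hw0 hw).symm)
    rw [hcard, Finset.card_singleton] at hJc
    refine ⟨Finset.univ, J, ?_, ?_, ?_⟩
    · rw [huniv]; nlinarith
    · intro j hj j' hj' h
      exact hJ j hj j' hj' (by simpa using h)
    · intros
      omega
  · rcases Nat.lt_or_ge 1 w with hw1 | hw1
    · obtain ⟨J, hJ, hJc⟩ := exists_sub_notMem {(w : ZMod q), ((w - 1 : ℕ) : ZMod q)}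
        (by simpa using ⟨(hcast w hw0 hw).symm, (hcast (w - 1) (by omega) (by omega)).symm⟩)
      rw [hcard] at hJc
      have h2 := Finset.card_le_two (a := (w : ZMod q)) (b := ((w - 1 : ℕ) : ZMod q))
      refine ⟨Finset.univ, J, ?_, ?_, ?_⟩
      · rw [huniv]
        have h3 : q ≤ J.card * 5 := hJc.trans (Nat.mul_le_mul_left _ (by omega))
        nlinarith
      · intro j hj j' hj' h
        exact hJ j hj j' hj' (by simp [h])
      · intro x _ x' _ j hj j' hj' ε _ _ _ l hl hl0
        by_contra! h1
        have hl1 : l = 1 := by omega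
        have h5 := congrArg (Int.cast : ℤ → ZMod q) hl
        push_cast at h5
        rw [hval, hval, ZMod.natCast_self, mul_zero, sub_zero, hl1] at h5
        refine hJ j' hj' j hj ?_
        rw [Finset.mem_insert, Finset.mem_singleton]
        right
        rw [Nat.cast_sub hw1.le]
        push_cast at h5 ⊢
        linear_combination h5
    -- The forbidden lower digit `1` now comes from the difference `w - 1 = 0`, which no set avoids.
    -- Then `j = j'` and no borrow occurs, so it suffices that the upper digits avoid the difference
    -- `1`.
    · have hw1 : w = 1 := by omega
      subst hw1
      obtain ⟨J, hJ, hJc⟩ := exists_sub_notMem {(1 : ZMod q)}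
        (by simpa using (hcast 1 hw0 hw).symm)
      rw [hcard, Finset.card_singleton] at hJc
      refine ⟨J, J, ?_, ?_, ?_⟩
      · nlinarith
      · intro j hj j' hj' h
        exact hJ j hj j' hj' (by simpa using h)
      · intro x hx x' hx' j hj j' hj' ε _ _ h0 l hl hl0
        by_contra! h1
        have hl1 : l = 1 := by omega
        have h5 := congrArg (Int.cast : ℤ → ZMod q) hl
        push_cast at h5
        rw [hval, hval, ZMod.natCast_self, mul_zero, sub_zero, hl1] at h5
        have hjj : j = j' := by
          push_cast at h5
          linear_combination -h5
        subst hjj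
        have hε : ε = 0 := by
          have : ε * q = 0 := by rw [hl1] at hl; push_cast at hl; linarith
          rcases mul_eq_zero.1 this with h | h
          · exact h
          · omega
        subst hε
        refine hJ x' hx' x hx ?_
        rw [Finset.mem_singleton]
        push_cast at h0
        linear_combination -h0
  · obtain ⟨J, hJ, hJc⟩ := exists_sub_notMem {(w : ZMod q)} (by simpa using (hcast w hw0 hw).symm)
    rw [hcard, Finset.card_singleton] at hJc
    obtain ⟨X, hX, hXc⟩ := exists_sub_notMem
      {(t : ZMod q), ((t + 1 : ℕ) : ZMod q), ((t - 1 : ℕ) : ZMod q)}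
      (by simpa using ⟨(hcast t (by omega) (by omega)).symm,
        by simpa using (hcast (t + 1) (by omega) (by omega)).symm,
        (hcast (t - 1) (by omega) (by omega)).symm⟩)
    rw [hcard] at hXc
    have h3 := Finset.card_le_three (a := (t : ZMod q)) (b := ((t + 1 : ℕ) : ZMod q))
      (c := ((t - 1 : ℕ) : ZMod q))
    have h7 : q ≤ X.card * 7 := hXc.trans (Nat.mul_le_mul_left _ (by omega))
    refine ⟨X, J, ?_, ?_, ?_⟩
    -- Here `q ^ 2 ≤ 21 * X.card * J.card`, and `22` is the first value with `q ^ 2 > 21 * (q + 1)`.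
    · have h8 := Nat.mul_le_mul h7 hJc
      by_contra! h9
      nlinarith
    · intro j hj j' hj' h
      exact hJ j hj j' hj' (by simpa using h)
    · intro x hx x' hx' j hj j' hj' ε h1 h2 h0 
      exfalso
      refine hX x' hx' x hx ?_
      have hx0 : x' - x = t + (ε : ZMod q) := by linear_combination -h0
      rw [hx0, Finset.mem_insert, Finset.mem_insert, Finset.mem_singleton]
      obtain rfl | rfl | rfl : ε = -1 ∨ ε = 0 ∨ ε = 1 := by omega
      · right; right
        rw [Nat.cast_sub (by omega)]
        push_cast; ring
      · left
        simp
      · right; left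
        push_cast; ring

/-! ### Masks of possible spectral exponents and verified chains. -/

/-- The mask of the residues `e, q e, …, q ^ (k - 1) e` modulo `N`. -/
def rotBits (N q : ℕ) : ℕ → ℕ → ℕ
  | 0, _ => 0
  | k + 1, e => 2 ^ e ||| rotBits N q k (e * q % N)

/-- The mask of the residues `r q ^ k` modulo `N` with `k < m`, `1 ≤ r ≤ D` and `al r`. -/
def badMask (N q m : ℕ) (al : ℕ → Bool) : ℕ → ℕ
  | 0 => 0
  | r + 1 => badMask N q m al r ||| bif al (r + 1) then rotBits N q m (r + 1) else 0

/-- First-fit count of a chain with start `s` whose differences avoid the mask `X`. -/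
def chainCount (N X fuel s : ℕ) : ℕ :=
  greedyCount (rotMask N ((2 ^ N - 1) ^^^ X) (s + 1)) fuel
    (rotMask N ((2 ^ N - 1) ^^^ X) (s + 1)) + 1

/-- Verification of an explicit chain with start `s` whose differences avoid the mask `X`. -/
def chainListOk (N X s : ℕ) : List ℕ → Bool
  | [] => true
  | a :: l => Nat.blt a N && (l.all (fun a' => !(Nat.testBit X ((s + a' + N - a) % N))) &&
      chainListOk N X s l)

theorem testBit_rotBits {N q k e : ℕ} (he : e < N) {j : ℕ} (hj : j < k) :
    (rotBits N q k e).testBit (e * q ^ j % N) := by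
  induction k generalizing e j with
  | zero => omega
  | succ k ih =>
    rw [rotBits, Nat.testBit_lor, Bool.or_eq_true]
    cases j with
    | zero =>
      left
      rw [pow_zero, mul_one, Nat.mod_eq_of_lt he]
      exact Nat.testBit_two_pow_self
    | succ j =>
      right
      have := ih (Nat.mod_lt (e * q) (by omega)) (show j < k by omega)
      rwa [Nat.mod_mul_mod, mul_assoc, ← pow_succ'] at this

theorem testBit_badMask {N q m D : ℕ} {al : ℕ → Bool} (hD : D < N) {r j : ℕ} (hr1 : 1 ≤ r)
    (hr : r ≤ D) (hal : al r) (hj : j < m) : (badMask N q m al D).testBit (r * q ^ j % N) := by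
  induction D with
  | zero => omega
  | succ D ih =>
    rw [badMask, Nat.testBit_lor, Bool.or_eq_true]
    rcases hr.eq_or_lt with rfl | hr
    · right
      rw [hal, cond_true]
      exact testBit_rotBits hD hj
    · exact Or.inl (ih (by omega) (by omega))

theorem testBit_mask_compl {N X e : ℕ} (h : ((2 ^ N - 1) ^^^ X).testBit e) (he : e < N) :
    X.testBit e = false := by
  rw [Nat.testBit_xor, Nat.testBit_two_pow_sub_one, decide_eq_true he] at h
  simpa using h

namespace DualSpectrum

variable {q m lam D w : ℕ} {Spec : ℕ → Prop}

/-- The mask contains every conjugate of every leader that is allowed by `al`, and each spectral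
exponent has a leader not divisible by `q`. The test `al` need only be true on such leaders. -/
theorem not_of_testBit_badMask (H : DualSpectrum q m lam D w Spec) (hq : 2 ≤ q) (hm : 0 < m)
    (hD : D < q ^ m - 1) {al : ℕ → Bool}
    (hal : ∀ r, 1 ≤ r → r ≤ D → Spec r → ¬ q ∣ r → al r) {e : ℕ}
    (he : (badMask (q ^ m - 1) q m al D).testBit (e % (q ^ m - 1)) = false) : ¬ Spec e := by
  intro hs
  obtain ⟨r, h1, h2, h3, h4, j, hj⟩ := H.lead_not_dvd hq hm hs
  have hpow : q ^ m ≡ 1 [MOD q ^ m - 1] :=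
    ((Nat.modEq_iff_dvd' (Nat.one_le_pow _ _ (by omega))).2 (dvd_refl _)).symm
  have hjm : j % m < m := Nat.mod_lt _ hm
  have h5 : r * q ^ ((m - j % m) % m) ≡ e [MOD q ^ m - 1] := by
    have h6 : r ≡ q ^ (j % m) * e [MOD q ^ m - 1] := by
      refine hj.trans (Nat.ModEq.mul_right _ ?_)
      conv_lhs => rw [← Nat.div_add_mod j m, pow_add, _root_.pow_mul]
      simpa using (hpow.pow (j / m)).mul_right (q ^ (j % m))
    refine (h6.mul_right _).trans ?_
    rw [mul_right_comm, ← pow_add]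
    rcases Nat.eq_zero_or_pos (j % m) with h | h
    · rw [h, Nat.sub_zero, Nat.mod_self, pow_zero, one_mul]
    · rw [Nat.mod_eq_of_lt (show m - j % m < m by omega), show j % m + (m - j % m) = m by omega]
      simpa using hpow.mul_right e
  have := testBit_badMask (N := q ^ m - 1) (q := q) hD h1 h2 (hal r h1 h2 h3 h4)
    (Nat.mod_lt (m - j % m) hm)
  rw [h5, he] at this
  exact absurd this (by simp)

theorem chainCount_le (H : DualSpectrum q m lam D w Spec) (hlam : 0 < lam) {X : ℕ}
    (hX : ∀ e, X.testBit (e % (q ^ m - 1)) = false → ¬ Spec e) (hX' : X < 2 ^ (q ^ m - 1))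
    {s : ℕ} (hs : Spec s) (hsN : s < q ^ m - 1) (fuel : ℕ) :
    chainCount (q ^ m - 1) X fuel s ≤ lam * w := by
  set N := q ^ m - 1 with hN
  rw [chainCount]
  set G := rotMask N ((2 ^ N - 1) ^^^ X) (s + 1) with hG
  have hlt : (2 ^ N - 1) ^^^ X < 2 ^ N := by
    refine Nat.xor_lt_two_pow ?_ hX'
    have : 0 < 2 ^ N := by positivity
    omega
  have hGbit : ∀ i, G.testBit i → i < N - 1 ∧ ¬ Spec (s + (i + 1)) := by
    intro i hi
    obtain ⟨h1, h2⟩ := testBit_rotMask hlt (by omega) hi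
    refine ⟨h1, ?_⟩
    have h3 := testBit_mask_compl h2 (Nat.mod_lt _ (by omega))
    rw [show s + (i + 1) = s + 1 + i by omega]
    exact hX _ h3
  obtain ⟨L, h1, h2, h3⟩ := exists_list_of_greedyCount G fuel G
  have h4 := H.list_length_le hlam hs (0 :: L.map (· + 1)) ?_ ?_
  · simpa [h1] using h4
  · intro a ha
    simp only [List.mem_cons, List.mem_map] at ha
    rcases ha with rfl | ⟨y, hy, rfl⟩
    · omega
    · have := (hGbit y (h2 y hy)).1
      omega
  · rw [List.pairwise_cons, List.pairwise_map]
    refine ⟨?_, ?_⟩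
    · intro x hx _
      simp only [List.mem_map] at hx
      obtain ⟨y, hy, rfl⟩ := hx
      rw [Nat.sub_zero, H.add_period]
      exact (hGbit y (h2 y hy)).2
    · refine h3.imp_of_mem fun {x y} hx hy h _ => ?_
      have h5 := (hGbit x (h2 x hx)).1
      rw [show s + (y + 1) + (q ^ m - 1) - (x + 1) = s + (y - x - 1 + 1) + (q ^ m - 1) by omega,
        H.add_period]
      exact (hGbit _ h.2).2

theorem length_le_of_chainListOk (H : DualSpectrum q m lam D w Spec) (hlam : 0 < lam) {X : ℕ}
    (hX : ∀ e, X.testBit (e % (q ^ m - 1)) = false → ¬ Spec e) {s : ℕ} (hs : Spec s) (L : List ℕ)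
    (hL : chainListOk (q ^ m - 1) X s L) : L.length ≤ lam * w := by
  have key : ∀ L : List ℕ, chainListOk (q ^ m - 1) X s L → (∀ a ∈ L, a < q ^ m - 1) ∧
      L.Pairwise fun a a' => ¬ Spec (s + a' + (q ^ m - 1) - a) := by
    intro L
    induction L with
    | nil => simp
    | cons a L ih =>
      intro h
      simp only [chainListOk, Bool.and_eq_true, List.all_eq_true, Bool.not_eq_true'] at h
      obtain ⟨h1, h2, h3⟩ := h
      obtain ⟨h4, h5⟩ := ih h3
      refine ⟨?_, List.pairwise_cons.2 ⟨fun a' ha' => hX _ (h2 a' ha'), h5⟩⟩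
      intro b hb
      rcases List.mem_cons.1 hb with rfl | hb
      · simpa [Nat.blt_eq] using h1
      · exact h4 b hb
  obtain ⟨h1, h2⟩ := key L hL
  refine H.list_length_le hlam hs L h1 (h2.imp ?_)
  intro a a' h _
  exact h

end DualSpectrum

theorem rotBits_lt {N q k e : ℕ} (he : e < N) : rotBits N q k e < 2 ^ N := by
  induction k generalizing e with
  | zero => simp [rotBits]
  | succ k ih =>
    rw [rotBits]
    exact Nat.or_lt_two_pow (Nat.pow_lt_pow_right (by omega) he)
      (ih (Nat.mod_lt _ (by omega)))

theorem badMask_lt {N q m D : ℕ} {al : ℕ → Bool} (hD : D < N) :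
    badMask N q m al D < 2 ^ N := by
  induction D with
  | zero => simp [badMask]
  | succ D ih =>
    rw [badMask]
    refine Nat.or_lt_two_pow (ih (by omega)) ?_
    cases al (D + 1)
    · simp
    · exact rotBits_lt hD

/-! ### Degree three over small fields. -/

/-- Admissibility of a two-digit residue with respect to a leader with leading digit `t`. -/
def threeOk (q t B : ℕ) : Bool := !(B % q == 0) && Nat.blt t B

/-- First-fit count of two-digit sets. -/
def threeCount (q t w : ℕ) : ℕ :=
  twoSidedCount (q * q) (maskOf (threeOk q t) (q * q))
    (maskOf (fun i => threeOk q t ((q * q - i) % (q * q))) (q * q)) (q + 2) (t * q + w)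

/-- First-fit count of three-digit chains. -/
def threeChain (q p k : ℕ) : ℕ :=
  chainCount (q ^ 3 - 1) (badMask (q ^ 3 - 1) q 3 (fun r => !(r % q == 0)) p) (q * q + 2 * q)
    (p * q ^ k % (q ^ 3 - 1))

/-- The number of words to be produced for a leader with leading digit `t`. -/
def threeTarget (q t : ℕ) : ℕ :=
  q * q + (bif q % 2 == 0 then q - 4 else 0) - bif t + 2 == q then q - 4 else 0

/-- Check of all leaders by two-digit sets. -/
def threeCheck (q : ℕ) (skip : List (ℕ × ℕ)) : Bool :=
  (List.range (q - 1)).all fun t => (List.range q).all fun w =>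
    (w == 0) || (t == 0 && !(w + 1 == q)) || skip.contains (t, w) ||
    Nat.ble (q + 2) (threeCount q t w)

/-- Check of given leaders by three-digit chains. -/
def threeChainCheck (q : ℕ) (l : List (ℕ × ℕ)) : Bool :=
  l.all fun z => Nat.ble (threeTarget q z.1) (threeChain q (z.1 * q + z.2) 0) ||
    Nat.ble (threeTarget q z.1) (threeChain q (z.1 * q + z.2) 1) ||
    Nat.ble (threeTarget q z.1) (threeChain q (z.1 * q + z.2) 2)

/-- The leaders listed as exceptions for `8` and `9` are covered by three-digit chains instead of
two-digit sets; fields with `4`, `5` and `7` elements use such chains throughout. -/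
theorem threeCheck_eight : threeCheck 8 [(3, 3), (5, 3), (5, 5)] = true := by decide +kernel
theorem threeCheck_nine : threeCheck 9 [(3, 3), (6, 3), (6, 6)] = true := by decide +kernel
theorem threeCheck_eleven : threeCheck 11 [] = true := by decide +kernel
theorem threeCheck_thirteen : threeCheck 13 [] = true := by decide +kernel
theorem threeCheck_sixteen : threeCheck 16 [] = true := by decide +kernel
theorem threeCheck_seventeen : threeCheck 17 [] = true := by decide +kernel
theorem threeCheck_nineteen : threeCheck 19 [] = true := by decide +kernel
theorem threeChainCheck_eight : threeChainCheck 8 [(3, 3), (5, 3), (5, 5)] = true := by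
  decide +kernel
theorem threeChainCheck_nine : threeChainCheck 9 [(3, 3), (6, 3), (6, 6)] = true := by
  decide +kernel
theorem threeChainCheck_four : threeChainCheck 4 [(1, 3), (2, 1)] = true := by
  decide +kernel
/-- Leaders for five elements that are covered by first-fit chains. -/
def threeLeaders_five : List (ℕ × ℕ) :=
  [(0, 4), (1, 1), (1, 2), (1, 3), (1, 4), (2, 1), (2, 2), (2, 3), (2, 4)]

theorem threeChainCheck_five : threeChainCheck 5 threeLeaders_five = true := by
  decide +kernel
/-- Leaders for seven elements that are covered by first-fit chains. -/
def threeLeaders_seven : List (ℕ × ℕ) :=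
    [(0, 6), (1, 1), (1, 2), (1, 3), (1, 4), (1, 5), (1, 6), (2, 1), (2, 2), (2, 3), (2, 4), (2, 5),
      (2, 6), (3, 1), (3, 2), (3, 3), (3, 4), (3, 5), (3, 6), (4, 1), (4, 2), (4, 3), (4, 4), (4, 5),
      (4, 6), (5, 3), (5, 4)]

theorem threeChainCheck_seven : threeChainCheck 7 threeLeaders_seven = true := by
  decide +kernel

/-- An explicit chain for the leader 16 and 5 elements. -/
def chain_five_sixteen : List ℕ :=
    [6, 11, 31, 36, 56, 61, 81, 86, 106, 111, 12, 37, 62, 87, 112, 13, 38, 63, 88, 113,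
    14, 39, 64, 89, 114]

/-- An explicit chain for the leader 17 and 5 elements. -/
def chain_five_seventeen : List ℕ :=
    [63, 64, 13, 14, 88, 89, 38, 39, 113, 114, 68, 69, 15, 19, 93, 94, 40, 44, 118, 119,
    70, 20, 95, 45, 120]

/-- An explicit chain for the leader 36 and 7 elements. -/
def chain_seven_thirtysix : List ℕ :=
    [72, 170, 268, 219, 317, 275, 226, 324, 73, 171, 122, 80, 178, 276, 227, 325, 25, 123,
    81, 179, 277, 228, 326, 26, 124, 82, 180, 278, 229, 327, 27, 125, 83, 181, 279, 230,
    328, 28, 126, 84, 182, 280, 231, 329, 29, 36]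

/-- An explicit chain for the leader 37 and 7 elements. -/
def chain_seven_thirtyseven : List ℕ :=
    [15, 18, 19, 39, 40, 43, 46, 47, 67, 68, 88, 89, 92, 95, 96, 116, 117, 137, 138, 141,
    144, 145, 165, 166, 186, 187, 190, 193, 194, 214, 215, 235, 236, 239, 242, 243, 263,
    264, 284, 285, 288, 291, 292, 312, 313, 316, 319, 320]

theorem chainListOk_five_sixteen : chainListOk (5 ^ 3 - 1) (badMask (5 ^ 3 - 1) 5 3
    (fun r => !(r % 5 == 0)) 16) 16 chain_five_sixteen = true := by
  decide +kernel

theorem chainListOk_five_seventeen : chainListOk (5 ^ 3 - 1) (badMask (5 ^ 3 - 1) 5 3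
    (fun r => !(r % 5 == 0)) 17) 17 chain_five_seventeen = true := by
  decide +kernel

theorem chainListOk_seven_thirtysix : chainListOk (7 ^ 3 - 1) (badMask (7 ^ 3 - 1) 7 3
    (fun r => !(r % 7 == 0)) 36) 36 chain_seven_thirtysix = true := by
  decide +kernel

theorem chainListOk_seven_thirtyseven : chainListOk (7 ^ 3 - 1) (badMask (7 ^ 3 - 1) 7 3
    (fun r => !(r % 7 == 0)) 37) 37 chain_seven_thirtyseven = true := by
  decide +kernel

namespace DualSpectrum

variable {q lam w p : ℕ} {Spec : ℕ → Prop}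

theorem three_of_threeCount (H : DualSpectrum q 3 lam p w Spec) (hq : 4 ≤ q) (hlam0 : 0 < lam)
    (hp : p + 3 ≤ (q - 1) * q) (hps : Spec p) (hqp : ¬ q ∣ p) (hp1 : q - 1 ≤ p)
    {skip : List (ℕ × ℕ)} (hc : threeCheck q skip = true) (hsk : (p / q, p % q) ∉ skip) :
    (q - 1) * (q + 2) ≤ lam * w := by
  have hdm := Nat.div_add_mod p q
  have hqq : (q - 1) * q + q = q * q := by rw [← Nat.succ_mul]; congr 1; omega
  have hw : p % q < q := Nat.mod_lt _ (by omega)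
  have hw0 : p % q ≠ 0 := fun h => hqp (Nat.dvd_of_mod_eq_zero h)
  have ht : p / q < q - 1 := by
    rw [Nat.div_lt_iff_lt_mul (by omega)]
    omega
  have hple : q ≤ q * q := Nat.le_mul_of_pos_left _ (by omega)
  have h1 : q + 2 ≤ threeCount q (p / q) (p % q) := by
    simp only [threeCheck, List.all_eq_true, List.mem_range, Bool.or_eq_true, beq_iff_eq,
      Bool.and_eq_true, Bool.not_eq_true', beq_eq_false_iff_ne, List.contains_iff_mem] at hc
    rcases hc _ ht _ hw with ((h | h) | h) | h
    · exact absurd h hw0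
    · rw [h.1] at hdm
      omega
    · exact absurd h hsk
    · exact Nat.le_of_ble_eq_true h
  have hpt : p / q < p := Nat.div_lt_self (by omega) (by omega)
  obtain ⟨U, hU1, hU2, hU3⟩ := exists_finset_of_twoSidedCount (M := q * q) (threeOk q (p / q))
    (p := p / q * q + p % q) (by rw [mul_comm, hdm]; omega) (by rw [mul_comm, hdm]; omega)
    (by rw [mul_comm, hdm]; simp [threeOk, Nat.blt_eq, hw0, hpt]) (q + 2)
  rw [mul_comm (p / q), hdm] at hU3
  have h2 := H.three_card_le (by omega) hlam0 (by omega) hps U hU2 fun u hu u' hu' => by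
    have := hU3 u hu u' hu'
    simp only [threeOk, Bool.and_eq_true, Bool.not_eq_true', beq_eq_false_iff_ne, Nat.blt_eq] at this
    exact ⟨fun h => this.1 (Nat.mod_eq_zero_of_dvd h), this.2⟩
  exact (Nat.mul_le_mul_left _ (by rw [hU1]; exact h1)).trans h2

theorem three_mask (H : DualSpectrum q 3 lam p w Spec) (hq : 2 ≤ q)
    (hp : p < q ^ 3 - 1) (e : ℕ)
    (he : (badMask (q ^ 3 - 1) q 3 (fun r => !(r % q == 0)) p).testBit (e % (q ^ 3 - 1)) = false) :
    ¬ Spec e :=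
  H.not_of_testBit_badMask hq (by norm_num) hp
    (fun r _ _ _ h => by simpa using fun h' => h (Nat.dvd_of_mod_eq_zero h')) he

theorem three_of_threeChain (H : DualSpectrum q 3 lam p w Spec) (hq : 2 ≤ q) (hlam0 : 0 < lam)
    (hp : p < q ^ 3 - 1) (hps : Spec p) {l : List (ℕ × ℕ)} (hc : threeChainCheck q l = true)
    (hl : (p / q, p % q) ∈ l) : threeTarget q (p / q) ≤ lam * w := by
  have key : ∀ k, threeChain q p k ≤ lam * w := by
    intro k
    refine H.chainCount_le hlam0 (H.three_mask hq hp) (badMask_lt hp) ?_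
      (Nat.mod_lt _ (by omega)) _
    rw [H.congr (Nat.mod_modEq _ _), mul_comm, H.pow_mul]
    exact hps
  simp only [threeChainCheck, List.all_eq_true, Bool.or_eq_true] at hc
  have h := hc _ hl
  simp only [mul_comm (p / q), Nat.div_add_mod] at h
  rcases h with (h | h) | h
  · exact (Nat.le_of_ble_eq_true h).trans (key 0)
  · exact (Nat.le_of_ble_eq_true h).trans (key 1)
  · exact (Nat.le_of_ble_eq_true h).trans (key 2)

/-- This is why `q + 2` is the size asked of two-digit sets: `(q - 1) * (q + 2) = q ^ 2 + q - 2`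
beats the largest target `q ^ 2 + q - 4`. -/
theorem threeTarget_le (q t : ℕ) (hq : 4 ≤ q) : threeTarget q t ≤ (q - 1) * (q + 2) := by
  obtain ⟨k, rfl⟩ := Nat.exists_eq_add_of_le hq
  have : (4 + k - 1) * (4 + k + 2) = (4 + k) * (4 + k) + (2 + k) := by
    rw [show 4 + k - 1 = 3 + k by omega]; ring
  rw [this, threeTarget]
  rcases Bool.eq_false_or_eq_true ((4 + k) % 2 == 0) with h | h <;>
    rcases Bool.eq_false_or_eq_true (t + 2 == 4 + k) with h' | h' <;>
    simp only [h, h', cond_true, cond_false] <;> omega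

theorem three_of_check (H : DualSpectrum q 3 lam p w Spec) (hq : 4 ≤ q)
    (hlam0 : 0 < lam) (hp : p + 3 ≤ (q - 1) * q) (hps : Spec p) (hqp : ¬ q ∣ p)
    (hp1 : q - 1 ≤ p) (hpN : p < q ^ 3 - 1) {skip : List (ℕ × ℕ)}
    (h1 : threeCheck q skip = true) (h2 : threeChainCheck q skip = true) :
    threeTarget q (p / q) ≤ lam * w := by
  by_cases h : (p / q, p % q) ∈ skip
  · exact H.three_of_threeChain (by omega) hlam0 hpN hps h2 h
  · exact (threeTarget_le _ _ hq).trans (H.three_of_threeCount hq hlam0 hp hps hqp hp1 h1 h)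

theorem three_four (H : DualSpectrum 4 3 lam p w Spec) (hlam0 : 0 < lam) (hp : p ≤ 9)
    (hps : Spec p) (hqp : ¬ 4 ∣ p) (hp4 : 7 ≤ p) : threeTarget 4 (p / 4) ≤ lam * w := by
  have key : ∀ p < 10, ¬ 4 ∣ p ∧ 7 ≤ p → (p / 4, p % 4) ∈ [(1, 3), (2, 1)] := by decide
  exact H.three_of_threeChain (by omega) hlam0 (by omega) hps threeChainCheck_four
    (key p (by omega) ⟨hqp, hp4⟩)

theorem three_five (H : DualSpectrum 5 3 lam p w Spec) (hlam0 : 0 < lam) (hp : p ≤ 17)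
    (hps : Spec p) (hqp : ¬ 5 ∣ p) (hp4 : 4 ≤ p) : threeTarget 5 (p / 5) ≤ lam * w := by
  have hpN : p < 5 ^ 3 - 1 := by omega
  by_cases h16 : p = 16 ∨ p = 17
  · rcases h16 with rfl | rfl
    · have h1 := H.length_le_of_chainListOk hlam0 (H.three_mask (by omega) hpN) hps _
        chainListOk_five_sixteen
      have h2 : threeTarget 5 (16 / 5) ≤ chain_five_sixteen.length := by decide
      exact h2.trans h1
    · have h1 := H.length_le_of_chainListOk hlam0 (H.three_mask (by omega) hpN) hps _
        chainListOk_five_seventeen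
      have h2 : threeTarget 5 (17 / 5) ≤ chain_five_seventeen.length := by decide
      exact h2.trans h1
  · have key : ∀ p < 18, ¬ 5 ∣ p ∧ 4 ≤ p ∧ ¬ (p = 16 ∨ p = 17) →
        (p / 5, p % 5) ∈ threeLeaders_five := by decide
    exact H.three_of_threeChain (by omega) hlam0 hpN hps threeChainCheck_five
      (key p (by omega) ⟨hqp, hp4, h16⟩)

theorem three_seven (H : DualSpectrum 7 3 lam p w Spec) (hlam0 : 0 < lam) (hp : p ≤ 39)
    (hps : Spec p) (hqp : ¬ 7 ∣ p) (hp4 : 6 ≤ p) : threeTarget 7 (p / 7) ≤ lam * w := by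
  have hpN : p < 7 ^ 3 - 1 := by omega
  by_cases h16 : p = 36 ∨ p = 37
  · rcases h16 with rfl | rfl
    · have h1 := H.length_le_of_chainListOk hlam0 (H.three_mask (by omega) hpN) hps _
        chainListOk_seven_thirtysix
      have h2 : threeTarget 7 (36 / 7) ≤ chain_seven_thirtysix.length := by decide
      exact h2.trans h1
    · have h1 := H.length_le_of_chainListOk hlam0 (H.three_mask (by omega) hpN) hps _
        chainListOk_seven_thirtyseven
      have h2 : threeTarget 7 (37 / 7) ≤ chain_seven_thirtyseven.length := by decide
      exact h2.trans h1
  · have key : ∀ p < 40, ¬ 7 ∣ p ∧ 6 ≤ p ∧ ¬ (p = 36 ∨ p = 37) →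
        (p / 7, p % 7) ∈ threeLeaders_seven := by decide
    exact H.three_of_threeChain (by omega) hlam0 hpN hps threeChainCheck_seven
      (key p (by omega) ⟨hqp, hp4, h16⟩)

theorem three_of_check_nil (H : DualSpectrum q 3 lam p w Spec) (hq : 4 ≤ q)
    (hlam0 : 0 < lam) (hp : p + 3 ≤ (q - 1) * q) (hps : Spec p) (hqp : ¬ q ∣ p)
    (hp1 : q - 1 ≤ p) (h1 : threeCheck q [] = true) : threeTarget q (p / q) ≤ lam * w :=
  (threeTarget_le _ _ hq).trans (H.three_of_threeCount hq hlam0 hp hps hqp hp1 h1 (by simp))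

/-- Weight bound for extension degree three. -/
theorem three_weight_ge (H : DualSpectrum q 3 lam p w Spec) (hq : 4 ≤ q) (hpp : IsPrimePow q)
    (hlam0 : 0 < lam) (hp : p + 3 ≤ (q - 1) * q) (hps : Spec p) (hqp : ¬ q ∣ p)
    (hp1 : q - 1 ≤ p) (hp4 : q = 4 → 7 ≤ p) : threeTarget q (p / q) ≤ lam * w := by
  have hqq : (q - 1) * q + q = q * q := by rw [← Nat.succ_mul]; congr 1; omega
  have hw0 : p % q ≠ 0 := fun h => hqp (Nat.dvd_of_mod_eq_zero h)
  have ht : p / q < q - 1 := by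
    rw [Nat.div_lt_iff_lt_mul (by omega)]
    omega
  have hpN : p < q ^ 3 - 1 := by
    have : q ^ 3 = q * (q * q) := by ring
    have := Nat.mul_le_mul_right (q * q) hq
    omega
  rcases Nat.lt_or_ge q 22 with h22 | h22
  -- Primality of the residue characteristic enters only here, to discard field sizes for which
  -- nothing was computed.
  · have npp : ∀ q ∈ [6, 10, 12, 14, 15, 18, 20, 21], ¬ IsPrimePow q := by
      intro q hq
      rw [isPrimePow_nat_iff_bounded]
      fin_cases hq <;> decide
    have hcase : q ∈ [6, 10, 12, 14, 15, 18, 20, 21] ∨ q ∈ [4, 5, 7, 8, 9] ∨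
        q ∈ [11, 13, 16, 17, 19] := by
      simp only [List.mem_cons, List.not_mem_nil, or_false]
      omega
    rcases hcase with h | h | h
    · exact absurd hpp (npp q h)
    · simp only [List.mem_cons, List.not_mem_nil, or_false] at h
      rcases h with rfl | rfl | rfl | rfl | rfl
      · exact H.three_four hlam0 (by omega) hps hqp (hp4 rfl)
      · exact H.three_five hlam0 (by omega) hps hqp hp1
      · exact H.three_seven hlam0 (by omega) hps hqp hp1
      · exact H.three_of_check hq hlam0 hp hps hqp hp1 hpN threeCheck_eight threeChainCheck_eight
      · exact H.three_of_check hq hlam0 hp hps hqp hp1 hpN threeCheck_nine threeChainCheck_nine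
    · have hc : threeCheck q [] = true := by
        simp only [List.mem_cons, List.not_mem_nil, or_false] at h
        rcases h with rfl | rfl | rfl | rfl | rfl
        · exact threeCheck_eleven
        · exact threeCheck_thirteen
        · exact threeCheck_sixteen
        · exact threeCheck_seventeen
        · exact threeCheck_nineteen
      exact H.three_of_check_nil hq hlam0 hp hps hqp hp1 hc
  · obtain ⟨U, hU1, hU2, hU3⟩ := exists_two_digit_set (t := p / q) (w := p % q) h22
      (Nat.pos_of_ne_zero hw0) (Nat.mod_lt _ (by omega)) (by omega)
    rw [mul_comm (p / q), Nat.div_add_mod] at hU3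
    have h1 := H.three_card_le (by omega) hlam0 (by omega) hps U hU2 hU3
    exact (threeTarget_le _ _ hq).trans ((Nat.mul_le_mul_left _ hU1).trans h1)

end DualSpectrum

/-! ### Odd degree: the second and the fifth range. -/

namespace DualSpectrum

variable {q m lam D w h p : ℕ} {Spec : ℕ → Prop}

theorem le_of_threeTarget_le {q t x : ℕ} (ht : t + 2 < q) (h : threeTarget q t ≤ x) :
    q * q + (if q % 2 = 0 then q - 4 else 0) ≤ x := by
  rw [threeTarget, show (t + 2 == q) = false by simpa using ht.ne] at h
  rcases Bool.eq_false_or_eq_true (q % 2 == 0) with h1 | h1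
  · rw [h1, cond_true, cond_false] at h
    rw [if_pos (by simpa using h1)]
    omega
  · rw [h1, cond_false] at h
    rw [if_neg (by simpa using h1)]
    omega

theorem sq_le_of_threeTarget_le {q t x : ℕ} (h : threeTarget q t ≤ x) :
    q * q ≤ x + (q - 4) := by
  rw [threeTarget] at h
  rcases Bool.eq_false_or_eq_true (q % 2 == 0) with h1 | h1 <;>
    rcases Bool.eq_false_or_eq_true (t + 2 == q) with h2 | h2 <;>
    simp only [h1, h2, cond_true, cond_false] at h <;> omega

/-- Lower bound for the weights when the largest leader is at least `Q - 1`, for `h ≥ 2`. -/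
theorem odd_weight_ge' (H : DualSpectrum q m lam p w Spec) (hq : 4 ≤ q) (hm : m = 2 * h + 1)
    (hh : 2 ≤ h) (hlam0 : 0 < lam) {Q c : ℕ} (hQ : q ^ h = Q) (hps : Spec p) (hqp : ¬ q ∣ p)
    (hc : 5 ≤ q ∨ 1 ≤ c) (h1 : (c + 1) * Q ≤ p + q) (h2 : p ≤ (q - 1) * Q) :
    (q + 1) * Q ≤ lam * w := by
  obtain ⟨R, hR⟩ : ∃ R, R = q ^ (h - 1) := ⟨_, rfl⟩
  have hqR : q ≤ R := hR ▸ Nat.le_self_pow (by omega) q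
  have hQR : Q = q * R := by rw [hR, ← hQ, ← pow_succ']; congr 1; omega
  have hQ0 : 0 < Q := by rw [← hQ]; positivity
  have hqq1 : (q - 1) * Q + Q = q * Q := by rw [← Nat.succ_mul]; congr 1; omega
  have hk : 2 * (q / 2 * q) ≤ q * q := by
    rw [← mul_assoc]; exact Nat.mul_le_mul_right _ (by omega)
  have hqqR : q * q ≤ q * R := Nat.mul_le_mul_left _ hqR
  have h4q : 4 * q ≤ q * q := Nat.mul_le_mul_right _ hq
  have h1t : p / Q * Q ≤ p := Nat.div_mul_le_self p Q
  have h2t := Nat.lt_div_mul_add (a := p) hQ0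
  refine H.odd_weight_ge hq hm (by omega) hlam0 hQ hps hqp ?_ (by omega)
  rw [← hR]
  generalize p / Q = t at *
  rcases Nat.lt_or_ge c t with hct | hct
  · -- the leading digit exceeds `c`
    obtain ⟨r, rfl⟩ : ∃ r, t = r + 1 := ⟨t - 1, by omega⟩
    have e1 : (r + 1) * Q = r * (q * R) + q * R := by rw [hQR]; ring
    have e2 : (r + 1 + 1) * R = r * R + 2 * R := by ring
    rcases Nat.eq_zero_or_pos r with rfl | hr
    · have h5 : 5 * R ≤ q * R := Nat.mul_le_mul_right _ (by omega)
      rw [e1] at h1t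
      rw [e2]
      have : 2 * R + (q / 2 * q + 2) ≤ q * R := by omega
      omega
    · have h5 : 4 * R ≤ q * R := Nat.mul_le_mul_right _ hq
      have h6 : r * R + q * R ≤ r * (q * R) + R := by
        obtain ⟨a, rfl⟩ : ∃ a, r = a + 1 := ⟨r - 1, by omega⟩
        have : a * R ≤ a * (q * R) := Nat.mul_le_mul_left _ (by omega)
        rw [Nat.succ_mul, Nat.succ_mul]
        omega
      rw [e1] at h1t
      rw [e2]
      have : 3 * R + (q / 2 * q + 2) ≤ 2 * (q * R) := by omega
      omega
  · have h3 : (t + 1) * Q ≤ (c + 1) * Q := Nat.mul_le_mul_right _ (by omega)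
    have e1 : (t + 1) * Q = t * (q * R) + q * R := by rw [hQR]; ring
    have e2 : (t + 1) * R = t * R + R := by ring
    have htc : c = t := by
      by_contra h
      have h4 : (t + 2) * Q ≤ (c + 1) * Q := Nat.mul_le_mul_right _ (by omega)
      have : (t + 2) * Q = t * Q + 2 * Q := by ring
      have : q < Q := by rw [hQR]; omega
      omega
    subst htc
    have h7 : c * R ≤ c * (q * R) := Nat.mul_le_mul_left _ (Nat.le_mul_of_pos_left _ (by omega))
    rw [e2]
    rcases Nat.eq_zero_or_pos c with rfl | hr
    · have h5 : 5 * R ≤ q * R := Nat.mul_le_mul_right _ (by omega)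
      have : R + (q / 2 * q + 2) + q ≤ q * R := by omega
      omega
    · have h6 : c * R + q * R ≤ c * (q * R) + R := by
        obtain ⟨a, rfl⟩ : ∃ a, c = a + 1 := ⟨c - 1, by omega⟩
        have : a * R ≤ a * (q * R) :=
          Nat.mul_le_mul_left _ (Nat.le_mul_of_pos_left _ (by omega))
        rw [Nat.succ_mul, Nat.succ_mul]
        omega
      have h5 : 4 * R ≤ q * R := Nat.mul_le_mul_right _ hq
      have : 2 * R + (q / 2 * q + 2) + q ≤ 2 * (q * R) := by omega
      omega

/-- Second range of designed distances. -/
theorem weight_ge_of_le_sub (H : DualSpectrum q m lam D w Spec) (hpp : IsPrimePow q)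
    (hm : m = 2 * h + 1) (hh : 1 ≤ h) (hlam : lam ∣ q - 1) (hlam0 : 0 < lam) {s Q : ℕ}
    (hQ : q ^ h = Q) (hs : 2 ≤ s) (hs' : lam * s + lam + 1 ≤ q)
    (hD : D + 1 + 2 * lam ≤ (lam * s + 1) * Q) : q * Q + 3 * lam ≤ lam * w + lam * s + 1 := by
  have hls : lam * 2 ≤ lam * s := Nat.mul_le_mul_left _ hs
  have hq : 4 ≤ q := by omega
  have hqQ : q ≤ Q := hQ ▸ Nat.le_self_pow (by omega) q
  obtain ⟨p, hp1, hpD, hps, hqp, Hp⟩ := H.exists_max_not_dvd (by omega) (by omega)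
  obtain ⟨r, rfl⟩ : ∃ r, s = r + 1 := ⟨s - 1, by omega⟩
  have hr : 1 ≤ lam * r := Nat.mul_pos hlam0 (by omega)
  rw [Nat.mul_succ] at hs' hD ⊢
  generalize hx : lam * r = x at *
  have hxq : (x + lam + 1) * Q ≤ (q - lam) * Q := Nat.mul_le_mul_right _ (by omega)
  have hlq : (q - lam) * Q ≤ (q - 1) * Q := Nat.mul_le_mul_right _ (by omega)
  have hqq : (q - 1) * Q + Q = q * Q := by rw [← Nat.succ_mul]; congr 1; omega
  -- A small largest leader satisfies the weaker bound with `s - 1` in place of `s`, which is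
  -- exactly the required gain of `lam`. Otherwise `p` is large enough to start a two-dimensional
  -- chain.
  rcases Nat.lt_or_ge (p + lam) ((x + 1) * Q) with hlt | hge
  · have := Hp.weight_ge_of_le (s := r) (by omega) hm hh hlam hlam0 hQ (by omega)
      (by rw [hx]; omega)
    rw [hx] at this
    omega
  · rcases Nat.lt_or_ge 1 h with hh2 | hh2
    · have := Hp.odd_weight_ge' hq hm hh2 hlam0 hQ hps hqp (c := x) (by omega) (by omega)
        (by omega)
      rw [Nat.succ_mul] at this
      omega
    · have hh1 : h = 1 := by omega
      subst hh1
      rw [pow_one] at hQ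
      subst hQ
      subst hm
      have h2x : 2 * q ≤ (x + 1) * q := Nat.mul_le_mul_right _ (by omega)
      have h3 := Hp.three_weight_ge hq hpp hlam0 (by omega) hps hqp (by omega) (by omega)
      have ht : p / q < x + lam + 1 := by
        rw [Nat.div_lt_iff_lt_mul (by omega)]
        omega
      rcases Nat.lt_or_ge (p / q + 2) q with h4 | h4
      · have h5 := le_of_threeTarget_le h4 h3
        -- Rounding: `q * q ≤ lam * w` and `lam ∣ q * q - 1` together give `q * q - 1 + lam ≤ lam *
        -- w`.
        obtain ⟨z, hz⟩ : lam ∣ q * q - 1 := by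
          rw [← sq]
          exact hlam.trans (by simpa using Nat.sub_dvd_pow_sub_pow q 1 2)
        have h6 : z < w := by
          by_contra! h
          have := Nat.mul_le_mul_left lam h
          omega
        have := Nat.mul_le_mul_left lam (Nat.succ_le_of_lt h6)
        rw [Nat.mul_succ] at this
        have : lam ≤ x := by
          rw [← hx]; exact Nat.le_mul_of_pos_right _ (by omega)
        omega
      -- A leading digit `q - 2` forces `lam = 1` and `s = q - 2`. The deficit `q - 4` in the target
      -- is then exactly what the claim tolerates.
      · have := sq_le_of_threeTarget_le h3
        have h1 : lam = 1 := by omega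
        subst h1
        omega

/-- Additional ranges of designed distances for primitive BCH codes. -/
theorem weight_ge_of_primitive (H : DualSpectrum q m 1 D w Spec) (hpp : IsPrimePow q) (hq : 5 ≤ q)
    (hm : m = 2 * h + 1) (hh : 1 ≤ h) {s Q : ℕ} (hQ : q ^ h = Q) (hs' : s + 3 ≤ q)
    (hD : D + 3 + s * q ^ (h - 1) ≤ (s + 1) * Q) :
    (2 * s ≤ q → 2 * (D + 1) ≤ w) ∧ (q < 2 * s → q * Q + 3 ≤ w + s) := by
  have hqQ : q ≤ Q := hQ ▸ Nat.le_self_pow (by omega) q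
  have hQ' : Q = q * q ^ (h - 1) := by rw [← hQ, ← pow_succ']; congr 1; omega
  have hsQ : (s + 1) * Q ≤ (q - 2) * Q := Nat.mul_le_mul_right _ (by omega)
  have hqq : (q - 2) * Q + 2 * Q = q * Q := by rw [← Nat.add_mul]; congr 1; omega
  have hqq1 : (q - 1) * Q + Q = q * Q := by rw [← Nat.succ_mul]; congr 1; omega
  obtain ⟨p, hp1, hpD, hps, hqp, Hp⟩ := H.exists_max_not_dvd (by omega) (by omega)
  -- Equality holds for `2 * s = q`; this is the reason for the term `s * q ^ (h - 1)` in the range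
  -- of designed distances.
  have hqs : 2 * s ≤ q → 2 * (s + 1) * Q ≤ (q + 1) * Q + 2 * s * q ^ (h - 1) := by
    intro h2
    rcases h2.eq_or_lt with h3 | h3
    · rw [h3, ← hQ', show 2 * (s + 1) = q + 2 by omega]
      nlinarith
    · exact (Nat.mul_le_mul_right _ (by omega)).trans (Nat.le_add_right _ _)
  suffices hmain : (q + 1) * Q ≤ w ∨
      (h = 1 ∧ q * q + (if q % 2 = 0 then q - 4 else 0) ≤ w) by
    rcases hmain with h1 | ⟨rfl, h1⟩
    · refine ⟨fun h2 => ?_, fun h2 => ?_⟩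
      · have h3 := hqs h2
        rw [mul_assoc, mul_assoc] at h3
        omega
      · rw [Nat.succ_mul] at h1
        omega
    · rw [pow_one] at hQ
      subst hQ
      refine ⟨fun h2 => ?_, fun h2 => by omega⟩
      rw [Nat.sub_self, pow_zero, mul_one] at hD
      rcases h2.eq_or_lt with h3 | h3
      -- With `2 * s = q` the range allows `2 * (D + 1)` up to `q ^ 2 + q - 4`, the target for even
      -- `q`.
      · rw [if_pos (by omega)] at h1
        have h4 : 2 * ((s + 1) * q) = (q + 2) * q := by rw [← mul_assoc]; congr 1; omega
        have h5 : (q + 2) * q = q * q + 2 * q := by ring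
        omega
      · have h4 : 2 * (s * q) + q ≤ q * q := by
          rw [← mul_assoc, ← Nat.succ_mul]
          exact Nat.mul_le_mul_right _ h3
        rw [Nat.succ_mul] at hD
        rcases Nat.lt_or_ge (2 * s + 1) q with h5 | h5
        · have h4 : 2 * (s * q) + 2 * q ≤ q * q := by
            rw [← mul_assoc, ← Nat.add_mul]
            exact Nat.mul_le_mul_right _ h5
          omega
        · omega
  have h1w : (1 : ℕ) * w = w := one_mul w
  -- If `p < Q - 1`, the middle block has `B = 0` and `A ≤ Q - 2`, and the gap is large enough for
  -- weight `2 * q * Q`.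
  rcases Nat.lt_or_ge (p + 1) Q with hlt | hge
  · left
    have h2Q : 5 * (q * Q) ≤ q * Q * Q := by
      rw [mul_comm]; exact Nat.mul_le_mul_left _ (by omega)
    have h3Q : 5 * (Q * Q) ≤ q * Q * Q := by
      rw [mul_assoc]; exact Nat.mul_le_mul_right _ hq
    have h4Q : q * Q ≤ Q * Q := Nat.mul_le_mul_right _ hqQ
    have h5Q : p * Q ≤ Q * Q := Nat.mul_le_mul_right _ (by omega)
    have h6Q : q * q ≤ q * Q := Nat.mul_le_mul_left _ hqQ
    have h7Q : 5 * (q * Q) ≤ q * q * Q := by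
      rw [mul_assoc]; exact Nat.mul_le_mul_right _ hq
    have h8Q : 5 * Q ≤ q * Q := Nat.mul_le_mul_right _ hq
    have := Hp.odd_bch (g := 2 * (q * Q) - 1) (by omega) hm hh (one_dvd _) one_pos hQ (by omega)
      (by omega) ?_ (by rw [sq]; omega)
    · rw [Nat.succ_mul]
      omega
    · intro A B _ hA hB
      have hB0 : B = 0 := by
        by_contra h
        have := Nat.le_mul_of_pos_left Q (Nat.pos_of_ne_zero h)
        omega
      subst hB0
      have h9 : (A + 2) * (q * Q) ≤ Q * (q * Q) := Nat.mul_le_mul_right _ (by omega)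
      rw [mul_comm Q, Nat.add_mul] at h9
      omega
  · rcases Nat.lt_or_ge 1 h with hh2 | hh2
    · left
      rw [← h1w]
      exact Hp.odd_weight_ge' (by omega) hm hh2 one_pos hQ hps hqp (c := 0) (by omega) (by omega)
        (by omega)
    · right
      have hh1 : h = 1 := by omega
      subst hh1
      rw [pow_one] at hQ
      subst hQ
      subst hm
      have h3 := Hp.three_weight_ge (by omega) hpp one_pos (by omega) hps hqp (by omega) (by omega)
      have ht : p / q < s + 1 := by
        rw [Nat.div_lt_iff_lt_mul (by omega)]
        omega
      rw [h1w] at h3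
      exact ⟨rfl, le_of_threeTarget_le (by omega) h3⟩

end DualSpectrum

/-! ### Successive elimination of cosets by lexicographic first-fit search. -/

/-- One step of `lexGreedy`: the word `a` is tried, `ih` handles the later words, `d` is the mask of
excluded positions and `k` the length still to be reached. -/
noncomputable def lexStep (n B s a : ℕ) (ih : ℕ → ℕ → Bool) (d k : ℕ) : Bool :=
  Nat.rec true (fun k' _ => Nat.rec false (fun d' _ =>
      Nat.rec (ih (Nat.lor (Nat.succ d')
          (Nat.lor (Nat.shiftLeft B (Nat.mod (Nat.add a (Nat.sub n s)) n))
            (Nat.shiftRight B (Nat.sub n (Nat.mod (Nat.add a (Nat.sub n s)) n))))) k')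
        (fun _ _ => ih (Nat.succ d') (Nat.succ k'))
        (Nat.land (Nat.shiftRight (Nat.succ d') a) 1)) d) k

/-- First-fit search through a list for a chain of length `k` with start `s` whose differences avoid
the mask `B`; the positions in the mask `d` are excluded. -/
noncomputable def lexGreedy (n B s : ℕ) (l : List ℕ) : ℕ → ℕ → Bool :=
  List.rec (motive := fun _ => ℕ → ℕ → Bool)
    (fun _ k => Nat.rec true (fun _ _ => false) k)
    (fun a _ ih => lexStep n B s a ih) l

/-- The quotient of `x` by `lam`, if it is integral, is put in front of a list. -/
noncomputable def consWord (n lam x : ℕ) (acc : List ℕ) : List ℕ :=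
  Nat.rec (Nat.rec (0 :: acc) (fun y _ => Nat.succ y :: acc)
      (Nat.mod (Nat.div x lam) (Nat.succ n))) (fun _ _ => acc) (Nat.mod x lam)

/-- The quotients by `lam` of the words with digits in base `q`, listed lexicographically, where each
digit is described by its weight `w` and enumerated as `(j * μ + o) % q` for `j < q`. -/
noncomputable def lexWords (n q lam : ℕ) (o : List (ℕ × ℕ × ℕ)) : ℕ → List ℕ → List ℕ :=
  List.rec (motive := fun _ => ℕ → List ℕ → List ℕ) (fun x acc => consWord n lam x acc)
    (fun t _ ih x acc => Nat.rec (motive := fun _ => List ℕ) acc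
      (fun j ih' => ih (Nat.add x (Nat.mul (Nat.mod (Nat.add (Nat.mul j t.2.1) t.2.2) q) t.1)) ih')
      q) o

theorem le_of_mem_consWord {n lam x : ℕ} {acc : List ℕ} (h : ∀ a ∈ acc, a ≤ n) :
    ∀ a ∈ consWord n lam x acc, a ≤ n := by
  intro a ha
  rw [consWord] at ha
  have hlt : Nat.mod (Nat.div x lam) (Nat.succ n) < n + 1 := Nat.mod_lt _ (Nat.succ_pos n)
  generalize Nat.mod (Nat.div x lam) (Nat.succ n) = y at ha hlt
  generalize Nat.mod x lam = z at ha
  cases z with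
  | zero =>
    cases y with
    | zero => exact (List.mem_cons.1 ha).elim (fun h1 => by omega) (h a)
    | succ y => exact (List.mem_cons.1 ha).elim (fun h1 => by omega) (h a)
  | succ z => exact h a ha

theorem le_of_mem_lexWords {n q lam : ℕ} (o : List (ℕ × ℕ × ℕ)) : ∀ x (acc : List ℕ),
    (∀ a ∈ acc, a ≤ n) → ∀ a ∈ lexWords n q lam o x acc, a ≤ n := by
  induction o with
  | nil => exact fun x acc h => le_of_mem_consWord h
  | cons t o ih =>
    intro x acc h
    change ∀ a ∈ Nat.rec (motive := fun _ => List ℕ) acc (fun j ih' => lexWords n q lam o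
      (Nat.add x (Nat.mul (Nat.mod (Nat.add (Nat.mul j t.2.1) t.2.2) q) t.1)) ih') q, a ≤ n
    suffices h1 : ∀ r, ∀ a ∈ Nat.rec (motive := fun _ => List ℕ) acc (fun j ih' =>
        lexWords n q lam o
          (Nat.add x (Nat.mul (Nat.mod (Nat.add (Nat.mul j t.2.1) t.2.2) q) t.1)) ih') r, a ≤ n from
      h1 q
    intro r
    induction r with
    | zero => exact h
    | succ r ihr => exact ih _ _ ihr

/-- Choosing `a` excludes all later `b` with `s + b - a` in `B` modulo `n`, that is, the cyclic
translate of `B` by `a - s`. The two shifts in `lexStep` are the two pieces of that translate; bits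
beyond position `n` are harmless, as they exclude no candidate below `n`. -/
theorem exists_list_of_lexGreedy {n B s : ℕ} (hs : s < n) (l : List ℕ) (hl : ∀ a ∈ l, a ≤ n) :
    ∀ d k, d.testBit n = true → lexGreedy n B s l d k = true → ∃ L : List ℕ, L.length = k ∧
      (∀ a ∈ L, a < n ∧ d.testBit a = false) ∧
      L.Pairwise fun a a' => B.testBit ((s + a' + n - a) % n) = false := by
  induction l with
  | nil =>
    intro d k _ h
    cases k with
    | zero => exact ⟨[], by simp⟩
    | succ k => exact absurd (show false = true from h) (by simp)
  | cons a l ih =>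
    intro d k hd h
    cases k with
    | zero => exact ⟨[], by simp⟩
    | succ k =>
      cases d with
      | zero => exact absurd (show false = true from h) (by simp)
      | succ d =>
        have hl' : ∀ a ∈ l, a ≤ n := fun b hb => hl b (List.mem_cons_of_mem _ hb)
        change Nat.rec (motive := fun _ => Bool) (lexGreedy n B s l (Nat.lor (Nat.succ d)
          (Nat.lor (Nat.shiftLeft B (Nat.mod (Nat.add a (Nat.sub n s)) n))
            (Nat.shiftRight B (Nat.sub n (Nat.mod (Nat.add a (Nat.sub n s)) n))))) k)
          (fun _ _ => lexGreedy n B s l (Nat.succ d) (Nat.succ k))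
          (Nat.land (Nat.shiftRight (Nat.succ d) a) 1) = true at h
        have hbit : (d + 1).testBit a = (Nat.land (Nat.shiftRight (Nat.succ d) a) 1 != 0) := by
          rw [Nat.testBit, Nat.land_comm]
          rfl
        cases hc : Nat.land (Nat.shiftRight (Nat.succ d) a) 1 with
        | succ c =>
          rw [hc] at h
          exact ih hl' _ _ hd h
        | zero =>
          rw [hc] at h hbit
          have hbit : (d + 1).testBit a = false := by simpa using hbit
          -- Bit `n` of `d` is a sentinel: it keeps the mask nonzero and rejects the word `n`
          -- itself.
          have han : a < n := by
            refine lt_of_le_of_ne (hl a (by simp)) ?_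
            rintro rfl
            rw [hd] at hbit
            exact absurd hbit (by simp)
          change lexGreedy n B s l ((d + 1) ||| ((B <<< ((a + (n - s)) % n)) |||
            (B >>> (n - (a + (n - s)) % n)))) k = true at h
          obtain ⟨L, h1, h2, h3⟩ := ih hl' _ _ (by rw [Nat.testBit_lor, hd, Bool.true_or]) h
          have h4 : ∀ b ∈ L, b < n ∧ (d + 1).testBit b = false ∧
              B.testBit ((s + b + n - a) % n) = false := by
            intro b hb
            obtain ⟨hbn, hb2⟩ := h2 b hb
            simp only [Nat.testBit_lor, Bool.or_eq_false_iff, Nat.testBit_shiftLeft,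
              Nat.testBit_shiftRight, Bool.and_eq_false_iff, decide_eq_false_iff_not, not_le] at hb2
            obtain ⟨h5, h6, h7⟩ := hb2
            refine ⟨hbn, h5, ?_⟩
            have hdm := Nat.div_add_mod (a + (n - s)) n
            have hlt : (a + (n - s)) % n < n := Nat.mod_lt _ (by omega)
            set r := (a + (n - s)) % n
            set c := (a + (n - s)) / n
            have hc2 : c < 2 := by
              by_contra! hge
              have := Nat.mul_le_mul_left n hge
              omega
            have key : (s + b + n - a) % n = if r ≤ b then b - r else n - r + b := by
              split_ifs with hr
              · interval_cases c
                · rw [show s + b + n - a = (b - r) + n * 2 by omega, Nat.add_mul_mod_self_left,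
                    Nat.mod_eq_of_lt (by omega)]
                · rw [show s + b + n - a = (b - r) + n by omega, Nat.add_mod_right,
                    Nat.mod_eq_of_lt (by omega)]
              · interval_cases c
                · rw [show s + b + n - a = (n - r + b) + n by omega, Nat.add_mod_right,
                    Nat.mod_eq_of_lt (by omega)]
                · rw [show s + b + n - a = n - r + b by omega, Nat.mod_eq_of_lt (by omega)]
            rw [key]
            split_ifs with hr
            · rcases h6 with h6 | h6
              · omega
              · exact h6
            · exact h7
          refine ⟨a :: L, by simp [h1], ?_, ?_⟩
          · intro b hb
            rcases List.mem_cons.1 hb with rfl | hb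
            · exact ⟨han, hbit⟩
            · exact ⟨(h4 b hb).1, (h4 b hb).2.1⟩
          · exact List.pairwise_cons.2 ⟨fun b hb => (h4 b hb).2.2, h3⟩

/-- The mask of the cyclotomic cosets modulo `n` of the elements of a list. -/
def cosetMask (n q m : ℕ) : List ℕ → ℕ
  | [] => 0
  | x :: l => rotBits n q m x ||| cosetMask n q m l

theorem testBit_rotBits_iff {N q k e : ℕ} (he : e < N) {i : ℕ} :
    (rotBits N q k e).testBit i ↔ ∃ j < k, i = e * q ^ j % N := by
  refine ⟨?_, fun ⟨j, hj, hi⟩ => hi ▸ testBit_rotBits he hj⟩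
  induction k generalizing e with
  | zero => simp [rotBits]
  | succ k ih =>
    intro h
    rw [rotBits, Nat.testBit_lor, Bool.or_eq_true] at h
    rcases h with h | h
    · refine ⟨0, by omega, ?_⟩
      rw [pow_zero, mul_one, Nat.mod_eq_of_lt he]
      rw [Nat.testBit_two_pow] at h
      exact (of_decide_eq_true h).symm
    · obtain ⟨j, hj, rfl⟩ := ih (Nat.mod_lt _ (by omega)) h
      exact ⟨j + 1, by omega, by rw [Nat.mod_mul_mod, mul_assoc, ← pow_succ']⟩

/-- Verification that a nonzero value on any coset of the list, all later cosets being allowed,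
forces a chain of length `k`. -/
noncomputable def peelOk (n q m k : ℕ) (W : List ℕ) : List ℕ → List ℕ → Bool
  | [], _ => true
  | x :: l, t =>
      lexGreedy n (rotBits n q m x ||| (cosetMask n q m l ||| cosetMask n q m t)) x W (2 ^ n) k &&
        peelOk n q m k W l t

/-- Iteration of `peelOk` over several orders of the words. -/
noncomputable def peelScriptOk (lam n q m k : ℕ) : List (List (ℕ × ℕ × ℕ) × List ℕ) → Bool
  | [] => true
  | (o, l) :: t => peelOk n q m k (lexWords n q lam o 0 []) l (t.flatMap Prod.snd) && peelScriptOk lam n q m k t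

/-- Verification of a script: its entries are reduced modulo `n`, its cosets cover `1, …, Y`, and
all of them can be peeled off. -/
noncomputable def scriptOk (lam n q m k Y : ℕ) (S : List (List (ℕ × ℕ × ℕ) × List ℕ)) : Bool :=
  (S.flatMap Prod.snd).all (fun x => Nat.blt x n) &&
    ((cosetMask n q m (S.flatMap Prod.snd) &&& (2 ^ (Y + 1) - 2) == 2 ^ (Y + 1) - 2) &&
      peelScriptOk lam n q m k S)

theorem testBit_cosetMask {n q m : ℕ} (hm : 0 < m) (hqm : q ^ m ≡ 1 [MOD n]) {l : List ℕ}
    (hl : ∀ x ∈ l, x < n) {x : ℕ} (hx : x ∈ l) (j : ℕ) :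
    (cosetMask n q m l).testBit (x * q ^ j % n) := by
  induction l with
  | nil => simp at hx
  | cons y l ih =>
    rw [cosetMask, Nat.testBit_lor, Bool.or_eq_true]
    rcases List.mem_cons.1 hx with rfl | hx
    · left
      have h1 : x * q ^ j ≡ x * q ^ (j % m) [MOD n] := by
        refine Nat.ModEq.mul_left _ ?_
        conv_lhs => rw [← Nat.mod_add_div j m, pow_add, pow_mul]
        simpa using (hqm.pow (j / m)).mul_left (q ^ (j % m))
      rw [h1]
      exact testBit_rotBits (hl x (by simp)) (Nat.mod_lt _ hm)
    · exact Or.inr (ih (fun z hz => hl z (by simp [hz])) hx)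

theorem exists_of_testBit_cosetMask {n q m : ℕ} {l : List ℕ} (hl : ∀ x ∈ l, x < n) {i : ℕ}
    (hi : (cosetMask n q m l).testBit i) : ∃ x ∈ l, ∃ j, i = x * q ^ j % n := by
  induction l with
  | nil => simp [cosetMask] at hi
  | cons y l ih =>
    rw [cosetMask, Nat.testBit_lor, Bool.or_eq_true] at hi
    rcases hi with hi | hi
    · obtain ⟨j, -, hj⟩ := (testBit_rotBits_iff (hl y (by simp))).1 hi
      exact ⟨y, by simp, j, hj⟩
    · obtain ⟨x, hx, j, hj⟩ := ih (fun z hz => hl z (by simp [hz])) hi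
      exact ⟨x, by simp [hx], j, hj⟩

namespace DualSpectrum

variable {q m lam D w n k : ℕ} {Spec : ℕ → Prop}

theorem not_of_lexGreedy (H : DualSpectrum q m lam D w Spec) (hlam : 0 < lam)
    (hN : q ^ m - 1 = lam * n) (hk : w < k) {B x : ℕ} {W : List ℕ} (hW : ∀ a ∈ W, a ≤ n)
    (hx : x < n) (hB : ∀ y, Spec (lam * y) → B.testBit (y % n))
    (hg : lexGreedy n B x W (2 ^ n) k = true) :
    ¬ Spec (lam * x) := by
  intro hs
  obtain ⟨L, h1, h2, h3⟩ := exists_list_of_lexGreedy hx W hW _ _ (Nat.testBit_two_pow_self) hg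
  have h4 := H.chain _ hs (L.map (lam * ·)) ?_ ?_
  · rw [List.length_map, h1] at h4
    omega
  · intro a ha
    obtain ⟨b, hb, rfl⟩ := List.mem_map.1 ha
    rw [hN]
    exact ⟨dvd_mul_right _ _, Nat.mul_lt_mul_of_pos_left (h2 b hb).1 hlam⟩
  · rw [List.pairwise_map]
    refine h3.imp fun {a a'} h hspec => ?_
    rw [hN, ← mul_add, ← mul_add, ← Nat.mul_sub] at hspec
    rw [hB _ hspec] at h
    exact absurd h (by simp)

/-- If the spectrum lies in the cosets still listed and the first one is spectral, a chain longer
than `w` appears. That coset is therefore not spectral, the list shrinks, and later searches have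
fewer exponents to avoid. -/
theorem mem_coset_of_peelOk (H : DualSpectrum q m lam D w Spec) (hlam : 0 < lam) (hm : 0 < m)
    (hqm : q ^ m ≡ 1 [MOD n]) (hN : q ^ m - 1 = lam * n) (hk : w < k) {W t : List ℕ}
    (hW : ∀ a ∈ W, a ≤ n) (ht : ∀ x ∈ t, x < n) :
    ∀ l : List ℕ, (∀ x ∈ l, x < n) → peelOk n q m k W l t = true →
      (∀ y, Spec (lam * y) → ∃ x ∈ l ++ t, ∃ j, y % n = x * q ^ j % n) →
      ∀ y, Spec (lam * y) → ∃ x ∈ t, ∃ j, y % n = x * q ^ j % n := by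
  intro l
  induction l with
  | nil => intro _ _ h; simpa using h
  | cons x l ih =>
    intro hl hp h
    rw [peelOk, Bool.and_eq_true] at hp
    have hx := hl x (by simp)
    have hl' : ∀ z ∈ l, z < n := fun z hz => hl z (by simp [hz])
    refine ih hl' hp.2 fun y hy => ?_
    have hxs : ¬ Spec (lam * x) := by
      refine H.not_of_lexGreedy hlam hN hk hW hx (fun y hy => ?_) hp.1
      obtain ⟨z, hz, j, hj⟩ := h y hy
      rw [hj]
      simp only [List.cons_append, List.mem_cons, List.mem_append] at hz
      simp only [Nat.testBit_lor, Bool.or_eq_true]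
      rcases hz with rfl | hz | hz
      · have := testBit_cosetMask hm hqm (l := [z]) (by simpa using hx) (List.mem_singleton_self z) j
        simpa [cosetMask] using Or.inl this
      · exact Or.inr (Or.inl (testBit_cosetMask hm hqm hl' hz j))
      · exact Or.inr (Or.inr (testBit_cosetMask hm hqm ht hz j))
    obtain ⟨z, hz, j, hj⟩ := h y hy
    rw [List.cons_append, List.mem_cons] at hz
    rcases hz with rfl | hz
    · refine absurd ?_ hxs
      rw [← H.pow_mul j]
      refine (H.congr ?_).1 hy
      rw [hN, mul_left_comm]
      refine Nat.ModEq.mul_left' _ ?_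
      rw [mul_comm]
      exact hj
    · exact ⟨z, hz, j, hj⟩

/-- After all cosets are removed the spectrum is empty, which is impossible for a nonzero word. -/
theorem false_of_peelScriptOk (H : DualSpectrum q m lam D w Spec) (hlam : 0 < lam) (hm : 0 < m)
    (hqm : q ^ m ≡ 1 [MOD n]) (hN : q ^ m - 1 = lam * n) (hk : w < k) :
    ∀ S : List (List (ℕ × ℕ × ℕ) × List ℕ), (∀ x ∈ S.flatMap Prod.snd, x < n) →
      peelScriptOk lam n q m k S = true →
      (∀ y, Spec (lam * y) → ∃ x ∈ S.flatMap Prod.snd, ∃ j, y % n = x * q ^ j % n) → False := by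
  intro S
  induction S with
  | nil =>
    intro _ _ h
    obtain ⟨e, he⟩ := H.ex
    obtain ⟨y, rfl⟩ := H.dvd e he
    obtain ⟨x, hx, -⟩ := h y he
    simp at hx
  | cons s S ih =>
    obtain ⟨o, l⟩ := s
    intro hS hp h
    rw [peelScriptOk, Bool.and_eq_true] at hp
    simp only [List.flatMap_cons, List.mem_append] at hS h
    refine ih (fun x hx => hS x (Or.inr hx)) hp.2 ?_
    exact H.mem_coset_of_peelOk hlam hm hqm hN hk
      (le_of_mem_lexWords o 0 [] (by simp)) (fun x hx => hS x (Or.inr hx)) l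
      (fun x hx => hS x (Or.inl hx)) hp.1 (by simpa only [List.mem_append] using h)

/-- A verified script bounds the weight. -/
theorem le_of_scriptOk (H : DualSpectrum q m lam D w Spec) (hq : 0 < q) (hlam : 0 < lam)
    (hm : 0 < m) (hN : q ^ m - 1 = lam * n) {Y : ℕ} (hD : D ≤ lam * Y)
    {S : List (List (ℕ × ℕ × ℕ) × List ℕ)} (hS : scriptOk lam n q m k Y S = true) : k ≤ w := by
  by_contra! hk
  have hpow : q ^ m ≡ 1 [MOD q ^ m - 1] :=
    ((Nat.modEq_iff_dvd' (Nat.one_le_pow _ _ hq)).2 (dvd_refl _)).symm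
  have hqm : q ^ m ≡ 1 [MOD n] := hpow.of_dvd (hN ▸ dvd_mul_left _ _)
  simp only [scriptOk, Bool.and_eq_true, List.all_eq_true, Nat.blt_eq, beq_iff_eq] at hS
  obtain ⟨h1, h2, h3⟩ := hS
  refine H.false_of_peelScriptOk hlam hm hqm hN hk S h1 h3 fun y hy => ?_
  obtain ⟨r, hr1, hrD, hr, j, hj⟩ := H.lead _ hy
  obtain ⟨z, rfl⟩ := H.dvd r hr
  have hz1 : 1 ≤ z := Nat.pos_of_mul_pos_left hr1
  have hzY : z ≤ Y := Nat.le_of_mul_le_mul_left (hrD.trans hD) hlam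
  have hbit : (cosetMask n q m (S.flatMap Prod.snd)).testBit z := by
    have h4 : (2 ^ (Y + 1) - 2).testBit z := by
      have h5 : 2 ^ (Y + 1) - 2 = (2 ^ Y - 1) <<< 1 := by
        rw [Nat.shiftLeft_eq, pow_succ]
        omega
      rw [h5, Nat.testBit_shiftLeft, Nat.testBit_two_pow_sub_one]
      simp only [ge_iff_le, Bool.and_eq_true, decide_eq_true_eq]
      omega
    rw [← h2, Nat.testBit_land, Bool.and_eq_true] at h4
    exact h4.1
  obtain ⟨x, hx, i, hi⟩ := exists_of_testBit_cosetMask h1 hbit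
  refine ⟨x, hx, i + (m - j % m), ?_⟩
  rw [hN, mul_left_comm] at hj
  have hj' : z ≡ q ^ j * y [MOD n] := Nat.ModEq.mul_left_cancel' hlam.ne' hj
  have h6 : z ≡ x * q ^ i [MOD n] := by
    have : z % n = x * q ^ i % n % n := by rw [← hi]
    rwa [Nat.mod_mod] at this
  have hjm : j % m < m := Nat.mod_lt _ hm
  have h7 : q ^ (j + (m - j % m)) ≡ 1 [MOD n] := by
    have h8 : j + (m - j % m) = m * (j / m + 1) := by
      have := Nat.mod_add_div j m
      rw [mul_add, mul_one]
      omega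
    rw [h8, _root_.pow_mul]
    simpa using hqm.pow (j / m + 1)
  have h9 : y ≡ x * q ^ (i + (m - j % m)) [MOD n] :=
    calc y ≡ q ^ (j + (m - j % m)) * y [MOD n] := by simpa using (h7.mul_right y).symm
      _ = q ^ j * y * q ^ (m - j % m) := by rw [pow_add]; ring
      _ ≡ z * q ^ (m - j % m) [MOD n] := hj'.symm.mul_right _
      _ ≡ x * q ^ i * q ^ (m - j % m) [MOD n] := h6.mul_right _
      _ = x * q ^ (i + (m - j % m)) := by rw [pow_add]; ring
  exact h9

end DualSpectrum

/-! ### Even degree: three-block chains and the obstacle to the BCH bound. -/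

theorem Finset.card_image_mul_add {R : ℕ} (S T : Finset ℕ) (hT : ∀ t ∈ T, t < R) :
    ((S ×ˢ T).image fun x => x.1 * R + x.2).card = S.card * T.card := by
  rw [Finset.card_image_of_injOn, Finset.card_product]
  rintro ⟨s, t⟩ hx ⟨s', t'⟩ hx' hxx
  simp only [Finset.coe_product, Set.mem_prod, Finset.mem_coe] at hx hx' hxx
  have h1 := hT t hx.2
  have h2 := hT t' hx'.2
  have hR : 0 < R := by omega
  have h3 : s = s' := by
    have := congrArg (· / R) hxx
    simpa [Nat.add_comm, Nat.add_mul_div_right _ _ hR, Nat.div_eq_of_lt h1,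
      Nat.div_eq_of_lt h2] using this
  subst h3
  exact Prod.ext rfl (by simpa using hxx)

namespace DualSpectrum

variable {q m lam D w h : ℕ} {Spec : ℕ → Prop}

/-- Exponents are read as one digit, `h` digits and `h - 1` digits, and the leader is first
multiplied by `R` so that its last block is zero. The last block is unrestricted, the middle one
runs over `U`, and the top digit gets only `q - 1 - v` values so that adding `v` and a carry stays
below `q`. -/
theorem even_card_le (H : DualSpectrum q m lam D w Spec) (hq : 2 ≤ q) (hlam0 : 0 < lam)
    (hm : m = 2 * h) (hh : 1 ≤ h) {M R v b : ℕ} (hR : q ^ (h - 1) = R) (hM : M = q * R)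
    (hb : b < M) (hp : Spec (v * M + b)) (U : Finset ℕ) (hU : ∀ u ∈ U, u < M)
    (hB : ∀ u ∈ U, ∀ u' ∈ U, 1 ≤ (b + u + M - u') % M)
    (hgood : ∀ u ∈ U, ∀ u' ∈ U, ∀ V x z, v ≤ V → V < q → z < R →
      x = (b + u + M - u') % M ∨ (x + 1 = (b + u + M - u') % M ∧ 1 ≤ z) →
      (v * M + b) * R < (V * M + x) * R + z → ¬ Spec ((V * M + x) * R + z)) :
    (q - 1 - v) * U.card * R ≤ lam * w := by
  have hR0 : 0 < R := hR ▸ Nat.pow_pos (by omega)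
  have hM0 : 0 < M := hM ▸ Nat.mul_pos (by omega) hR0
  have hN : q ^ m = q * M * R := by
    have h1 : q ^ h = q * R := by rw [← hR, ← pow_succ']; congr 1; omega
    rw [hm, two_mul, pow_add, h1, hM]
    ring
  have hps : Spec ((v * M + b) * R) := by
    rw [mul_comm, ← hR]
    exact (H.pow_mul _ _).2 hp
  have h1 := H.card_le hlam0 hps
    (((((Finset.range (q - 1 - v) ×ˢ U).image fun x => x.1 * M + x.2) ×ˢ Finset.range R).image
      fun x => x.1 * R + x.2)) ?_ ?_
  · rwa [Finset.card_image_mul_add _ _ (by simp), Finset.card_image_mul_add _ _ hU,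
      Finset.card_range, Finset.card_range] at h1
  · intro a ha
    simp only [Finset.mem_image, Finset.mem_product, Finset.mem_range, Prod.exists] at ha
    obtain ⟨y, z, ⟨⟨i, u, ⟨hi, hu⟩, rfl⟩, hz⟩, rfl⟩ := ha
    have h1 : (i + 2) * M ≤ q * M := Nat.mul_le_mul_right _ (by omega)
    have h2 : (i * M + u + 2) * R ≤ q * M * R := by
      refine Nat.mul_le_mul_right _ ?_
      have := hU u hu
      rw [Nat.add_mul] at h1
      omega
    rw [Nat.add_mul _ 2] at h2
    omega
  · intro a ha a' ha' hlt _
    simp only [Finset.mem_image, Finset.mem_product, Finset.mem_range, Prod.exists] at ha ha'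
    obtain ⟨y, z, ⟨⟨i, u, ⟨hi, hu⟩, rfl⟩, hz⟩, rfl⟩ := ha
    obtain ⟨y', z', ⟨⟨i', u', ⟨hi', hu'⟩, rfl⟩, hz'⟩, rfl⟩ := ha'
    have hB1 := hB u hu u' hu'
    have hg := hgood u hu u' hu'
    have h5 := hU u hu
    have h6 := hU u' hu'
    have h9 := Nat.div_add_mod (b + u + M - u') M
    have hBlt : (b + u + M - u') % M < M := Nat.mod_lt _ hM0
    have hc : (b + u + M - u') / M < 3 := by
      rw [Nat.div_lt_iff_lt_mul hM0]
      omega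
    generalize (b + u + M - u') % M = B at *
    generalize (b + u + M - u') / M = c at *
    have hyy : i' * M + u' ≤ i * M + u := by
      by_contra! hcon
      have := Nat.mul_le_mul_right R hcon
      rw [Nat.succ_mul] at this
      omega
    have hvv : i' ≤ i := by
      by_contra! hcon
      have := Nat.mul_le_mul_right M hcon
      rw [Nat.succ_mul] at this
      omega
    have hV : i' + 1 ≤ i + c := by
      by_contra! hcon
      have hvv : i = i' := by omega
      subst hvv
      have hc0 : c = 0 := by omega
      rw [hc0] at h9
      omega
    obtain ⟨V, hVe⟩ : ∃ V, V + i' + 1 = v + i + c := ⟨v + i + c - i' - 1, by omega⟩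
    have key : ∀ x β z0, x + β = B → z + β * R = z' + z0 →
        (v * M + b) * R + (((i * M + u) * R + z) - ((i' * M + u') * R + z')) =
          (V * M + x) * R + z0 := by
      intro x β z0 hx hz0
      have e1 : v * M + b + (i * M + u) = i' * M + u' + (V * M + x + β) := by
        have := congrArg (· * M) hVe
        simp only [Nat.add_mul, one_mul] at this
        rw [mul_comm] at h9
        omega
      have e2 := congrArg (· * R) e1
      simp only [Nat.add_mul _ _ R] at e2 hlt ⊢
      omega
    -- A borrow from the last block lowers the middle one to `B - 1` and leaves a nonzero last
    -- block; this is the second alternative in `hgood`.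
    rcases Nat.lt_or_ge z z' with hzz | hzz
    · have h10 := key (B - 1) 1 (z + R - z') (by omega) (by omega)
      rw [h10]
      refine hg V (B - 1) _ (by omega) (by omega) (by omega) (Or.inr ⟨by omega, by omega⟩) ?_
      omega
    · have h10 := key B 0 (z - z') (by omega) (by omega)
      rw [h10]
      refine hg V B _ (by omega) (by omega) (by omega) (Or.inl rfl) ?_
      omega

/-- The shape of the nonzero exponents in the layout of one digit, `h` digits, `h - 1` digits. -/
theorem even_cases (H : DualSpectrum q m lam D w Spec) (hq : 2 ≤ q) (hm : m = 2 * h) (hh : 2 ≤ h)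
    {M R V x z : ℕ} (hR : q ^ (h - 1) = R) (hM : M = q * R) (hlamq : lam < q)
    (hD : D < lam * M) (hV : V < q) (hx : x < M) (hz : z < R)
    (hN : (V * M + x) * R + z < q ^ m - 1) (hs : Spec ((V * M + x) * R + z)) :
    q ∣ x ∨ (x < lam ∧ x * M + z * q + V ≤ D ∧ Spec (x * M + z * q + V)) ∨
      (z = 0 ∧ V * M + x ≤ D ∧ Spec (V * M + x)) ∨ (V = 0 ∧ x < lam * R) := by
  have hR0 : 0 < R := by omega
  have hM0 : 0 < M := by omega
  have hRM : q ^ h = M := by rw [hM, ← hR, ← pow_succ']; congr 1; omega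
  have hqR : q ^ (2 * h) = q * M * R := by rw [two_mul, pow_add, hRM, hM]; ring
  have hDN : D < q ^ m - 1 := by
    have h1 : (lam + 1) * M ≤ q * M := Nat.mul_le_mul_right _ hlamq
    have h2 : q * M * 1 ≤ q * M * R := Nat.mul_le_mul_left _ hR0
    rw [hm, hqR]
    rw [Nat.add_mul] at h1
    omega
  obtain ⟨k, hk1, hkm, hr1, hr, hrs⟩ := H.lead_rot hq (by omega) hDN hs hN
  subst hm
  have hqM : ∀ y, 0 < y → ¬ y * (q * M) ≤ D := by
    intro y hy h1
    have h2 : 1 * (q * M) ≤ y * (q * M) := Nat.mul_le_mul_right _ hy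
    have h3 : lam * M ≤ q * M := Nat.mul_le_mul_right _ hlamq.le
    omega
  have hqh : q ^ (h + 1) = q * M := by rw [pow_succ', hRM]
  have hge : ∀ y j, 0 < y → h + 1 ≤ j → ¬ y * q ^ j ≤ D := by
    intro y j hy hj h1
    obtain ⟨j', rfl⟩ := Nat.exists_eq_add_of_le hj
    rw [pow_add, hqh, mul_left_comm, mul_comm] at h1
    exact hqM (y * q ^ j') (Nat.mul_pos hy (by positivity)) h1
  rcases Nat.lt_or_ge k (h - 1) with hk | hk
  · -- few digits are moved
    have h1 : (V * M + x) * R / q ^ k ≤ D := by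
      refine le_trans ?_ ((Nat.le_add_left _ _).trans hr)
      exact Nat.div_le_div_right (Nat.le_add_right _ _)
    obtain ⟨j, hj⟩ := Nat.exists_eq_add_of_le hk.le
    have hRk : R = q ^ j * q ^ k := by rw [← hR, hj, pow_add, mul_comm]
    have h2 : (V * M + x) * q ^ j ≤ D := by
      rwa [hRk, ← mul_assoc, Nat.mul_div_cancel _ (by positivity)] at h1
    have hV0 : V = 0 := by
      by_contra hV0
      refine hge V (h + j) (Nat.pos_of_ne_zero hV0) (by omega) (le_trans ?_ h2)
      rw [pow_add, hRM, ← mul_assoc]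
      exact Nat.mul_le_mul_right _ (Nat.le_add_right _ _)
    refine Or.inr (Or.inr (Or.inr ⟨hV0, ?_⟩))
    subst hV0
    rw [zero_mul, zero_add] at h2
    have h3 : x * q ^ j < lam * (q ^ (k + 1) * q ^ j) := by
      refine h2.trans_lt (hD.trans_eq ?_)
      rw [hM, hRk]
      ring
    rw [← mul_assoc] at h3
    refine (lt_of_mul_lt_mul_right h3 (Nat.zero_le _)).trans_le ?_
    exact Nat.mul_le_mul_left _ (hR ▸ Nat.pow_le_pow_right (by omega) (by omega))
  rcases Nat.eq_or_lt_of_le hk with rfl | hk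
  · rw [hR] at hr hrs
    have h2 : 2 * h - (h - 1) = h + 1 := by omega
    rw [Nat.mul_add_mod_self_right, Nat.mod_eq_of_lt hz, h2, mul_comm _ R, Nat.mul_add_div hR0,
      Nat.div_eq_of_lt hz, add_zero] at hr hrs
    have hz0 : z = 0 := by
      by_contra hz0
      exact hge z (h + 1) (Nat.pos_of_ne_zero hz0) le_rfl (by omega)
    subst hz0
    rw [zero_mul, zero_add] at hr hrs
    exact Or.inr (Or.inr (Or.inl ⟨rfl, hr, hrs⟩))
  rcases Nat.lt_or_ge k (2 * h - 1) with hk2 | hk2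
  · left
    obtain ⟨j, hj⟩ := Nat.exists_eq_add_of_le (show h - 1 + 1 ≤ k from hk)
    have hkR : q ^ k = R * q ^ (1 + j) := by rw [hj, add_assoc, pow_add, hR]
    have hMj : M = q ^ (1 + j) * q ^ (h - 1 - j) := by
      rw [← pow_add, ← hRM]; congr 1; omega
    have h1 : ((V * M + x) * R + z) % q ^ k = R * (x % q ^ (1 + j)) + z := by
      rw [hkR, Nat.mod_mul, mul_comm _ R, Nat.mul_add_mod, Nat.mod_eq_of_lt hz, Nat.mul_add_div hR0,
        Nat.div_eq_of_lt hz, add_zero, hMj, ← mul_assoc, mul_comm V, mul_assoc, Nat.mul_add_mod,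
        add_comm]
    have h3 : x % q ^ (1 + j) = 0 := by
      by_contra h3
      refine hge _ (h - 1 + (2 * h - k)) (Nat.pos_of_ne_zero h3) (by omega) (le_trans ?_ hr)
      rw [h1, pow_add _ (h - 1), hR, ← mul_assoc]
      refine le_trans (Nat.mul_le_mul_right _ ?_) (Nat.le_add_right _ _)
      rw [mul_comm R]
      exact Nat.le_add_right _ _
    exact (dvd_pow_self q (by omega : 1 + j ≠ 0)).trans (Nat.dvd_of_mod_eq_zero h3)
  rcases Nat.eq_or_lt_of_le hk2 with hk3 | hk3
  · have hkR : q ^ k = M * R := by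
      rw [← hRM, ← hR, ← pow_add]; congr 1; omega
    have hxz : x * R + z < M * R := by
      have : (x + 1) * R ≤ M * R := Nat.mul_le_mul_right _ hx
      rw [Nat.add_mul] at this
      omega
    have h1 : ((V * M + x) * R + z) = M * R * V + (x * R + z) := by ring
    rw [h1, hkR, Nat.mul_add_mod, Nat.mod_eq_of_lt hxz, Nat.mul_add_div (Nat.mul_pos hM0 hR0),
      Nat.div_eq_of_lt hxz, show 2 * h - k = 1 by omega, pow_one, add_zero,
      show (x * R + z) * q + V = x * M + z * q + V by rw [hM]; ring] at hr hrs
    refine Or.inr (Or.inl ⟨?_, hr, hrs⟩)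
    refine lt_of_mul_lt_mul_right (a := M) ?_ (Nat.zero_le _)
    omega
  · have hk4 : k = 2 * h := by omega
    subst hk4
    rw [Nat.mod_eq_of_lt (by omega), Nat.div_eq_of_lt (by omega), Nat.sub_self, pow_zero, mul_one,
      add_zero] at hr
    have hMR : M * R = q ^ (h + 1) * q ^ (h - 2) := by
      rw [← hRM, ← hR, ← pow_add, ← pow_add]; congr 1; omega
    have hV0 : V = 0 := by
      by_contra hV0
      refine hge V (h + 1 + (h - 2)) (Nat.pos_of_ne_zero hV0) (by omega) (le_trans ?_ hr)
      rw [pow_add, ← hMR]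
      calc V * (M * R) ≤ V * (M * R) + (x * R + z) := Nat.le_add_right _ _
        _ = _ := by ring
    refine Or.inr (Or.inr (Or.inr ⟨hV0, ?_⟩))
    subst hV0
    rw [zero_mul, zero_add] at hr
    have h1 : x * R < lam * q * R := by
      rw [mul_assoc, ← hM]; omega
    refine (lt_of_mul_lt_mul_right h1 (Nat.zero_le _)).trans_le (Nat.mul_le_mul_left _ ?_)
    rw [← hR]
    exact Nat.le_self_pow (by omega) q

end DualSpectrum

theorem eq_or_eq_add_of_dvd {lam M y f : ℕ} (hM0 : 0 < M) (hlamM : lam ∣ M - 1) (hy : y < lam)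
    (hf : f < 2 * lam) (hfM : f < M) (hdvd : lam ∣ y * M + (M - 1 - f)) :
    f = y ∨ f = y + lam := by
  have h1 : y * M + (M - 1 - f) + f = (y + 1) * (M - 1) + y := by
    obtain ⟨c, rfl⟩ := Nat.exists_eq_add_of_le hM0
    rw [add_assoc, show 1 + c - 1 - f + f = c by omega, show 1 + c - 1 = c by omega]
    ring
  have h2 : f ≡ y [MOD lam] := by
    have h3 : y * M + (M - 1 - f) + f ≡ 0 + f [MOD lam] :=
      ((Nat.modEq_zero_iff_dvd).2 hdvd).add_right _
    have h4 : (y + 1) * (M - 1) + y ≡ 0 + y [MOD lam] :=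
      ((Nat.modEq_zero_iff_dvd).2 (hlamM.mul_left _)).add_right _
    rw [h1, zero_add] at h3
    rw [zero_add] at h4
    exact h3.symm.trans h4
  have h3 : f % lam = y := by
    rw [h2, Nat.mod_eq_of_lt hy]
  have h4 := Nat.div_add_mod f lam
  have h5 : f / lam < 2 := by rw [Nat.div_lt_iff_lt_mul (by omega)]; omega
  interval_cases (f / lam) <;> omega

namespace DualSpectrum

variable {q m lam D w h M R : ℕ} {Spec : ℕ → Prop}

/-- Either the weight is large, or a specific exponent close to a multiple of `q ^ h` is nonzero. -/
theorem even_obstacle (H : DualSpectrum q m lam D w Spec) (hm : m = 2 * h) (hh : 2 ≤ h)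
    (hM : q ^ h = M) (hlam : lam ∣ q - 1) (hlam2 : 2 ≤ lam) (hlamq : 2 * lam + 1 ≤ q)
    (hD : D ≤ lam * (M - q)) : 2 * (M - q + 1) ≤ w ∨
      ∃ t f, t + 2 ≤ lam ∧ (f = t ∨ f = t + lam) ∧ t * M + (M - 1 - f) ≤ D ∧
        Spec (t * M + (M - 1 - f)) := by
  have hMM : q ^ m = M * M := by rw [hm, two_mul, pow_add, hM]
  have hqM : q * q ≤ M := by
    rw [← hM, ← pow_two]
    exact Nat.pow_le_pow_right (by omega) hh
  have hMq : q ≤ M := (Nat.le_mul_self q).trans hqM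
  have hlM : lam * (M - q) + lam * q = lam * M := by rw [← Nat.mul_add]; congr 1; omega
  have hqMM : q * M ≤ M * M := Nat.mul_le_mul_right _ hMq
  have h2lM : (2 * lam + 1) * M ≤ q * M := Nat.mul_le_mul_right _ hlamq
  have h2lM' : (2 * lam + 1) * M = 2 * (lam * M) + M := by ring
  have hDN : D < q ^ m - 1 := by omega
  have hlamM : lam ∣ M - 1 := hlam.trans (by simpa [hM] using Nat.sub_dvd_pow_sub_pow q 1 h)
  have hlamN : lam ∣ q ^ m - 1 := hlam.trans (by simpa using Nat.sub_dvd_pow_sub_pow q 1 m)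
  -- The gap is the one for which the BCH bound gives the claim. If it fails, some spectral exponent
  -- has an almost maximal upper half.
  by_cases hall : ∀ e, Spec e → e < q ^ m - 1 → e + (2 * (lam * (M - q)) + lam) ≤ q ^ m - 1
  · left
    have h1 := H.bch (by omega) hlamN hDN hall
    have h2 : lam * (2 * (M - q + 1)) = 2 * (lam * (M - q)) + lam + lam := by ring
    exact Nat.le_of_mul_le_mul_left (h2.trans_le h1) (by omega : 0 < lam)
  right
  push Not at hall
  obtain ⟨e, he, heN, hlt⟩ := hall
  obtain ⟨f, hf⟩ : ∃ f, e + f = q ^ m - 1 := ⟨q ^ m - 1 - e, by omega⟩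
  have hlf : lam ∣ f := (Nat.dvd_add_right (H.dvd e he)).1 (hf ▸ hlamN)
  have hf2 : f ≤ 2 * (lam * (M - q)) := by
    obtain ⟨c, rfl⟩ := hlf
    have h1 : lam * c < lam * (2 * (M - q) + 1) := by
      have : lam * (2 * (M - q) + 1) = 2 * (lam * (M - q)) + lam := by ring
      omega
    have h2 := Nat.lt_of_mul_lt_mul_left h1
    calc lam * c ≤ lam * (2 * (M - q)) := Nat.mul_le_mul_left _ (by omega)
      _ = _ := by ring
  have hM0 : 0 < M := by omega
  obtain ⟨f1, f0, hf0, hff⟩ : ∃ f1 f0, f0 < M ∧ f = M * f1 + f0 :=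
    ⟨f / M, f % M, Nat.mod_lt _ hM0, (Nat.div_add_mod f M).symm⟩
  have hf1 : f1 < 2 * lam := by
    refine Nat.lt_of_mul_lt_mul_left (a := M) ?_
    have : M * (2 * lam) = 2 * (lam * M) := by ring
    have : 0 < lam * q := Nat.mul_pos (by omega) (by omega)
    omega
  have hee : e = (M - 1 - f1) * M + (M - 1 - f0) := by
    have h1 : (M - 1 - f1) * M + M * f1 + M = M * M := by
      rw [mul_comm M f1, ← Nat.add_mul, ← Nat.succ_mul]; congr 1; omega
    omega
  obtain ⟨y, hy⟩ : ∃ y, y = M - 1 - f0 := ⟨_, rfl⟩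
  rw [← hy] at hee
  have hyM : y < M := by omega
  obtain ⟨k, hk1, hkm, hr1, hr, hrs⟩ := H.lead_rot (by omega) (by omega) hDN he heN
  have hDM : D < lam * M := by
    have : 0 < lam * q := Nat.mul_pos (by omega) (by omega)
    omega
  -- The upper half of `e` is nearly maximal, so it must land in the lower half after rotation. With
  -- `k < h` the quotient, and with `k > h` the rotated remainder, would already exceed `D`.
  have hkh : k = h := by
    rcases lt_trichotomy k h with hk | hk | hk
    · exfalso
      obtain ⟨j, hj⟩ := Nat.exists_eq_add_of_le hk.le
      have hMk : M = q ^ j * q ^ k := by rw [← hM, hj, pow_add, mul_comm]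
      have hqj : q ≤ q ^ j := Nat.le_self_pow (by omega) q
      have h1 : (M - 1 - f1) * q ^ j ≤ e / q ^ k := by
        rw [Nat.le_div_iff_mul_le (Nat.pow_pos (by omega)), hee, mul_assoc, ← hMk]
        omega
      have h2 : (M - 2 * lam) * q ≤ (M - 1 - f1) * q ^ j := Nat.mul_le_mul (by omega) hqj
      have h3 : (M - 2 * lam) * q + 2 * lam * q = M * q := by
        rw [← Nat.add_mul]; congr 1; omega
      have h4 : 2 * lam * q ≤ q * q := Nat.mul_le_mul_right _ (by omega)
      have h5 : M * (2 * lam + 1) ≤ M * q := Nat.mul_le_mul_left _ hlamq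
      have h6 : M * (2 * lam + 1) = 2 * (lam * M) + M := by ring
      have h7 := le_trans (Nat.le_add_left _ _) hr
      omega
    · exact hk
    · exfalso
      obtain ⟨j, hj⟩ := Nat.exists_eq_add_of_le hk
      have hkM : q ^ k = M * q ^ (1 + j) := by rw [hj, Nat.succ_add_eq_add_succ, add_comm 1 j, pow_add, hM]
      have hMj : M = q ^ (1 + j) * q ^ (m - k) := by
        rw [← pow_add, ← hM]; congr 1; omega
      have hqj : q ≤ q ^ (1 + j) := Nat.le_self_pow (by omega) q
      have h1 : (M - 1 - f1) % q ^ (1 + j) = q ^ (1 + j) - 1 - f1 := by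
        obtain ⟨c, hc⟩ : ∃ c, q ^ (m - k) = c + 1 :=
          Nat.exists_eq_add_of_lt (Nat.pow_pos (n := m - k) (by omega : 0 < q)) |>.imp (by simp)
        have : M - 1 - f1 = q ^ (1 + j) * c + (q ^ (1 + j) - 1 - f1) := by
          rw [hMj, hc, mul_add, mul_one]
          omega
        rw [this, Nat.mul_add_mod, Nat.mod_eq_of_lt (by omega)]
      have h2 : e % q ^ k = M * (q ^ (1 + j) - 1 - f1) + y := by
        rw [hee, mul_comm, hkM, Nat.mod_mul, Nat.mul_add_mod, Nat.mod_eq_of_lt hyM,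
          Nat.mul_add_div hM0, Nat.div_eq_of_lt hyM, add_zero, h1, add_comm]
      have h3 := le_trans (Nat.le_add_right _ _) hr
      rw [h2] at h3
      have h4 : M * lam ≤ M * ((q ^ (1 + j) - 1 - f1) * q ^ (m - k)) := by
        refine Nat.mul_le_mul_left _ ?_
        rcases Nat.eq_or_lt_of_le hkm with hkm | hkm
        · rw [hkm, Nat.sub_self, pow_zero, mul_one]
          have : q ^ (1 + j) = M := by rw [← hM]; congr 1; omega
          rw [this]
          have : 3 * lam ≤ q * q := Nat.mul_le_mul (by omega) (by omega)
          omega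
        · have h5 : q ≤ q ^ (m - k) := Nat.le_self_pow (by omega) q
          calc lam ≤ 1 * q := by omega
            _ ≤ _ := Nat.mul_le_mul (by omega) h5
      have h6 : M * ((q ^ (1 + j) - 1 - f1) * q ^ (m - k)) ≤
          (M * (q ^ (1 + j) - 1 - f1) + y) * q ^ (m - k) := by
        rw [← mul_assoc]
        exact Nat.mul_le_mul_right _ (Nat.le_add_right _ _)
      rw [mul_comm M lam] at h4
      omega
  have hm2 : m - h = h := by omega
  rw [hkh, hm2, hM, hee, Nat.mul_add_mod_self_right, Nat.mod_eq_of_lt hyM,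
    mul_comm (M - 1 - f1), Nat.mul_add_div hM0, Nat.div_eq_of_lt hyM, add_zero] at hr hrs
  have hy2 : y + 2 ≤ lam := by
    by_contra! hcon
    have h1 : (lam - 1) * M ≤ y * M := Nat.mul_le_mul_right _ (by omega)
    have h2 : (lam - 1) * M + M = lam * M := by rw [← Nat.succ_mul]; congr 1; omega
    have h3 : lam * (2 * lam + 1) ≤ lam * q := Nat.mul_le_mul_left _ hlamq
    have h4 : 2 * (2 * lam + 1) ≤ lam * (2 * lam + 1) := Nat.mul_le_mul_right _ hlam2
    omega
  refine ⟨y, f1, hy2, ?_, by omega, hrs⟩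
  exact eq_or_eq_add_of_dvd hM0 hlamM (by omega) hf1 (by omega) (H.dvd _ hrs)

/-- Maximality only among leaders with a prescribed residue pattern is what the three-block chains
need, provided that the pattern survives along the chain. -/
theorem exists_max_of_residue {κ : ℕ → Prop} {o : ℕ}
    (ho : Spec o) (hoD : o ≤ D) (hκ : κ (o % M)) :
    ∃ p, o ≤ p ∧ p ≤ D ∧ Spec p ∧ κ (p % M) ∧ ∀ r, r ≤ D → Spec r → κ (r % M) → r ≤ p := by
  classical
  have h1 := Nat.findGreatest_spec (P := fun r => Spec r ∧ κ (r % M)) hoD ⟨ho, hκ⟩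
  exact ⟨_, Nat.le_findGreatest (P := fun r => Spec r ∧ κ (r % M)) hoD ⟨ho, hκ⟩,
    Nat.findGreatest_le D, h1.1, h1.2, fun r hr hs hk => Nat.le_findGreatest hr ⟨hs, hk⟩⟩

theorem even_lt_or_eq (hm : m = 2 * h) (hh : 2 ≤ h) (hR : q ^ (h - 1) = R)
    (hM : M = q * R) {V x z : ℕ} (hV : V < q) (hx : x < M) (hz : z < R) :
    (V * M + x) * R + z < q ^ m - 1 ∨ (V * M + x) * R + z = 0 + (q ^ m - 1) := by
  have h1 : q ^ h = M := by rw [hM, ← hR, ← pow_succ']; congr 1; omega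
  have hqR : q ^ m = q * M * R := by rw [hm, two_mul, pow_add, h1, hM]; ring
  have h2 : (V + 1) * M ≤ q * M := Nat.mul_le_mul_right _ hV
  have h3 : (V * M + x + 1) * R ≤ q * M * R := by
    refine Nat.mul_le_mul_right _ ?_
    rw [Nat.add_mul] at h2
    omega
  rw [Nat.add_mul _ 1] at h3
  omega

/-- Each case of `even_cases` fails: `2 ≤ B % q` makes `B` and `B - 1` indivisible by `q`; `lam < B`
keeps the middle block from dropping below `lam`; a zero last block contradicts the maximality of
the leader; a zero top digit makes the exponent too small. -/
theorem even_not_spec (H : DualSpectrum q m lam D w Spec) (hq : 2 ≤ q) (hm : m = 2 * h)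
    (hh : 2 ≤ h) (hR : q ^ (h - 1) = R) (hM : M = q * R) (hlamq : lam < q)
    (hD : D < lam * M) {v b B : ℕ} (hvb : lam * R ≤ v * M + b)
    (hmax : ∀ r, r ≤ D → Spec r → r % M = B → r ≤ v * M + b) (hB : B < M) (hBq : 2 ≤ B % q)
    (hBlam : lam < B) {V x z : ℕ} (hvV : v ≤ V) (hV : V < q) (hz : z < R)
    (hx : x = B ∨ (x + 1 = B ∧ 1 ≤ z)) (hlt : (v * M + b) * R < (V * M + x) * R + z) :
    ¬ Spec ((V * M + x) * R + z) := by
  intro hs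
  rcases even_lt_or_eq hm hh hR hM hV (by omega : x < M) hz with hN | hN
  · rcases H.even_cases hq hm hh hR hM hlamq hD hV (by omega) hz hN hs with h1 | h1 | h1 | h1
    · obtain ⟨c, rfl⟩ := h1
      rcases hx with rfl | ⟨rfl, -⟩
      · simp at hBq
      · rw [Nat.mul_add_mod, Nat.mod_eq_of_lt (by omega)] at hBq
        omega
    · omega
    · obtain ⟨rfl, h2, h3⟩ := h1
      have hxB : x = B := by omega
      subst hxB
      have h4 := hmax _ h2 h3 (by rw [Nat.mul_add_mod_self_right, Nat.mod_eq_of_lt hB])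
      have := Nat.mul_le_mul_right R h4
      omega
    · obtain ⟨rfl, h2⟩ := h1
      have hv : v = 0 := by omega
      subst hv
      simp only [zero_mul, zero_add] at hvb hlt
      have h5 : (x + 1) * R ≤ b * R := Nat.mul_le_mul_right _ (by omega)
      rw [Nat.add_mul] at h5
      omega
  · rw [hN, H.add_period] at hs
    refine H.not_zero ?_ hs
    have h1 : q ^ m = M * M := by
      rw [hm, two_mul, pow_add, hM, ← hR, ← pow_succ']
      congr 2 <;> omega
    have h2 : (lam + 1) * M ≤ M * M := Nat.mul_le_mul_right _ (by omega)
    rw [Nat.add_mul] at h2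
    omega

end DualSpectrum

/-! ### Even degree: chains that preserve the last digit of the leader. -/

theorem Nat.exists_avoid_sub {R y : ℕ} (hy : y % R ≠ 0) (hR : 0 < R) :
    ∃ Y : Finset ℕ, (∀ a ∈ Y, a < R) ∧ (∀ a ∈ Y, ∀ a' ∈ Y, (y + a + R - a') % R ≠ 0) ∧
      R ≤ Y.card * 3 := by
  have : NeZero R := ⟨hR.ne'⟩
  have hy' : ((y : ℕ) : ZMod R) ≠ 0 := by
    rwa [Ne, ZMod.natCast_eq_zero_iff, Nat.dvd_iff_mod_eq_zero]
  obtain ⟨X, hX, hcard⟩ := exists_sub_notMem {((y : ℕ) : ZMod R)} (by simpa using hy'.symm)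
  refine ⟨X.image ZMod.val, ?_, ?_, ?_⟩
  · intro a ha
    obtain ⟨x, -, rfl⟩ := Finset.mem_image.1 ha
    exact ZMod.val_lt x
  · intro a ha a' ha' h0
    obtain ⟨x, hx, rfl⟩ := Finset.mem_image.1 ha
    obtain ⟨x', hx', rfl⟩ := Finset.mem_image.1 ha'
    refine hX x' hx' x hx (Finset.mem_singleton.2 ?_)
    have h1 : ((y + x.val + R - x'.val : ℕ) : ZMod R) = 0 := by
      rwa [ZMod.natCast_eq_zero_iff, Nat.dvd_iff_mod_eq_zero]
    rw [Nat.cast_sub (by have := ZMod.val_lt x'; omega)] at h1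
    push_cast at h1
    simp only [ZMod.natCast_val, ZMod.cast_id', id_eq, CharP.cast_eq_zero, add_zero] at h1
    linear_combination -h1
  · rw [Finset.card_image_of_injective _ (ZMod.val_injective R)]
    simpa [ZMod.card] using hcard

theorem mul_add_sub_mod {q R M b y y' : ℕ} (hq : 0 < q) (hM : M = q * R) (hy' : y' < R) :
    (b + q * y + M - q * y') % M = q * ((b / q + y + R - y') % R) + b % q := by
  have h1 : b + q * y + M - q * y' = q * (b / q + y + R - y') + b % q := by
    have h2 := Nat.div_add_mod b q
    generalize b / q = c at *
    have h3 : q * (c + y + R - y') + q * y' = q * c + q * y + q * R := by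
      rw [← Nat.mul_add, ← Nat.mul_add, ← Nat.mul_add]; congr 1; omega
    omega
  have h4 : b % q < q := Nat.mod_lt _ hq
  rw [h1, hM, Nat.mod_mul, Nat.mul_add_mod, Nat.mod_eq_of_lt h4, Nat.mul_add_div hq,
    Nat.div_eq_of_lt h4, add_zero, add_comm]

namespace DualSpectrum

variable {q m lam D w h M R : ℕ} {Spec : ℕ → Prop}

/-- Translations by multiples of `q` never change the last digit of the residue, so the leader need
only be maximal among those with its own last digit. -/
theorem even_card_of_digit (H : DualSpectrum q m lam D w Spec) (hq : 2 ≤ q) (hm : m = 2 * h)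
    (hh : 2 ≤ h) (hR : q ^ (h - 1) = R) (hM : M = q * R) (hlam0 : 0 < lam) (hlamq : lam < q)
    (hD : D < lam * M) {v b : ℕ} (hb : b < M) (hps : Spec (v * M + b)) (hvb : lam * R ≤ v * M + b)
    (hbq : 2 ≤ b % q)
    (hmax : ∀ r, r ≤ D → Spec r → r % M % q = b % q ∧ lam < r % M → r ≤ v * M + b)
    (Y : Finset ℕ) (hY : ∀ y ∈ Y, y < R)
    (hY' : ∀ y ∈ Y, ∀ y' ∈ Y, lam < q * ((b / q + y + R - y') % R) + b % q) :
    (q - 1 - v) * Y.card * R ≤ lam * w := by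
  have hR0 : 0 < R := hR ▸ Nat.pow_pos (by omega)
  have h1 := H.even_card_le hq hlam0 hm (by omega) hR hM hb hps (Y.image (q * ·)) ?_ ?_ ?_
  · rwa [Finset.card_image_of_injective _ (mul_right_injective₀ (by omega : q ≠ 0))] at h1
  · intro u hu
    obtain ⟨y, hy, rfl⟩ := Finset.mem_image.1 hu
    rw [hM]
    exact Nat.mul_lt_mul_of_pos_left (hY y hy) (by omega)
  · intro u hu u' hu'
    obtain ⟨y, hy, rfl⟩ := Finset.mem_image.1 hu
    obtain ⟨y', hy', rfl⟩ := Finset.mem_image.1 hu'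
    rw [mul_add_sub_mod (by omega) hM (hY y' hy')]
    omega
  · intro u hu u' hu' V x z hvV hV hz hx hlt
    obtain ⟨y, hy, rfl⟩ := Finset.mem_image.1 hu
    obtain ⟨y', hy', rfl⟩ := Finset.mem_image.1 hu'
    rw [mul_add_sub_mod (by omega) hM (hY y' hy')] at hx
    have h2 := hY' y hy y' hy'
    have h4 : b % q < q := Nat.mod_lt _ (by omega)
    have h3 : q * ((b / q + y + R - y') % R) + b % q < M := by
      have h5 : (b / q + y + R - y') % R + 1 ≤ R := Nat.mod_lt _ hR0
      have h6 := Nat.mul_le_mul_left q h5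
      rw [Nat.mul_add] at h6
      omega
    have h5 : (q * ((b / q + y + R - y') % R) + b % q) % q = b % q := by
      rw [Nat.mul_add_mod, Nat.mod_mod]
    refine H.even_not_spec hq hm hh hR hM hlamq hD hvb ?_ h3 (by omega) h2 hvV hV hz hx hlt
    intro r hr hrs hrB
    exact hmax r hr hrs ⟨by rw [hrB, h5], by omega⟩

theorem even_ge_of_digit (H : DualSpectrum q m lam D w Spec) (hq : 2 ≤ q) (hm : m = 2 * h)
    (hh : 2 ≤ h) (hR : q ^ (h - 1) = R) (hM : M = q * R) (hlam0 : 0 < lam) (hlamq : lam < q)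
    (hD : D < lam * M) {v b : ℕ} (hb : b < M) (hps : Spec (v * M + b)) (hvb : lam * R ≤ v * M + b)
    (hbq : 2 ≤ b % q)
    (hmax : ∀ r, r ≤ D → Spec r → r % M % q = b % q ∧ lam < r % M → r ≤ v * M + b)
    (hblam : lam < b % q) : (q - 1 - v) * R * R ≤ lam * w := by
  simpa using H.even_card_of_digit hq hm hh hR hM hlam0 hlamq hD hb hps hvb hbq hmax
    (Finset.range R) (by simp) fun y _ y' _ => by omega

/-- When the last digit does not exceed `lam` by itself, the digits above it must not all vanish.
Avoiding one difference ensures this and costs a factor three. -/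
theorem even_ge_of_digit' (H : DualSpectrum q m lam D w Spec) (hq : 2 ≤ q) (hm : m = 2 * h)
    (hh : 2 ≤ h) (hR : q ^ (h - 1) = R) (hM : M = q * R) (hlam0 : 0 < lam) (hlamq : lam < q)
    (hD : D < lam * M) {v b : ℕ} (hb : b < M) (hps : Spec (v * M + b)) (hvb : lam * R ≤ v * M + b)
    (hbq : 2 ≤ b % q)
    (hmax : ∀ r, r ≤ D → Spec r → r % M % q = b % q ∧ lam < r % M → r ≤ v * M + b)
    (hblam : lam < b) : (q - 1 - v) * R * R ≤ 3 * (lam * w) := by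
  rcases Nat.lt_or_ge lam (b % q) with h1 | h1
  · have := H.even_ge_of_digit hq hm hh hR hM hlam0 hlamq hD hb hps hvb hbq hmax h1
    omega
  · have hR0 : 0 < R := hR ▸ Nat.pow_pos (by omega)
    have hbR : b / q < R := by
      rw [Nat.div_lt_iff_lt_mul (by omega), mul_comm]
      omega
    have hb0 : b / q % R ≠ 0 := by
      rw [Nat.mod_eq_of_lt hbR]
      intro h2
      have := Nat.div_add_mod b q
      rw [h2] at this
      omega
    obtain ⟨Y, hY1, hY2, hY3⟩ := Nat.exists_avoid_sub hb0 hR0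
    have h2 := H.even_card_of_digit hq hm hh hR hM hlam0 hlamq hD hb hps hvb hbq hmax Y hY1
      fun y hy y' hy' => by
        have h3 := Nat.mul_le_mul_left q (Nat.one_le_iff_ne_zero.2 (hY2 y hy y' hy'))
        omega
    calc (q - 1 - v) * R * R ≤ (q - 1 - v) * (Y.card * 3) * R := by gcongr
      _ = 3 * ((q - 1 - v) * Y.card * R) := by ring
      _ ≤ _ := Nat.mul_le_mul_left _ h2

/-- The bound in even degree, except for degree four and the largest `lam`. -/
theorem weight_ge_of_even_of_ne (H : DualSpectrum q m lam D w Spec) (hm : m = 2 * h) (hh : 2 ≤ h)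
    (hlam : lam ∣ q - 1) (hlam2 : 2 ≤ lam) (hlamq : 2 * lam + 1 ≤ q)
    (hD : D ≤ lam * (q ^ h - q)) (hne : 3 ≤ h ∨ 3 * lam + 1 ≤ q) : 2 * (q ^ h - q + 1) ≤ w := by
  obtain ⟨R, hR⟩ : ∃ R, q ^ (h - 1) = R := ⟨_, rfl⟩
  obtain ⟨M, hMR⟩ : ∃ M, M = q * R := ⟨_, rfl⟩
  have hM : q ^ h = M := by rw [hMR, ← hR, ← pow_succ']; congr 1; omega
  rw [hM] at hD ⊢
  rcases H.even_obstacle hm hh hM hlam hlam2 hlamq hD with h1 | ⟨t, f, ht, hf, hoD, ho⟩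
  · exact h1
  have hR0 : 0 < R := hR ▸ Nat.pow_pos (by omega)
  have hqR : q ≤ R := hR ▸ Nat.le_self_pow (by omega) q
  have hlM : lam * (M - q) + lam * q = lam * M := by
    rw [← Nat.mul_add, Nat.sub_add_cancel (hMR ▸ Nat.le_mul_of_pos_right _ hR0)]
  have hlq : 2 * q ≤ lam * q := Nat.mul_le_mul_right _ hlam2
  have hlR : (2 * lam + 1) * R ≤ M := hMR ▸ Nat.mul_le_mul_right _ hlamq
  have hlR' : (2 * lam + 1) * R = 2 * (lam * R) + R := by ring
  have hfM : f + 1 + lam * R ≤ M := by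
    have : lam * q ≤ lam * R := Nat.mul_le_mul_left _ hqR
    omega
  have hoM : (t * M + (M - 1 - f)) % M = M - 1 - f := by
    rw [Nat.mul_add_mod_self_right, Nat.mod_eq_of_lt (by omega)]
  have hoq : (M - 1 - f) % q = q - 1 - f := by
    obtain ⟨c, rfl⟩ : ∃ c, R = c + 1 := ⟨R - 1, by omega⟩
    have : M - 1 - f = q * c + (q - 1 - f) := by
      rw [hMR, Nat.mul_add, mul_one]
      omega
    rw [this, Nat.mul_add_mod, Nat.mod_eq_of_lt (by omega)]
  obtain ⟨p, hop, hpD, hps, ⟨hp1, hp2⟩, hmax⟩ := exists_max_of_residue (M := M) (D := D)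
    (κ := fun r => r % q = q - 1 - f ∧ lam < r) ho hoD
    ⟨by rw [hoM, hoq], by rw [hoM]; have := Nat.le_mul_of_pos_right lam hR0; omega⟩
  have hpv : p / M * M + p % M = p := Nat.div_add_mod' p M
  have hv : p / M < lam := by
    rw [Nat.div_lt_iff_lt_mul (by omega)]
    omega
  have hcommon : ∀ a : ℕ, 2 * (M - q) + 1 < a → lam * a ≤ lam * w → 2 * (M - q + 1) ≤ w := by
    intro a ha h1
    have := Nat.le_of_mul_le_mul_left h1 (by omega : 0 < lam)
    omega
  have hq2 : (lam + 1) * R * R ≤ (q - 1 - p / M) * R * R := by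
    refine Nat.mul_le_mul_right _ (Nat.mul_le_mul_right _ ?_)
    omega
  have hlow : lam * R ≤ t * M + (M - 1 - f) := by omega
  -- For `h ≥ 3` the inequality `R ≥ q ^ 2` absorbs the factor three. For `h = 2` the hypothesis `3
  -- * lam + 1 ≤ q` makes the obstacle's last digit `q - 1 - f` exceed `lam`, so no factor is lost.
  rcases Nat.lt_or_ge 2 h with h3 | h3
  · have h1 := H.even_ge_of_digit' (by omega) hm hh hR hMR (by omega) (by omega) (by omega)
      (v := p / M) (b := p % M) (Nat.mod_lt _ (by omega)) (by rwa [hpv]) (by rw [hpv]; omega)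
      (by omega) (by rw [hpv, hp1]; exact hmax) hp2
    have h4 := hq2.trans h1
    have hqqR : q * q ≤ R := by
      rw [← hR, ← pow_two]
      exact Nat.pow_le_pow_right (by omega) (by omega)
    have h5 : 6 * lam * M ≤ (lam + 1) * R * R := by
      calc 6 * lam * M = 6 * lam * q * R := by rw [hMR]; ring
        _ ≤ (lam + 1) * (q * q) * R := by
          refine Nat.mul_le_mul_right _ ?_
          rw [← mul_assoc]
          refine Nat.mul_le_mul_right _ ?_
          have h6 : (lam + 1) * (2 * lam + 1) ≤ (lam + 1) * q := Nat.mul_le_mul_left _ hlamq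
          have h7 : (lam + 1) * (2 * lam + 1) = 2 * (lam * lam) + 3 * lam + 1 := by ring
          have h8 : 2 * lam ≤ lam * lam := Nat.mul_le_mul_right _ hlam2
          omega
        _ ≤ _ := Nat.mul_le_mul_right _ (Nat.mul_le_mul_left _ hqqR)
    refine hcommon (2 * M) (by omega) ?_
    have h6 : 6 * lam * M = 3 * (lam * (2 * M)) := by ring
    omega
  · have h2 : h = 2 := by omega
    subst h2
    have hRq : R = q := by rw [← hR]; simp
    have h1 := H.even_ge_of_digit (by omega) hm hh hR hMR (by omega) (by omega) (by omega)
      (v := p / M) (b := p % M) (Nat.mod_lt _ (by omega)) (by rwa [hpv]) (by rw [hpv]; omega)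
      (by omega) (by rw [hpv, hp1]; exact hmax) (by omega)
    have h4 : (2 * lam + 1) * M ≤ (q - 1 - p / M) * R * R := by
      have h5 : 2 * lam + 1 ≤ q - 1 - p / M := by omega
      calc (2 * lam + 1) * M = (2 * lam + 1) * R * R := by rw [hMR, hRq, mul_assoc]
        _ ≤ _ := Nat.mul_le_mul_right _ (Nat.mul_le_mul_right _ h5)
    refine hcommon (2 * M) (by omega) ?_
    have h6 : (2 * lam + 1) * M = lam * (2 * M) + M := by ring
    omega

end DualSpectrum

/-! ### Degree four with the largest `lam`, where `q = 2 * lam + 1`. -/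

/-- Admissibility of a two-digit residue `B` with respect to a leader `v * q ^ 2 + b`. -/
def evenOk (q lam v b B : ℕ) : Bool :=
  Nat.ble 2 (B % q) && (Nat.blt lam B ||
    (Nat.ble 2 v && (Nat.ble (v + 2) B && Nat.ble (lam + 1) (B + v))) ||
    (Nat.beq b (lam + 1) && Nat.beq B lam))

theorem evenOk_iff {q lam v b B : ℕ} : evenOk q lam v b B = true ↔ 2 ≤ B % q ∧
    ((lam < B ∨ (2 ≤ v ∧ v + 2 ≤ B ∧ lam + 1 ≤ B + v)) ∨ (b = lam + 1 ∧ B = lam)) := by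
  simp only [evenOk, Bool.and_eq_true, Bool.or_eq_true, Nat.ble_eq, Nat.blt_eq, Nat.beq_eq]

namespace DualSpectrum

variable {q lam D w : ℕ} {Spec : ℕ → Prop}

theorem dvd_add_of_spec (H : DualSpectrum q 4 lam D w Spec) (hlam : lam ∣ q - 1) (hq : 1 ≤ q)
    {V x : ℕ} (hs : Spec (V * (q * q) + x)) : lam ∣ V + x := by
  have h1 := H.dvd _ hs
  obtain ⟨c, hc⟩ := hlam
  obtain ⟨d, rfl⟩ : ∃ d, q = d + 1 := ⟨q - 1, by omega⟩
  have h2 : V * ((d + 1) * (d + 1)) + x = lam * (c * V * (d + 2)) + (V + x) := by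
    have : d = lam * c := by simpa using hc
    calc V * ((d + 1) * (d + 1)) + x = d * (V * (d + 2)) + (V + x) := by ring
      _ = lam * c * (V * (d + 2)) + (V + x) := by rw [← this]
      _ = _ := by ring
  rw [h2] at h1
  exact (Nat.dvd_add_right (dvd_mul_right _ _)).1 h1

/-- For `B > lam` this is `even_not_spec`. Small residues are admissible for two further reasons:
since `q ^ 2 ≡ 1`, a spectral exponent forces `lam` to divide a sum of two blocks, and that sum
would lie strictly between `lam` and `2 * lam`; otherwise the rotated exponent would be a leader
beyond the maximal one. -/
theorem four_not_spec (H : DualSpectrum q 4 lam D w Spec) (hlam : lam ∣ q - 1) (hlam3 : 3 ≤ lam)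
    (hlamq : 2 * lam + 1 ≤ q) (hD : D ≤ lam * (q * q - q)) {v b B : ℕ} (hbM : b < q * q) (hb : lam < b)
    (hsp : b = lam + 1 → v + 1 = lam) (hvb : lam * q ≤ v * (q * q) + b)
    (hmax : ∀ r, r ≤ D → Spec r → 2 ≤ r % (q * q) % q ∧ lam < r % (q * q) → r ≤ v * (q * q) + b)
    (hB : B < q * q) (hok : evenOk q lam v b B = true) {V x z : ℕ} (hvV : v ≤ V) (hV : V < q)
    (hz : z < q) (hx : x = B ∨ (x + 1 = B ∧ 1 ≤ z))
    (hlt : (v * (q * q) + b) * q < (V * (q * q) + x) * q + z) :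
    ¬ Spec ((V * (q * q) + x) * q + z) := by
  have hqq : q * q - q + q = q * q := Nat.sub_add_cancel (Nat.le_mul_self q)
  have hlM : lam * (q * q - q) + lam * q = lam * (q * q) := by rw [← Nat.mul_add, hqq]
  have hlq : 0 < lam * q := Nat.mul_pos (by omega) (by omega)
  have hDM : D < lam * (q * q) := by omega
  have h3q : 3 * q ≤ q * q := Nat.mul_le_mul_right _ (by omega)
  rw [evenOk_iff] at hok
  obtain ⟨hBq, hok⟩ := hok
  by_cases hBlam : lam < B
  · refine H.even_not_spec (by omega) rfl le_rfl (pow_one q) rfl (by omega) hDM hvb ?_ hB hBq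
      hBlam hvV hV hz hx hlt
    rintro r hr hrs rfl
    exact hmax r hr hrs ⟨hBq, hBlam⟩
  have hv2 : 2 ≤ v := by omega
  intro hs
  have hN : (V * (q * q) + x) * q + z < q ^ 4 - 1 := by
    have h1 : (V + 1) * (q * q) ≤ q * (q * q) := Nat.mul_le_mul_right _ hV
    rw [Nat.add_mul] at h1
    have h2 : (V * (q * q) + x + 2) * q ≤ q * (q * q) * q := Nat.mul_le_mul_right _ (by omega)
    have h3 : q ^ 4 = q * (q * q) * q := by ring
    rw [Nat.add_mul _ 2] at h2
    omega
  rcases H.even_cases (by omega) (h := 2) rfl le_rfl (pow_one q) rfl (by omega) hDM hV (by omega) hz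
    hN hs with h1 | h1 | h1 | h1
  · obtain ⟨c, hc⟩ := h1
    rcases hx with rfl | ⟨rfl, -⟩
    · rw [hc] at hBq
      simp at hBq
    · rw [hc, Nat.mul_add_mod, Nat.mod_eq_of_lt (by omega)] at hBq
      omega
  · obtain ⟨hxl, hr, hrs⟩ := h1
    have hzV : z * q + V < q * q := by
      have : (z + 1) * q ≤ q * q := Nat.mul_le_mul_right _ hz
      rw [Nat.add_mul] at this
      omega
    rw [add_assoc] at hr hrs
    have h2 : (x * (q * q) + (z * q + V)) % (q * q) = z * q + V := by
      rw [Nat.mul_add_mod_self_right, Nat.mod_eq_of_lt hzV]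
    have h3 : (z * q + V) % q = V := by rw [Nat.mul_add_mod_self_right, Nat.mod_eq_of_lt hV]
    by_cases hlz : lam < z * q + V
    · have h4 := hmax _ hr hrs ⟨by rw [h2, h3]; omega, by rwa [h2]⟩
      have hxv : x ≤ v := by
        by_contra! hcon
        have h5 : (v + 1) * (q * q) ≤ x * (q * q) := Nat.mul_le_mul_right _ hcon
        rw [Nat.add_mul, one_mul] at h5
        omega
      rcases hok with hok | hok
      · omega
      · have hxv : x = v := by have := hsp hok.1; omega
        subst hxv
        have h5 : 1 * q ≤ z * q := Nat.mul_le_mul_right _ (by omega)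
        omega
    · have hz0 : z = 0 := by
        by_contra hz0
        have h5 : 1 * q ≤ z * q := Nat.mul_le_mul_right _ (by omega)
        omega
      subst hz0
      have h5 := H.dvd_add_of_spec hlam (by omega) hrs
      have h6 := Nat.eq_zero_of_dvd_of_lt (a := lam) (b := x + (0 * q + V) - lam)
        (Nat.dvd_sub h5 dvd_rfl) (by omega)
      omega
  · obtain ⟨rfl, hr, hrs⟩ := h1
    have h2 : V < lam := by
      by_contra! hcon
      have : lam * (q * q) ≤ V * (q * q) := Nat.mul_le_mul_right _ hcon
      omega
    have h5 := H.dvd_add_of_spec hlam (by omega) hrs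
    have h6 := Nat.eq_zero_of_dvd_of_lt (Nat.dvd_sub h5 dvd_rfl : lam ∣ V + x - lam) (by omega)
    rcases hok with hok | hok
    · omega
    · have := hsp hok.1
      omega
  · omega

theorem four_card_le (H : DualSpectrum q 4 lam D w Spec) (hlam : lam ∣ q - 1) (hlam3 : 3 ≤ lam)
    (hlamq : 2 * lam + 1 ≤ q) (hD : D ≤ lam * (q * q - q)) {v b : ℕ} (hbM : b < q * q)
    (hb : lam < b) (hsp : b = lam + 1 → v + 1 = lam) (hvb : lam * q ≤ v * (q * q) + b)
    (hps : Spec (v * (q * q) + b))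
    (hmax : ∀ r, r ≤ D → Spec r → 2 ≤ r % (q * q) % q ∧ lam < r % (q * q) → r ≤ v * (q * q) + b)
    (U : Finset ℕ) (hU : ∀ u ∈ U, u < q * q)
    (hok : ∀ u ∈ U, ∀ u' ∈ U, evenOk q lam v b ((b + u + q * q - u') % (q * q)) = true) :
    (q - 1 - v) * U.card * q ≤ lam * w := by
  have hqq : 0 < q * q := by omega
  refine H.even_card_le (by omega) (by omega) (h := 2) rfl (by omega) (pow_one q) rfl hbM hps U hU
    (fun u hu u' hu' => ?_) fun u hu u' hu' V x z hvV hV hz hx hlt =>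
      H.four_not_spec hlam hlam3 hlamq hD hbM hb hsp hvb hmax (Nat.mod_lt _ hqq) (hok u hu u' hu')
        hvV hV hz hx hlt
  have h1 := (evenOk_iff.1 (hok u hu u' hu')).1
  by_contra! h0
  rw [Nat.lt_one_iff.1 h0] at h1
  simp at h1

end DualSpectrum

theorem two_digit_shift {q c ξ j j' x x' : ℕ} (hq : 0 < q) (hj' : j' < q) (hx' : x' < q) :
    (c * q + ξ + (x * q + j) + q * q - (x' * q + j')) % (q * q) =
      q * ((c + x + (q - 1) - x' + (ξ + j + q - j') / q) % q) + (ξ + j + q - j') % q := by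
  have h1 := Nat.div_add_mod (ξ + j + q - j') q
  have hlt : (ξ + j + q - j') % q < q := Nat.mod_lt _ hq
  generalize (ξ + j + q - j') % q = l at *
  generalize (ξ + j + q - j') / q = d at *
  have h2 : c * q + ξ + (x * q + j) + q * q - (x' * q + j') =
      q * (c + x + (q - 1) - x' + d) + l := by
    have h3 : q * (c + x + (q - 1) - x' + d) + x' * q + q = c * q + x * q + q * q + q * d := by
      have h4 : c + x + (q - 1) - x' + d + x' + 1 = c + x + q + d := by omega
      calc _ = q * (c + x + (q - 1) - x' + d + x' + 1) := by ring
        _ = _ := by rw [h4]; ring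
    omega
  rw [h2, Nat.mod_mul, Nat.mul_add_mod, Nat.mod_eq_of_lt hlt, Nat.mul_add_div hq,
    Nat.div_eq_of_lt hlt, add_zero, add_comm]

/-- Sets of six shifts that avoid two consecutive differences. -/
theorem exists_six_shifts {ξ : ℕ} (hξ : 2 ≤ ξ) : ∃ J : Finset ℕ, J.card = 6 ∧
    (∀ j ∈ J, j < 16 ∧ (3 ≤ ξ → j < 12) ∧ (3 ≤ ξ → ξ ≠ 6 → ξ + j < 16 ∨ j < 6) ∧
      (7 ≤ ξ → j < 6)) ∧ ∀ j ∈ J, ∀ j' ∈ J,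
      ξ + j ≠ j' ∧ ξ + j ≠ j' + 1 ∧ j' ≤ ξ + j + 13 ∧ (3 ≤ ξ → j' ≤ ξ + j + 8) := by
  rcases Nat.lt_or_ge ξ 7 with h | h
  · interval_cases ξ
    · exact ⟨{0, 3, 6, 9, 12, 15}, by decide⟩
    · exact ⟨{0, 1, 5, 6, 10, 11}, by decide⟩
    · exact ⟨{0, 1, 2, 7, 8, 9}, by decide⟩
    · exact ⟨{0, 1, 2, 3, 9, 10}, by decide⟩
    · exact ⟨{0, 1, 2, 3, 4, 11}, by decide⟩
  · refine ⟨Finset.range 6, by simp, ?_, ?_⟩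
    · intro j hj
      rw [Finset.mem_range] at hj
      omega
    · intro j hj j' hj'
      rw [Finset.mem_range] at hj hj'
      omega

/-- Two-sided sets of two-digit residues from sets of digits. -/
theorem exists_evenOk_of_product {q lam v b c ξ : ℕ} (hlamq : lam < q) (hb : b = c * q + ξ)
    (X J : Finset ℕ) (h2 : ∀ x ∈ X, x < q) (h3 : ∀ j ∈ J, j < q)
    (h4 : ∀ j ∈ J, ∀ j' ∈ J, 2 ≤ (ξ + j + q - j') % q ∧
      (lam < (ξ + j + q - j') % q ∨ (b = lam + 1 ∧ lam ≤ (ξ + j + q - j') % q) ∨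
        ∀ x ∈ X, ∀ x' ∈ X, (c + x + (q - 1) - x' + (ξ + j + q - j') / q) % q ≠ 0)) :
    ∃ U : Finset ℕ, U.card = X.card * J.card ∧ (∀ u ∈ U, u < q * q) ∧
      ∀ u ∈ U, ∀ u' ∈ U, evenOk q lam v b ((b + u + q * q - u') % (q * q)) = true := by
  have hq0 : 0 < q := by omega
  refine ⟨(X ×ˢ J).image fun y => y.1 * q + y.2, ?_, ?_, ?_⟩
  · exact Finset.card_image_mul_add _ _ h3
  · intro u hu
    simp only [Finset.mem_image, Finset.mem_product, Prod.exists] at hu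
    obtain ⟨x, j, ⟨hx, hj⟩, rfl⟩ := hu
    have h5 : (x + 1) * q ≤ q * q := Nat.mul_le_mul_right _ (h2 x hx)
    have := h3 j hj
    rw [Nat.add_mul] at h5
    omega
  · intro u hu u' hu'
    simp only [Finset.mem_image, Finset.mem_product, Prod.exists] at hu hu'
    obtain ⟨x, j, ⟨hx, hj⟩, rfl⟩ := hu
    obtain ⟨x', j', ⟨hx', hj'⟩, rfl⟩ := hu'
    obtain ⟨h6, h7⟩ := h4 j hj j' hj'
    have h8 := two_digit_shift (c := c) (ξ := ξ) (j := j) (x := x) hq0 (h3 j' hj') (h2 x' hx')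
    rw [← hb] at h8
    rw [h8, evenOk_iff]
    have hlt : (ξ + j + q - j') % q < q := Nat.mod_lt _ hq0
    refine ⟨by rwa [Nat.mul_add_mod, Nat.mod_eq_of_lt hlt], ?_⟩
    rcases h7 with h7 | h7 | h7
    · exact Or.inl (Or.inl (by omega))
    · rcases Nat.eq_zero_or_pos ((c + x + (q - 1) - x' + (ξ + j + q - j') / q) % q) with h9 | h9
      · rw [h9, mul_zero, zero_add]
        omega
      · have := Nat.mul_le_mul_left q h9
        exact Or.inl (Or.inl (by omega))
    · have := Nat.mul_le_mul_left q (Nat.pos_of_ne_zero (h7 x hx x' hx'))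
      exact Or.inl (Or.inl (by omega))

/-- Lower digits `0` and `1` move the last digit by at most one. It stays above `lam`, except that
it may reach `lam` when `b = lam + 1`, which `evenOk` admits. -/
theorem exists_evenOk_set_of_large_digit {q lam v b c ξ : ℕ} (hq : q = 2 * lam + 1)
    (hlam : 1 ≤ lam) (hb : b = c * q + ξ) (hB1 : lam + 1 ≤ ξ) (hB2 : ξ + 2 ≤ q)
    (hB3 : lam + 2 ≤ ξ ∨ c = 0) :
    ∃ U : Finset ℕ, U.card = q * 2 ∧ (∀ u ∈ U, u < q * q) ∧
      ∀ u ∈ U, ∀ u' ∈ U, evenOk q lam v b ((b + u + q * q - u') % (q * q)) = true := by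
  have hq0 : 0 < q := by omega
  have hdiv : ∀ y, y < q → (y + q) / q = 1 ∧ (y + q) % q = y := fun y hy =>
    ⟨by rw [Nat.add_div_right _ hq0, Nat.div_eq_of_lt hy], by
      rw [Nat.add_mod_right, Nat.mod_eq_of_lt hy]⟩
  have h := exists_evenOk_of_product (v := v) (lam := lam) (by omega) hb (Finset.range q) {0, 1}
    (by simp) ?_ ?_
  · simpa using h
  · simp only [Finset.mem_insert, Finset.mem_singleton]
    omega
  · intro j hj j' hj'
    simp only [Finset.mem_insert, Finset.mem_singleton] at hj hj'
    have h1 : (ξ + j + q - j') % q = ξ + j - j' := by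
      rw [show ξ + j + q - j' = ξ + j - j' + q by omega]
      exact (hdiv _ (by omega)).2
    have h2 : c = 0 → b = ξ := by rintro rfl; omega
    rw [h1]
    refine ⟨by omega, ?_⟩
    by_cases h3 : lam < ξ + j - j'
    · exact Or.inl h3
    · exact Or.inr (Or.inl (by omega))

/-- Large two-sided sets of two-digit residues. -/
theorem exists_evenOk_set {q lam v b c ξ : ℕ} (hlam : 8 ≤ lam)
    (hlam' : 16 ≤ lam ∨ (ξ ≠ 2 ∧ ξ ≠ 2 * lam ∧ (ξ = 6 → 9 ≤ lam))) (hq : q = 2 * lam + 1) (hb : b = c * q + ξ) (hc : c < q) (hξ : ξ < q) (hξ2 : 2 ≤ ξ) (hbl : lam < b)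
    (hB : ¬ (lam + 1 ≤ ξ ∧ ξ + 2 ≤ q ∧ (lam + 2 ≤ ξ ∨ c = 0)))
    (hne : ¬ (c = 2 * lam ∧ ξ = 2 * lam)) :
    ∃ U : Finset ℕ, 2 * q ≤ U.card ∧ (∀ u ∈ U, u < q * q) ∧
      ∀ u ∈ U, ∀ u' ∈ U, evenOk q lam v b ((b + u + q * q - u') % (q * q)) = true := by
  have hq0 : 0 < q := by omega
  suffices h : ∃ X J : Finset ℕ, 2 * q ≤ X.card * J.card ∧ (∀ x ∈ X, x < q) ∧ (∀ j ∈ J, j < q) ∧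
      ∀ j ∈ J, ∀ j' ∈ J, 2 ≤ (ξ + j + q - j') % q ∧
        (lam < (ξ + j + q - j') % q ∨ (b = lam + 1 ∧ lam ≤ (ξ + j + q - j') % q) ∨
          ∀ x ∈ X, ∀ x' ∈ X, (c + x + (q - 1) - x' + (ξ + j + q - j') / q) % q ≠ 0) by
    obtain ⟨X, J, h1, h2, h3, h4⟩ := h
    obtain ⟨U, hU1, hU2⟩ := exists_evenOk_of_product (v := v) (by omega) hb X J h2 h3 h4
    exact ⟨U, hU1 ▸ h1, hU2⟩
  have hdiv : ∀ y, y < q → (y + q) / q = 1 ∧ (y + q) % q = y := fun y hy =>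
    ⟨by rw [Nat.add_div_right _ hq0, Nat.div_eq_of_lt hy], by
      rw [Nat.add_mod_right, Nat.mod_eq_of_lt hy]⟩
  have hdiv0 : ∀ y, y < q → y / q = 0 ∧ y % q = y := fun y hy =>
    ⟨Nat.div_eq_of_lt hy, Nat.mod_eq_of_lt hy⟩
  have hdiv2 : ∀ y, y < q → (y + q + q) / q = 2 ∧ (y + q + q) % q = y := fun y hy =>
    ⟨by rw [Nat.add_div_right _ hq0, (hdiv y hy).1], by rw [Nat.add_mod_right, (hdiv y hy).2]⟩
  -- For a small last digit the six shifts give a lower digit above `lam` whenever there is a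
  -- borrow. Without a borrow, the upper digit is nonzero because `X` avoids the difference `c`.
  -- Since `X` has at least `q / 3` elements, the product has at least `2 * q`.
  by_cases hC : ξ ≤ lam + 1
  · have hc1 : 1 ≤ c := by
      by_contra! h0
      have h0 : c = 0 := by omega
      subst h0
      exact hB ⟨by omega, by omega, Or.inr rfl⟩
    obtain ⟨X, hX1, hX3, hX2⟩ := Nat.exists_avoid_sub (y := c) (R := q)
      (by rw [Nat.mod_eq_of_lt hc]; omega) hq0
    obtain ⟨J, hJ1, hJ2, hJ3⟩ := exists_six_shifts hξ2
    refine ⟨X, J, by rw [hJ1]; omega, hX1, fun j hj => by have := (hJ2 j hj).1; omega, ?_⟩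
    intro j hj j' hj'
    obtain ⟨h1, h2, h3, h4⟩ := hJ2 j hj
    have hA : ξ + j < q := by
      rcases hlam' with hlam' | ⟨h6, -, h7⟩
      · omega
      · rcases Nat.lt_or_ge ξ 7 with h8 | h8
        · by_cases h9 : ξ = 6
          · have := h7 h9
            have := h2 (by omega)
            omega
          · rcases h3 (by omega) h9 with h10 | h10 <;> omega
        · have := h4 h8
          omega
    obtain ⟨h5, h6, h7, h8⟩ := hJ3 j hj j' hj'
    have hB' : j' + lam < ξ + j + q := by
      rcases hlam' with hlam' | ⟨h9, -⟩
      · omega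
      · have := h8 (by omega)
        omega
    have hj'q : j' < 16 := (hJ2 j' hj').1
    clear hlam' h2 h3 h4 h8 hB hJ2 hJ3
    by_cases h6 : j' ≤ ξ + j
    · have h7 : (ξ + j + q - j') / q = 1 ∧ (ξ + j + q - j') % q = ξ + j - j' := by
        rw [show ξ + j + q - j' = ξ + j - j' + q by omega]
        exact hdiv _ (by omega)
      rw [h7.1, h7.2]
      refine ⟨by omega, Or.inr (Or.inr fun x hx x' hx' => ?_)⟩
      have := hX1 x' hx'
      rw [show c + x + (q - 1) - x' + 1 = c + x + q - x' by omega]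
      exact hX3 x hx x' hx'
    · have h7 := hdiv0 (ξ + j + q - j') (by omega)
      rw [h7.2]
      exact ⟨by omega, Or.inl (by omega)⟩
  -- Multiples of three either stay above `lam` or overflow to `3 * (i - i') - 1 ≥ 2`. The overflow
  -- adds one to the upper digit, so `X` must avoid `c + 1`.
  · have hξq : ξ = 2 * lam := by omega
    obtain ⟨X, hX1, hX3, hX2⟩ := Nat.exists_avoid_sub (y := c + 1) (R := q)
      (by rw [Nat.mod_eq_of_lt (by omega)]; omega) hq0
    refine ⟨X, {0, 3, 6, 9, 12, 15}, ?_, hX1, ?_, ?_⟩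
    · rw [show ({0, 3, 6, 9, 12, 15} : Finset ℕ).card = 6 from rfl]
      omega
    · simp only [Finset.mem_insert, Finset.mem_singleton]
      omega
    · intro j hj j' hj'
      have hJ : ∀ j ∈ ({0, 3, 6, 9, 12, 15} : Finset ℕ), ∃ i, j = 3 * i ∧ i ≤ 5 := by
        intro j hj
        simp only [Finset.mem_insert, Finset.mem_singleton] at hj
        exact ⟨j / 3, by omega, by omega⟩
      obtain ⟨i, rfl, hi⟩ := hJ j hj
      obtain ⟨i', rfl, hi'⟩ := hJ j' hj'
      rcases Nat.lt_or_ge i' i with h1 | h1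
      · have h2 : (ξ + 3 * i + q - 3 * i') / q = 2 ∧
            (ξ + 3 * i + q - 3 * i') % q = 3 * i - 3 * i' - 1 := by
          rw [show ξ + 3 * i + q - 3 * i' = 3 * i - 3 * i' - 1 + q + q by omega]
          exact hdiv2 _ (by omega)
        rw [h2.1, h2.2]
        refine ⟨by omega, Or.inr (Or.inr fun x hx x' hx' => ?_)⟩
        have := hX1 x' hx'
        rw [show c + x + (q - 1) - x' + 2 = c + 1 + x + q - x' by omega]
        exact hX3 x hx x' hx'
      · have h2 : (ξ + 3 * i + q - 3 * i') % q = 2 * lam + 3 * i - 3 * i' := by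
          rw [show ξ + 3 * i + q - 3 * i' = 2 * lam + 3 * i - 3 * i' + q by omega]
          exact (hdiv _ (by omega)).2
        rw [h2]
        exact ⟨by omega, Or.inl (by omega)⟩

/-- Peeling order for 5 elements. -/
def script_five : List (List (ℕ × ℕ × ℕ) × List ℕ) :=
    [([(125, 4, 4), (25, 4, 4), (5, 4, 4), (1, 4, 4)], [19]), ([(1, 1, 4), (25, 4, 4), (125, 4,
    1), (5, 4, 4)], [17, 14, 12, 9, 7, 4, 2]), ([(1, 2, 2), (25, 4, 2), (5, 1, 1), (125, 4, 0)],
    [18, 16, 13, 11, 8, 6, 3, 1])]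

/-- For this and the next scripts, `k = 2 * (q ^ 2 - q + 1)` is the claimed weight and `Y = q ^ 2 -
q` bounds the leaders divided by `lam`. -/
theorem scriptOk_five : scriptOk 2 312 5 4 42 20 script_five = true := by
  decide +kernel

/-- Peeling order for 7 elements. -/
def script_seven : List (List (ℕ × ℕ × ℕ) × List ℕ) :=
    [([(49, 6, 3), (1, 6, 5), (343, 6, 0), (7, 6, 6)], [41, 39]), ([(1, 4, 3), (49, 6, 6), (7, 6,
    6), (343, 6, 1)], [37, 34, 32, 30, 27, 25, 23, 20, 18, 16, 13, 11, 9, 6, 2]), ([(49, 6, 6),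
    (7, 6, 2), (1, 1, 2), (343, 2, 2)], [40, 38, 36, 31, 29, 26, 24, 22, 19, 17, 15, 12, 10, 8,
    5, 4, 3, 1])]

theorem scriptOk_seven : scriptOk 3 800 7 4 86 42 script_seven = true := by
  decide +kernel

/-- Peeling order for 9 elements. -/
def script_nine : List (List (ℕ × ℕ × ℕ) × List ℕ) :=
    [([(81, 8, 8), (9, 4, 4), (1, 8, 8), (729, 2, 2)], [71]), ([(81, 8, 6), (9, 8, 8), (1, 8, 1),
    (729, 8, 3)], [69]), ([(81, 8, 8), (9, 8, 8), (1, 1, 1), (729, 2, 2)], [70]), ([(81, 8, 8),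
    (1, 1, 8), (9, 8, 8), (729, 8, 8)], [67]), ([(81, 8, 8), (9, 8, 8), (729, 8, 0), (1, 8, 1)],
    [68]), ([(81, 8, 8), (9, 7, 7), (729, 5, 5), (1, 8, 8)], [64, 62, 60, 59, 55]), ([(81, 8, 6),
    (1, 8, 8), (9, 8, 2), (729, 4, 4)], [66, 65, 53]), ([(81, 8, 8), (9, 8, 8), (729, 7, 3), (1,
    8, 3)], [51, 44, 42, 35, 26, 17, 8]), ([(1, 1, 1), (729, 8, 3), (81, 4, 4), (9, 8, 8)], [58,
    49]), ([(1, 8, 5), (81, 8, 0), (9, 8, 8), (729, 1, 4)], [46, 40, 37, 33, 31, 28, 24, 22, 19,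
    15, 13, 10, 6]), ([(81, 8, 2), (1, 8, 1), (9, 8, 8), (729, 8, 8)], [57, 56, 52, 50, 48, 47,
    43, 41, 39, 38, 34, 32, 30, 29, 25, 23, 21, 20, 16, 14, 12, 11, 7, 5, 4, 3, 2, 1])]

theorem scriptOk_nine : scriptOk 4 1640 9 4 146 72 script_nine = true := by
  decide +kernel

/-- Peeling order for 11 elements. -/
def script_eleven : List (List (ℕ × ℕ × ℕ) × List ℕ) :=
    [([(121, 10, 10), (11, 10, 3), (1, 10, 10), (1331, 10, 8)], [109, 107]), ([(121, 10, 1), (11,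
    5, 5), (1331, 10, 10), (1, 3, 9)], [108]), ([(121, 10, 10), (11, 10, 10), (1331, 10, 10), (1,
    6, 6)], [106, 105, 104, 100, 98, 96, 95, 94]), ([(121, 10, 7), (1, 6, 1), (11, 10, 8), (1331,
    10, 10)], [103]), ([(121, 10, 10), (11, 10, 3), (1, 10, 10), (1331, 9, 10)], [92]), ([(121,
    10, 10), (11, 10, 10), (1331, 10, 10), (1, 5, 4)], [93, 87]), ([(121, 10, 5), (1331, 10, 3),
    (1, 10, 4), (11, 8, 0)], [89]), ([(121, 10, 10), (1, 10, 10), (11, 10, 1), (1331, 10, 7)],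
    [102, 101, 85, 84]), ([(121, 10, 10), (1331, 8, 3), (11, 10, 1), (1, 10, 10)], [91, 90, 86,
    83, 82, 81]), ([(121, 10, 10), (11, 8, 0), (1, 5, 2), (1331, 4, 4)], [76, 74]), ([(121, 10,
    1), (11, 10, 3), (1331, 10, 5), (1, 10, 2)], [78]), ([(121, 10, 5), (1331, 7, 7), (1, 10,
    10), (11, 4, 4)], [80]), ([(121, 10, 7), (11, 3, 4), (1, 3, 8), (1331, 10, 10)], [79]),
    ([(121, 10, 10), (1, 2, 3), (1331, 2, 7), (11, 10, 10)], [72, 70, 69, 68, 67, 65, 64, 63, 61,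
    60, 59, 58, 57, 56, 54, 52, 50, 48, 47, 46, 45, 43, 41, 39, 37, 36, 35, 32, 30, 28, 26, 25,
    21, 19, 17, 15, 14, 10, 8]), ([(1, 10, 3), (1331, 6, 5), (121, 10, 10), (11, 10, 5)], [71,
    62, 51, 49, 40, 38, 34, 29, 27, 23, 20, 18, 16, 13, 12, 9, 7, 6, 5, 4, 3, 2, 1]), ([(1, 9,
    9), (1331, 9, 4), (11, 10, 9), (121, 9, 6)], [75, 53, 42, 31, 24])]

theorem scriptOk_eleven : scriptOk 5 2928 11 4 222 110 script_eleven = true := by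
  decide +kernel

/-! ### Existence of two-digit sets in degree four. -/

/-- There is a two-sided set of two-digit residues that yields the even bound in degree four. -/
def HasEvenSet (q lam v b : ℕ) : Prop :=
  ∃ U : Finset ℕ, lam * (2 * (q * q - q) + 1) < (q - 1 - v) * U.card * q ∧ (∀ u ∈ U, u < q * q) ∧
    ∀ u ∈ U, ∀ u' ∈ U, evenOk q lam v b ((b + u + q * q - u') % (q * q)) = true

theorem hasEvenSet_of_card {q lam v b : ℕ} (hq : q = 2 * lam + 1) (hv : v < lam)
    (h : ∃ U : Finset ℕ, 2 * q ≤ U.card ∧ (∀ u ∈ U, u < q * q) ∧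
      ∀ u ∈ U, ∀ u' ∈ U, evenOk q lam v b ((b + u + q * q - u') % (q * q)) = true) :
    HasEvenSet q lam v b := by
  obtain ⟨U, h1, h2⟩ := h
  refine ⟨U, ?_, h2⟩
  calc lam * (2 * (q * q - q) + 1) < (lam + 1) * (2 * q) * q := by
        have h3 : lam * (2 * (q * q - q) + 1) ≤ lam * (2 * (q * q)) :=
          Nat.mul_le_mul_left _ (by have := Nat.le_mul_self q; omega)
        have h4 : (lam + 1) * (2 * q) * q = lam * (2 * (q * q)) + 2 * (q * q) := by ring
        have h5 : 0 < q * q := Nat.mul_pos (by omega) (by omega)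
        omega
    _ ≤ (q - 1 - v) * U.card * q :=
        Nat.mul_le_mul_right _ (Nat.mul_le_mul (by omega) h1)

/-- A sufficient condition for the admissibility of a two-digit residue. -/
def overOk (q lam B : ℕ) : Bool := Nat.ble 2 (B % q) && Nat.blt lam B

theorem evenOk_of_overOk {q lam v b B : ℕ} (h : overOk q lam B = true) :
    evenOk q lam v b B = true := by
  rw [overOk, Bool.and_eq_true, Nat.ble_eq, Nat.blt_eq] at h
  exact evenOk_iff.2 ⟨h.1, Or.inl (Or.inl h.2)⟩

/-- First-fit count of sets of two-digit residues. -/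
def overCount (q lam b : ℕ) : ℕ :=
  twoSidedCount (q * q) (maskOf (overOk q lam) (q * q))
    (maskOf (fun i => overOk q lam ((q * q - i) % (q * q))) (q * q)) (2 * q) b

/-- Check of a single leader. -/
def evenPairOk (q lam : ℕ) (skip : List (ℕ × ℕ)) (v c ξ : ℕ) : Bool :=
  Nat.ble (c * q + ξ) lam || Nat.beq (c * q + ξ + 1) (q * q) ||
    (Nat.beq v 0 && Nat.blt (c * q + ξ + 1 + lam) (q * q)) ||
    Nat.blt (lam * (q * q - q)) (v * (q * q) + (c * q + ξ)) || skip.contains (c, ξ) ||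
    Nat.blt (lam * (2 * (q * q - q) + 1)) ((q - 1 - v) * overCount q lam (c * q + ξ) * q)

/-- Check of the leaders whose last digit lies in `l` and whose preceding digit lies in
`a, …, a + k - 1`. -/
def evenCheck (q lam a k : ℕ) (l : List ℕ) (skip : List (ℕ × ℕ)) : Bool :=
  (List.range' a k).all fun c => l.all fun ξ => evenPairOk q lam skip ((4 * lam - c - ξ) % lam) c ξ

/-- Last digits `8` to `11` and the exception `(0, 7)` fall under the large-digit construction; the
other four exceptions receive explicit sets. -/
theorem evenCheck_thirteen : evenCheck 13 6 0 13 [2, 3, 4, 5, 6, 7, 12]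
    [(0, 7), (1, 7), (8, 12), (4, 3), (5, 2)] = true := by decide +kernel
theorem evenCheck_seventeen : evenCheck 17 8 0 17 [2, 6, 16] [] = true := by decide +kernel
theorem evenCheck_nineteen : evenCheck 19 9 0 19 [2, 18] [] = true := by decide +kernel
theorem evenCheck_twentythree : evenCheck 23 11 0 23 [2, 22] [] = true := by decide +kernel
theorem evenCheck_twentyfive : evenCheck 25 12 0 25 [2, 24] [] = true := by decide +kernel
theorem evenCheck_twentyseven_low : evenCheck 27 13 0 9 [2, 26] [] = true := by
  decide +kernel
theorem evenCheck_twentyseven_mid : evenCheck 27 13 9 9 [2, 26] [] = true := by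
  decide +kernel
theorem evenCheck_twentyseven_high : evenCheck 27 13 18 9 [2, 26] [] = true := by
  decide +kernel
theorem evenCheck_twentynine_low : evenCheck 29 14 0 9 [2, 28] [] = true := by
  decide +kernel
theorem evenCheck_twentynine_mid : evenCheck 29 14 9 9 [2, 28] [] = true := by
  decide +kernel
theorem evenCheck_twentynine_high : evenCheck 29 14 18 11 [2, 28] [] = true := by
  decide +kernel
theorem evenCheck_thirtyone_low : evenCheck 31 15 0 9 [2, 30] [] = true := by
  decide +kernel
theorem evenCheck_thirtyone_mid : evenCheck 31 15 9 9 [2, 30] [] = true := by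
  decide +kernel
theorem evenCheck_thirtyone_high : evenCheck 31 15 18 13 [2, 30] [] = true := by
  decide +kernel

theorem hasEvenSet_of_evenCheck {q lam a k v c ξ : ℕ} {l : List ℕ}
    {skip : List (ℕ × ℕ)} (hq : q = 2 * lam + 1) (hc : evenCheck q lam a k l skip = true)
    (hac : a ≤ c) (hck : c < a + k) (hl : ξ ∈ l) (hv : v < lam) (hcq : c < q) (hξ : ξ < q) (hξ2 : 2 ≤ ξ) (hdvd : lam ∣ v + c + ξ) (hbl : lam < c * q + ξ)
    (hne : c * q + ξ + 1 ≠ q * q) (hv0 : v = 0 → q * q ≤ c * q + ξ + 1 + lam)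
    (hD : v * (q * q) + (c * q + ξ) ≤ lam * (q * q - q)) (hskip : (c, ξ) ∉ skip) :
    HasEvenSet q lam v (c * q + ξ) := by
  -- The top digit is determined by the two others through `lam ∣ v + c + ξ`; as both are at most `2
  -- * lam`, the subtraction does not truncate.
  have hvm : (4 * lam - c - ξ) % lam = v := by
    have h1 : 4 * lam - c - ξ ≡ v [MOD lam] := by
      refine Nat.ModEq.add_right_cancel' (c + ξ) ?_
      rw [show 4 * lam - c - ξ + (c + ξ) = lam * 4 by omega, ← add_assoc]
      exact ((Nat.modEq_zero_iff_dvd.2 (dvd_mul_right _ _)).trans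
        (Nat.modEq_zero_iff_dvd.2 hdvd).symm)
    rw [h1, Nat.mod_eq_of_lt hv]
  simp only [evenCheck, List.all_eq_true, List.mem_range'_1] at hc
  have h1 := hc c ⟨hac, hck⟩ ξ hl
  rw [hvm] at h1
  simp only [evenPairOk, Bool.or_eq_true, Bool.and_eq_true, Nat.ble_eq, Nat.beq_eq, Nat.blt_eq,
    List.contains_iff_mem] at h1
  have h2 : lam * (2 * (q * q - q) + 1) < (q - 1 - v) * overCount q lam (c * q + ξ) * q := by
    rcases h1 with ((((h1 | h1) | h1) | h1) | h1) | h1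
    · omega
    · exact absurd h1 hne
    · have := hv0 h1.1
      omega
    · omega
    · exact absurd h1 hskip
    · exact h1
  have hb : c * q + ξ < q * q := by
    have : (c + 1) * q ≤ q * q := Nat.mul_le_mul_right _ hcq
    rw [Nat.add_mul] at this
    omega
  have hbq : (c * q + ξ) % q = ξ := by rw [Nat.mul_add_mod_self_right, Nat.mod_eq_of_lt hξ]
  obtain ⟨U, hU1, hU2, hU3⟩ := exists_finset_of_twoSidedCount (M := q * q) (overOk q lam) hb
    (by omega) (by rw [overOk, Bool.and_eq_true, Nat.ble_eq, Nat.blt_eq, hbq]; exact ⟨hξ2, hbl⟩)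
    (2 * q)
  refine ⟨U, ?_, hU2, fun u hu u' hu' => evenOk_of_overOk (hU3 u hu u' hu')⟩
  rw [hU1]
  exact h2

theorem hasEvenSet_of_list {q lam v b : ℕ} (L : List ℕ) (hL : L.Nodup)
    (h1 : lam * (2 * (q * q - q) + 1) < (q - 1 - v) * L.length * q)
    (h2 : (L.all fun u => Nat.blt u (q * q) &&
      L.all fun u' => evenOk q lam v b ((b + u + q * q - u') % (q * q))) = true) :
    HasEvenSet q lam v b := by
  simp only [List.all_eq_true, Bool.and_eq_true, Nat.blt_eq] at h2
  refine ⟨L.toFinset, by rwa [List.toFinset_card_of_nodup hL], fun u hu => ?_,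
    fun u hu u' hu' => ?_⟩
  · exact (h2 u (List.mem_toFinset.1 hu)).1
  · exact (h2 u (List.mem_toFinset.1 hu)).2 u' (List.mem_toFinset.1 hu')

/-- The threshold is `6 * 313 = 1878`: with `v = 4` it takes `19` elements, with `v = 5` it takes
`21`. -/
theorem hasEvenSet_one_seven : HasEvenSet 13 6 4 20 :=
  hasEvenSet_of_list [0, 1, 2, 3, 4, 5, 13, 14, 26, 27, 39, 40, 52, 53, 65, 66, 78, 79, 91]
    (by decide +kernel) (by decide +kernel) (by decide +kernel)

theorem hasEvenSet_eight_twelve : HasEvenSet 13 6 4 116 :=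
  hasEvenSet_of_list [0, 16, 19, 22, 42, 45, 48, 61, 81, 84, 87, 107, 110, 120, 123, 126, 146, 149,
    152] (by decide +kernel) (by decide +kernel) (by decide +kernel)

theorem hasEvenSet_four_three : HasEvenSet 13 6 5 55 :=
  hasEvenSet_of_list [0, 5, 6, 12, 13, 18, 19, 38, 39, 44, 45, 77, 78, 83, 84, 103, 104, 109, 110,
    142, 143] (by decide +kernel) (by decide +kernel) (by decide +kernel)

theorem hasEvenSet_five_two : HasEvenSet 13 6 5 67 :=
  hasEvenSet_of_list [0, 3, 6, 35, 39, 42, 45, 48, 52, 74, 78, 81, 84, 87, 91, 94, 120, 123, 126,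
    130, 133] (by decide +kernel) (by decide +kernel) (by decide +kernel)

namespace DualSpectrum

variable {q lam D w : ℕ} {Spec : ℕ → Prop}

/-- The even bound in degree four follows from large two-sided sets of two-digit residues. -/
theorem weight_ge_of_hasEvenSet (H : DualSpectrum q 4 lam D w Spec) (hlam3 : 3 ≤ lam)
    (hq : q = 2 * lam + 1) (hD : D ≤ lam * (q * q - q))
    (hsets : ∀ v c ξ, v < lam → c < q → ξ < q → 2 ≤ ξ → lam ∣ v + c + ξ → lam < c * q + ξ →
      ¬ (c = 2 * lam ∧ ξ = 2 * lam) → (v = 0 → q * q ≤ c * q + ξ + 1 + lam) →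
      v * (q * q) + (c * q + ξ) ≤ lam * (q * q - q) → HasEvenSet q lam v (c * q + ξ)) :
    2 * (q * q - q + 1) ≤ w := by
  have hdl : lam ∣ q - 1 := ⟨2, by omega⟩
  obtain ⟨M, hM⟩ : ∃ M, M = q * q := ⟨_, rfl⟩
  rcases H.even_obstacle (h := 2) (M := M) rfl le_rfl (by rw [hM, pow_two]) hdl (by omega)
    (by omega) (by rwa [hM]) with h1 | ⟨t, f, ht, hf, hoD, ho⟩
  · rwa [← hM]
  have hlM : lam * (M - q) + lam * q = lam * M := by
    rw [← Nat.mul_add, Nat.sub_add_cancel (hM ▸ Nat.le_mul_self q)]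
  have hlM2 : (2 * lam + 1) * q = M := by rw [hM, ← hq]
  have hlM3 : (2 * lam + 1) * q = 2 * (lam * q) + q := by ring
  have hlq : 3 * q ≤ lam * q := Nat.mul_le_mul_right _ hlam3
  rw [← hM] at hD
  have hoM : (t * M + (M - 1 - f)) % M = M - 1 - f := by
    rw [Nat.mul_add_mod_self_right, Nat.mod_eq_of_lt (by omega)]
  have hoq : (M - 1 - f) % q = q - 1 - f := by
    obtain ⟨c, hc⟩ : ∃ c, q = c + 1 := ⟨q - 1, by omega⟩
    have : M - 1 - f = q * c + (q - 1 - f) := by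
      have h2 : q * q = q * c + q := by conv_lhs => rw [hc, Nat.mul_add, mul_one, ← hc]
      omega
    rw [this, Nat.mul_add_mod, Nat.mod_eq_of_lt (by omega)]
  obtain ⟨p, hop, hpD, hps, ⟨hp1, hp2⟩, hmax⟩ := exists_max_of_residue (M := M) (D := D)
    (κ := fun r => 2 ≤ r % q ∧ lam < r) ho hoD ⟨by rw [hoM, hoq]; omega, by rw [hoM]; omega⟩
  obtain ⟨v, hv⟩ : ∃ v, v = p / M := ⟨_, rfl⟩
  obtain ⟨b, hb⟩ : ∃ b, b = p % M := ⟨_, rfl⟩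
  have hp : v * M + b = p := by rw [hv, hb]; exact Nat.div_add_mod' p M
  rw [← hb] at hp1 hp2
  have hbM : b < M := hb ▸ Nat.mod_lt _ (by omega)
  have hvlam : v < lam := by
    rw [hv, Nat.div_lt_iff_lt_mul (by omega)]
    omega
  have hbdm : b / q * q + b % q = b := Nat.div_add_mod' b q
  have hc : b / q < q := by
    rw [Nat.div_lt_iff_lt_mul (by omega)]
    omega
  have hξ : b % q < q := Nat.mod_lt _ (by omega)
  rw [← hp] at hps hmax hop hpD
  have hdvd : lam ∣ v + b / q + b % q := by
    have h1 := H.dvd_add_of_spec hdl (by omega) (V := v) (x := b) (by rw [← hM]; exact hps)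
    obtain ⟨c, hc'⟩ := hdl
    have h2 : b = lam * (c * (b / q)) + (b / q + b % q) := by
      have h3 : q = lam * c + 1 := by omega
      conv_lhs => rw [← hbdm]
      conv_lhs => arg 1; arg 2; rw [h3]
      ring
    rw [h2, add_left_comm] at h1
    rw [add_assoc]
    exact (Nat.dvd_add_right (dvd_mul_right _ _)).1 h1
  have hv0 : v = 0 → M ≤ b + 1 + lam := by
    rintro rfl
    have h1 : t = 0 := by
      by_contra h0
      have := Nat.le_mul_of_pos_left M (Nat.pos_of_ne_zero h0)
      omega
    subst h1
    omega
  have hvb : lam * q ≤ v * M + b := by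
    rcases Nat.eq_zero_or_pos v with h0 | h0
    · have := hv0 h0
      omega
    · have := Nat.le_mul_of_pos_left M h0
      omega
  -- The residue `q ^ 2 - 1` forces `v = 0`. The chain preserving its last digit `2 * lam > lam`
  -- then gives `2 * q ^ 2 ≤ w` directly.
  by_cases hne : b / q = 2 * lam ∧ b % q = 2 * lam
  · have hv00 : v = 0 := by
      rw [hne.1, hne.2, add_assoc, show 2 * lam + 2 * lam = lam * 4 by ring] at hdvd
      exact Nat.eq_zero_of_dvd_of_lt ((Nat.dvd_add_left (dvd_mul_right _ _)).1 hdvd) hvlam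
    have h1 := H.even_ge_of_digit (by omega) (h := 2) rfl le_rfl (pow_one q) hM (by omega)
      (by omega) (by omega) hbM hps hvb hp1
      (fun r hr hrs hrκ => hmax r hr hrs ⟨hrκ.1 ▸ hp1, hrκ.2⟩) (by omega)
    rw [hv00, show q - 1 - 0 = lam * 2 by omega, mul_assoc, mul_assoc] at h1
    have := Nat.le_of_mul_le_mul_left h1 (by omega)
    omega
  · obtain ⟨U, hU1, hU2, hU3⟩ := hsets v (b / q) (b % q) hvlam hc hξ hp1 hdvd (by omega) hne
      (fun h => by have := hv0 h; omega) (by rw [← hM]; omega)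
    rw [hbdm] at hU3
    have hsp : b = lam + 1 → v + 1 = lam := by
      intro h
      have h1 : b / q = 0 := Nat.div_eq_of_lt (by omega)
      have h2 : b % q = lam + 1 := by rw [h]; exact Nat.mod_eq_of_lt (by omega)
      rw [h1, h2, show v + 0 + (lam + 1) = v + 1 + lam by ring] at hdvd
      have h3 := Nat.le_of_dvd (by omega) ((Nat.dvd_add_left (dvd_refl lam)).1 hdvd)
      omega
    rw [hM] at hbM hvb hps hmax hD
    have h1 := H.four_card_le hdl hlam3 (by omega) hD hbM hp2 hsp hvb hps hmax U hU2 hU3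
    have := Nat.lt_of_mul_lt_mul_left (hU1.trans_le h1)
    omega

/-- The bound in degree four for the largest `lam`. -/
theorem weight_ge_of_four (H : DualSpectrum q 4 lam D w Spec) (hpp : IsPrimePow q)
    (hlam2 : 2 ≤ lam) (hq : q = 2 * lam + 1) (hD : D ≤ lam * (q * q - q)) :
    2 * (q * q - q + 1) ≤ w := by
  have hlarge : ∀ v c ξ, v < lam → c < q → ξ < q →
      lam + 1 ≤ ξ ∧ ξ + 2 ≤ q ∧ (lam + 2 ≤ ξ ∨ c = 0) → HasEvenSet q lam v (c * q + ξ) := by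
    rintro v c ξ hv hc hξ ⟨h1, h2, h3⟩
    refine hasEvenSet_of_card hq hv ?_
    obtain ⟨U, hU1, hU2⟩ := exists_evenOk_set_of_large_digit (v := v) hq (by omega) rfl h1 h2 h3
    exact ⟨U, by omega, hU2⟩
  -- The general constructions cover `lam ≥ 16`. For `8 ≤ lam < 16` they leave only the last digits
  -- `2` and `2 * lam`, and `6` when `lam = 8`, to be checked by computation.
  have hsmall : ∀ (l : List ℕ), 8 ≤ lam → (∀ ξ ∈ [2, 2 * lam], ξ ∈ l) → (lam = 8 → 6 ∈ l) →
      (lam < 16 → ∀ c < q, ∃ a k, evenCheck q lam a k l [] = true ∧ a ≤ c ∧ c < a + k) →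
      2 * (q * q - q + 1) ≤ w := by
    intro l h8 hl h6 hcheck
    refine H.weight_ge_of_hasEvenSet (by omega) hq hD
      fun v c ξ hv hc hξ hξ2 hdvd hbl hne hv0 hvD => ?_
    by_cases hB : lam + 1 ≤ ξ ∧ ξ + 2 ≤ q ∧ (lam + 2 ≤ ξ ∨ c = 0)
    · exact hlarge v c ξ hv hc hξ hB
    by_cases hlam' : 16 ≤ lam ∨ (ξ ≠ 2 ∧ ξ ≠ 2 * lam ∧ (ξ = 6 → 9 ≤ lam))
    · exact hasEvenSet_of_card hq hv
        (exists_evenOk_set (v := v) h8 hlam' hq rfl hc hξ hξ2 hbl hB hne)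
    · obtain ⟨a, k, hk, ha, hak⟩ := hcheck (by omega) c hc
      have hξl : ξ ∈ l := by
        by_cases hξ2 : ξ = 2
        · exact hl _ (by simp [hξ2])
        by_cases hξ3 : ξ = 2 * lam
        · exact hl _ (by simp [hξ3])
        have hξ6 : ξ = 6 := by omega
        exact hξ6 ▸ h6 (by omega)
      refine hasEvenSet_of_evenCheck hq hk ha hak hξl hv hc hξ hξ2 hdvd hbl (fun h => hne ?_) hv0
        hvD (by simp)
      have h1 : (c + 1) * q ≤ q * q := Nat.mul_le_mul_right _ hc
      have h2 : c + 1 = q := by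
        refine Nat.le_antisymm hc (Nat.le_of_mul_le_mul_right ?_ (show 0 < q by omega))
        rw [Nat.add_mul]
        omega
      have h3 : q * q = c * q + q := by conv_lhs => rw [← h2, Nat.add_mul, one_mul, h2]
      omega
  have hnpp : ∀ {n p r : ℕ}, p.Prime → r.Prime → p ≠ r → n = p * r → ¬ IsPrimePow n := by
    rintro n p r hp hr hne rfl h
    rw [isPrimePow_iff_unique_prime_dvd] at h
    exact hne (h.unique ⟨hp, dvd_mul_right _ _⟩ ⟨hr, dvd_mul_left _ _⟩)
  subst hq
  rcases Nat.lt_or_ge lam 16 with h16 | h16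
  swap
  · exact hsmall [2, 2 * lam] (by omega) (fun _ h => h) (by omega) (by omega)
  interval_cases lam
  · exact H.le_of_scriptOk (n := 312) (by omega) (by omega) (by omega) (by norm_num) hD scriptOk_five
  · exact H.le_of_scriptOk (n := 800) (by omega) (by omega) (by omega) (by norm_num) hD
      scriptOk_seven
  · exact H.le_of_scriptOk (n := 1640) (by omega) (by omega) (by omega) (by norm_num) hD
      scriptOk_nine
  · exact H.le_of_scriptOk (n := 2928) (by omega) (by omega) (by omega) (by norm_num) hD
      scriptOk_eleven
  · refine H.weight_ge_of_hasEvenSet (by omega) rfl hD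
      fun v c ξ hv hc hξ hξ2 hdvd hbl hne hv0 hvD => ?_
    by_cases hB : 6 + 1 ≤ ξ ∧ ξ + 2 ≤ 13 ∧ (6 + 2 ≤ ξ ∨ c = 0)
    · exact hlarge v c ξ hv hc hξ hB
    by_cases hskip : (c, ξ) ∈ [(0, 7), (1, 7), (8, 12), (4, 3), (5, 2)]
    · simp only [List.mem_cons, Prod.mk.injEq, List.not_mem_nil, or_false] at hskip
      rcases hskip with ⟨rfl, rfl⟩ | ⟨rfl, rfl⟩ | ⟨rfl, rfl⟩ | ⟨rfl, rfl⟩ | ⟨rfl, rfl⟩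
      · omega
      · obtain rfl : v = 4 := by omega
        exact hasEvenSet_one_seven
      · obtain rfl : v = 4 := by omega
        exact hasEvenSet_eight_twelve
      · obtain rfl : v = 5 := by omega
        exact hasEvenSet_four_three
      · obtain rfl : v = 5 := by omega
        exact hasEvenSet_five_two
    · refine hasEvenSet_of_evenCheck rfl evenCheck_thirteen (by omega) (by omega) ?_ hv hc hξ hξ2
        hdvd hbl (by omega) hv0 hvD hskip
      simp only [List.mem_cons, List.not_mem_nil, or_false]
      omega
  · exact absurd hpp (hnpp (p := 3) (r := 5) (by norm_num) (by norm_num) (by norm_num) rfl)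
  · exact hsmall _ (by omega) (by simp) (by simp) fun _ c hc =>
      ⟨_, _, evenCheck_seventeen, by omega, by omega⟩
  · exact hsmall _ (by omega) (by simp) (by simp) fun _ c hc =>
      ⟨_, _, evenCheck_nineteen, by omega, by omega⟩
  · exact absurd hpp (hnpp (p := 3) (r := 7) (by norm_num) (by norm_num) (by norm_num) rfl)
  · exact hsmall _ (by omega) (by simp) (by simp) fun _ c hc =>
      ⟨_, _, evenCheck_twentythree, by omega, by omega⟩
  · exact hsmall _ (by omega) (by simp) (by simp) fun _ c hc =>
      ⟨_, _, evenCheck_twentyfive, by omega, by omega⟩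
  · refine hsmall [2, 26] (by omega) (by simp) (by simp) fun _ c hc => ?_
    rcases Nat.lt_or_ge c 9 with h | h
    · exact ⟨_, _, evenCheck_twentyseven_low, by omega, by omega⟩
    rcases Nat.lt_or_ge c 18 with h' | h'
    · exact ⟨_, _, evenCheck_twentyseven_mid, by omega, by omega⟩
    · exact ⟨_, _, evenCheck_twentyseven_high, by omega, by omega⟩
  · refine hsmall [2, 28] (by omega) (by simp) (by simp) fun _ c hc => ?_
    rcases Nat.lt_or_ge c 9 with h | h
    · exact ⟨_, _, evenCheck_twentynine_low, by omega, by omega⟩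
    rcases Nat.lt_or_ge c 18 with h' | h'
    · exact ⟨_, _, evenCheck_twentynine_mid, by omega, by omega⟩
    · exact ⟨_, _, evenCheck_twentynine_high, by omega, by omega⟩
  · refine hsmall [2, 30] (by omega) (by simp) (by simp) fun _ c hc => ?_
    rcases Nat.lt_or_ge c 9 with h | h
    · exact ⟨_, _, evenCheck_thirtyone_low, by omega, by omega⟩
    rcases Nat.lt_or_ge c 18 with h' | h'
    · exact ⟨_, _, evenCheck_thirtyone_mid, by omega, by omega⟩
    · exact ⟨_, _, evenCheck_thirtyone_high, by omega, by omega⟩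

/-- The bound in even degree for `lam` at least two. -/
theorem weight_ge_of_even_of_two_le {m h : ℕ} (H : DualSpectrum q m lam D w Spec)
    (hpp : IsPrimePow q) (hm : m = 2 * h) (hh : 2 ≤ h) (hlam : lam ∣ q - 1) (hlam2 : 2 ≤ lam)
    (hlamq : 2 * lam + 1 ≤ q) (hD : D ≤ lam * (q ^ h - q)) : 2 * (q ^ h - q + 1) ≤ w := by
  by_cases hne : 3 ≤ h ∨ 3 * lam + 1 ≤ q
  · exact H.weight_ge_of_even_of_ne hm hh hlam hlam2 hlamq hD hne
  push Not at hne
  obtain rfl : h = 2 := by omega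
  obtain rfl : m = 4 := by omega
  obtain ⟨c, hc⟩ := hlam
  have hq : q = 2 * lam + 1 := by
    have h1 : c < 3 := by
      by_contra! h0
      have := Nat.mul_le_mul_left lam h0
      omega
    have h2 : 2 ≤ c := by
      by_contra! h0
      have := Nat.mul_le_mul_left lam (Nat.le_of_lt_succ h0)
      omega
    obtain rfl : c = 2 := by omega
    omega
  rw [pow_two] at hD ⊢
  exact H.weight_ge_of_four hpp hlam2 hq hD

end DualSpectrum

/-! ### Square-root comparisons and assembly of the cases. -/

noncomputable section

theorem sqrt_lt_of_sub_le {q lam Q n x : ℝ} (hlam : 1 ≤ lam) (hq : 2 * lam + 1 ≤ q) (hQ : q ≤ Q)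
    (hn : lam * n = q * Q ^ 2 - 1) (hx : q * Q - q + 2 * lam ≤ lam * x) : √(2 * n) < x := by
  have hq3 : 3 ≤ q := by linarith
  have hqQ0 : 0 ≤ q * (Q - 1) := mul_nonneg (by linarith) (by linarith)
  have hpos : 0 < lam * x := lt_of_lt_of_le (by linarith) hx
  have hx0 : 0 < x := by
    by_contra! h
    exact absurd (mul_nonpos_of_nonneg_of_nonpos (by linarith) h) (not_le.2 hpos)
  rw [Real.sqrt_lt' hx0]
  have h1 : (2 * lam) * (q * Q ^ 2 - 1) < (q * Q - q + 2 * lam) ^ 2 := by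
    -- The second factor is `q * (Q - 1) ^ 2 - 2 * lam`. Adding `q * (Q - 1) ^ 2` to this product
    -- gives exactly the difference of the two sides of `h1`.
    have h2 : 0 ≤ (q - 1 - 2 * lam) * (q * Q ^ 2 - 1 - 2 * (q * Q - q) - 2 * lam - q + 1) := by
      refine mul_nonneg (by linarith) ?_
      nlinarith [mul_nonneg (by linarith : (0 : ℝ) ≤ q) (sq_nonneg (Q - 1)),
        mul_nonneg (by linarith : (0 : ℝ) ≤ q - 3)
          (mul_nonneg (by linarith) (by linarith) : (0 : ℝ) ≤ Q * (Q - 2))]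
    have h3 : 0 < q * (Q - 1) ^ 2 := by
      have : 0 < Q - 1 := by linarith
      positivity
    linarith
  have h4 : (q * Q - q + 2 * lam) ^ 2 ≤ (lam * x) ^ 2 :=
    pow_le_pow_left₀ (by linarith) hx 2
  have h5 : lam ^ 2 * (2 * n) < lam ^ 2 * x ^ 2 := by
    calc lam ^ 2 * (2 * n) = 2 * lam * (lam * n) := by ring
      _ < (lam * x) ^ 2 := by rw [hn]; exact h1.trans_le h4
      _ = lam ^ 2 * x ^ 2 := by ring
  exact lt_of_mul_lt_mul_left h5 (by positivity)

theorem sqrt_lt_of_sq_le {q lam Q n x : ℝ} (hlam : 1 ≤ lam)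
    (hn : lam * n = q * Q ^ 2 - 1) (hx0 : 0 < x) (hx : 2 * lam * (q * Q ^ 2) ≤ (lam * x) ^ 2) :
    √(2 * n) < x := by
  rw [Real.sqrt_lt' hx0]
  have h5 : lam ^ 2 * (2 * n) < lam ^ 2 * x ^ 2 := by
    calc lam ^ 2 * (2 * n) = 2 * lam * (lam * n) := by ring
      _ < 2 * lam * (q * Q ^ 2) := by rw [hn]; linarith
      _ ≤ (lam * x) ^ 2 := hx
      _ = lam ^ 2 * x ^ 2 := by ring
  exact lt_of_mul_lt_mul_left h5 (by positivity)

theorem real_le_minDist {F ι : Type*} [Field F] [DecidableEq F] [Fintype ι]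
    {C : Submodule F (ι → F)} {x : ℝ} (hC : C ≠ ⊥)
    (h : ∀ c ∈ C, c ≠ 0 → x ≤ hammingNorm c) : x ≤ minDist C :=
  Nat.ceil_le.1 (le_minDist hC fun c hc h0 => Nat.ceil_le.2 (h c hc h0))

/-- With `s = 1` the hypothesis squares to `q ≤ 2 * lam`. The second range needs `s ≥ 2` because its
proof falls back on `s - 1`. -/
theorem two_le_of_sqrt_le {q lam s : ℕ} (hlam0 : 0 < lam) (hs : 1 ≤ s) (hlam : 2 * lam + 1 ≤ q)
    (h : √((lam : ℝ) * q / 2) ≤ lam * s) : 2 ≤ s := by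
  by_contra hcon
  have hs1 : s = 1 := by omega
  subst hs1
  rw [Real.sqrt_le_left (by positivity)] at h
  have h1 : (2 * (lam : ℝ) + 1) ≤ q := by exact_mod_cast hlam
  have h2 : (0 : ℝ) < lam := by exact_mod_cast hlam0
  push_cast at h
  have h3 := mul_le_mul_of_nonneg_left h1 h2.le
  linarith

/-- Interface between the spectral bounds and the matrix-product code. -/
theorem matrixProduct_bounds {F K : Type*} [Field F] [Fintype F] [DecidableEq F] [Field K]
    [Algebra F K] [Finite K] {q m lam n δ : ℕ} (hq : Fintype.card F = q) (hlam : lam ∣ q - 1)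
    (hN : q ^ m - 1 = lam * n) (hN0 : q ^ m - 1 ≠ 0) (hδ : 2 ≤ δ) {α : K}
    (hα : IsPrimitiveRoot α (q ^ m - 1)) {A : Matrix (Fin 2) (Fin 2) F} (hA : A.det ≠ 0)
    {C : Submodule F (Fin n → F)} (hC : C = bchCode F n (α ^ lam) δ)
    {C' : Submodule F (Fin 2 × Fin n → F)} (hC' : C' = matrixProductCode ![C, dualCode C] A) :
    Module.finrank F C' = n ∧
    (∀ x : ℝ, (∀ w Spec, DualSpectrum q m lam (lam * (δ - 1)) w Spec → x ≤ w) →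
      x ≤ minDist (dualCode C) ∧ (x ≤ δ → x ≤ minDist C') ∧
      ((∀ j, A 0 j ≠ 0) → x ≤ 2 * δ → x ≤ minDist C')) ∧
    ((∀ j, A 0 j ≠ 0) → min (2 * δ) (minDist (dualCode C)) ≤ minDist C') := by
  have hn0 : 0 < n := Nat.pos_of_ne_zero (by rintro rfl; simp [hN] at hN0)
  have hβ : IsPrimitiveRoot (α ^ lam) n := hα.pow (Nat.pos_of_ne_zero hN0) hN
  have hrank : Module.finrank F C' = n := by
    rw [hC', finrank_matrixProductCode hA, finrank_add_finrank_dualCode]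
  have hne : matrixProductCode ![C, dualCode C] A ≠ ⊥ := by
    intro h
    rw [hC', h, finrank_bot] at hrank
    omega
  have h1 : ∀ u ∈ C, u ≠ 0 → δ ≤ hammingNorm u := fun u hu h0 =>
    hammingNorm_ge_of_mem_bchCode hβ (hC ▸ hu) h0
  refine ⟨hrank, fun x hx => ?_, fun hA0 => ?_⟩
  · have h2 : ∀ v ∈ dualCode C, v ≠ 0 → x ≤ hammingNorm v := fun v hv h0 =>
      hx _ _ (dualSpectrum hq hlam hN hα hN0 (hC ▸ hv) h0)
    refine ⟨real_le_minDist (hC ▸ dualCode_bchCode_ne_bot hβ.pow_eq_one hn0 hδ) h2,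
      fun hxδ => ?_, fun hA0 hxδ => ?_⟩
    · rw [hC']
      refine Nat.ceil_le.1 (le_minDist_matrixProductCode hA hne (fun u hu h0 => ?_)
        fun v hv h0 => Nat.ceil_le.2 (h2 v hv h0))
      exact Nat.ceil_le.2 (hxδ.trans (by exact_mod_cast h1 u hu h0))
    · rw [hC']
      refine Nat.ceil_le.1 (le_minDist_matrixProductCode' hA hA0 hne (fun u hu h0 => ?_)
        fun v hv h0 => Nat.ceil_le.2 (h2 v hv h0))
      exact Nat.ceil_le.2 (hxδ.trans (by
        have := h1 u hu h0
        exact_mod_cast (Nat.mul_le_mul_left 2 this)))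
  · rw [hC']
    refine le_minDist_matrixProductCode' hA hA0 hne (fun u hu h0 => ?_) fun v hv h0 => ?_
    · exact (min_le_left _ _).trans (Nat.mul_le_mul_left 2 (h1 u hu h0))
    · exact (min_le_right _ _).trans (minDist_le hv h0)

theorem bounds_of_large {q m lam n s d h Q : ℕ} (hlam : lam ∣ q - 1)
    (hlam0 : 0 < lam) (hlam2 : 2 * lam + 1 ≤ q) (hs : 1 ≤ s) (hs2 : lam * s + lam + 1 ≤ q)
    (hh : 1 ≤ h) (hmh : m = 2 * h + 1) (hQ : q ^ h = Q) (hqQ : q ≤ Q)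
    (hnQ : (lam : ℝ) * n = q * (Q : ℝ) ^ 2 - 1)
    (hsq : √(2 * lam * q) + lam * s ≤ (q : ℝ))
    (hd : ((d + 1 : ℕ) : ℝ) = ((q : ℝ) * Q - q) / lam + s + 1) :
    (∀ w Spec, DualSpectrum q m lam (lam * d) w Spec →
      ((q : ℝ) * Q + lam - 1) / lam - s * Q ≤ w) ∧
      ((q : ℝ) * Q + lam - 1) / lam - s * Q ≤ (d + 1 : ℕ) ∧ √(2 * n) < ((q : ℝ) * Q + lam - 1) / lam - s * Q := by
  have hlamR : (1 : ℝ) ≤ lam := by exact_mod_cast hlam0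
  have hlam2R : 2 * (lam : ℝ) + 1 ≤ q := by exact_mod_cast hlam2
  have hs2R : (lam : ℝ) * s + lam + 1 ≤ q := by exact_mod_cast hs2
  have hsR : (1 : ℝ) ≤ s := by exact_mod_cast hs
  have hqQR : (q : ℝ) ≤ Q := by exact_mod_cast hqQ
  have hdR : (lam : ℝ) * d + q = q * Q + lam * s := by
    push_cast at hd
    field_simp at hd
    linarith
  have hdN : lam * d + q = q * Q + lam * s := by exact_mod_cast hdR
  have hx : (((q : ℝ) * Q + lam - 1) / lam - s * Q) * lam = q * Q + lam - 1 - lam * s * Q := by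
    field_simp
  have hle : ∀ y : ℝ, (q : ℝ) * Q + lam ≤ lam * y + lam * s * Q + 1 →
      ((q : ℝ) * Q + lam - 1) / lam - s * Q ≤ y := by
    intro y hy
    refine le_of_mul_le_mul_right ?_ (by linarith : (0 : ℝ) < lam)
    linarith
  refine ⟨fun w Spec H => hle w ?_, hle _ ?_, ?_⟩
  · exact_mod_cast H.weight_ge_of_large (by omega) hmh hh hlam hlam0 hQ
      (Nat.mul_pos hlam0 (by omega)) (by omega) hdN
  · push_cast
    have h1 : (lam : ℝ) * s * Q ≥ 1 * Q :=
      mul_le_mul_of_nonneg_right (by nlinarith) (by positivity)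
    nlinarith
  · have h0 : 0 < √(2 * (lam : ℝ) * q) := Real.sqrt_pos.2 (by nlinarith)
    have h1 := Real.sq_sqrt (show 0 ≤ 2 * (lam : ℝ) * q by positivity)
    have h2 : 2 * (lam : ℝ) * q ≤ (q - lam * s) ^ 2 := by
      rw [← h1]; exact pow_le_pow_left₀ h0.le (by linarith) 2
    have h3 : (0 : ℝ) < Q := by linarith
    have h4 : (q - lam * s) * (Q : ℝ) ≤ lam * (((q : ℝ) * Q + lam - 1) / lam - s * Q) := by
      have := hx
      linarith
    have h5 : 0 < (q - lam * s) * (Q : ℝ) := mul_pos (by linarith) h3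
    refine sqrt_lt_of_sq_le hlamR hnQ ?_ ?_
    · by_contra! h
      nlinarith
    · refine le_trans ?_ (pow_le_pow_left₀ h5.le h4 2)
      rw [mul_pow]
      calc 2 * (lam : ℝ) * (q * Q ^ 2) = 2 * lam * q * Q ^ 2 := by ring
        _ ≤ _ := mul_le_mul_of_nonneg_right h2 (by positivity)

theorem bounds_of_le_sub_one {q m lam n s d h Q : ℕ} (hpp : IsPrimePow q) (hlam : lam ∣ q - 1)
    (hlam0 : 0 < lam) (hlam2 : 2 * lam + 1 ≤ q) (hs : 1 ≤ s) (hs2 : lam * s + lam + 1 ≤ q)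
    (hh : 1 ≤ h) (hmh : m = 2 * h + 1) (hQ : q ^ h = Q) (hqQ : q ≤ Q)
    (hnQ : (lam : ℝ) * n = q * (Q : ℝ) ^ 2 - 1)
    (hsq : √(lam * q / 2) ≤ (lam * s : ℝ)) (hd1 : √(2 * n) / 2 < ((d + 1 : ℕ) : ℝ))
    (hd3 : ((d + 1 : ℕ) : ℝ) ≤ ((Q : ℝ) - 1) / lam + s * Q - 1) :
    (∀ w Spec, DualSpectrum q m lam (lam * d) w Spec →
      ((q : ℝ) * Q - 1) / lam - s + 3 ≤ w) ∧
      √(2 * n) < min (2 * ((d + 1 : ℕ) : ℝ)) (((q : ℝ) * Q - 1) / lam - s + 3) := by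
  have hlamR : (1 : ℝ) ≤ lam := by exact_mod_cast hlam0
  have hlam2R : 2 * (lam : ℝ) + 1 ≤ q := by exact_mod_cast hlam2
  have hs2R : (lam : ℝ) * s + lam + 1 ≤ q := by exact_mod_cast hs2
  have hsR : (1 : ℝ) ≤ s := by exact_mod_cast hs
  have hqQR : (q : ℝ) ≤ Q := by exact_mod_cast hqQ
  have hs2 : 2 ≤ s := two_le_of_sqrt_le hlam0 hs hlam2 hsq
  have hdR : (lam : ℝ) * d + 1 + 2 * lam ≤ (lam * s + 1) * Q := by
    push_cast at hd3
    field_simp at hd3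
    linarith
  have hdN : lam * d + 1 + 2 * lam ≤ (lam * s + 1) * Q := by exact_mod_cast hdR
  have hx : ((q * Q - 1) / lam - s + 3) * (lam : ℝ) = q * Q - 1 - lam * s + 3 * lam := by
    field_simp
  refine ⟨fun w Spec H => ?_, lt_min ?_ ?_⟩
  · have h1 : q * Q + 3 * lam ≤ lam * w + lam * s + 1 :=
      H.weight_ge_of_le_sub hpp hmh hh hlam hlam0 hQ hs2 (by omega) hdN
    have h2 : (q : ℝ) * Q + 3 * lam ≤ lam * w + lam * s + 1 := by exact_mod_cast h1
    refine le_of_mul_le_mul_right ?_ (by linarith : (0 : ℝ) < lam)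
    linarith
  · push_cast at hd1 ⊢
    linarith
  · refine sqrt_lt_of_sub_le hlamR hlam2R hqQR hnQ ?_
    rw [mul_comm (lam : ℝ), hx]
    linarith

theorem bounds_of_eq {q m lam n s d h Q : ℕ} (hlam : lam ∣ q - 1)
    (hlam0 : 0 < lam) (hlam2 : 2 * lam + 1 ≤ q) (hs : 1 ≤ s) (hs2 : lam * s + lam + 1 ≤ q)
    (hh : 1 ≤ h) (hmh : m = 2 * h + 1) (hQ : q ^ h = Q) (hqQ : q ≤ Q)
    (hnQ : (lam : ℝ) * n = q * (Q : ℝ) ^ 2 - 1)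
    (hsq : √(lam * q / 2) ≤ (lam * s : ℝ))
    (hd : ((d + 1 : ℕ) : ℝ) = ((Q : ℝ) - 1) / lam + s * Q) :
    (∀ w Spec, DualSpectrum q m lam (lam * d) w Spec →
      ((q : ℝ) * Q - 1) / lam - s + 2 ≤ w) ∧
      √(2 * n) < min (2 * ((d + 1 : ℕ) : ℝ)) (((q : ℝ) * Q - 1) / lam - s + 2) := by
  have hlamR : (1 : ℝ) ≤ lam := by exact_mod_cast hlam0
  have hlam2R : 2 * (lam : ℝ) + 1 ≤ q := by exact_mod_cast hlam2
  have hs2R : (lam : ℝ) * s + lam + 1 ≤ q := by exact_mod_cast hs2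
  have hsR : (1 : ℝ) ≤ s := by exact_mod_cast hs
  have hqQR : (q : ℝ) ≤ Q := by exact_mod_cast hqQ
  have hdR : (lam : ℝ) * d + 1 + lam = (lam * s + 1) * Q := by
    push_cast at hd
    field_simp at hd
    linarith
  have hdN : lam * d + 1 + lam = (lam * s + 1) * Q := by exact_mod_cast hdR
  have hx : ((q * Q - 1) / lam - s + 2) * (lam : ℝ) = q * Q - 1 - lam * s + 2 * lam := by
    field_simp
  refine ⟨fun w Spec H => ?_, lt_min ?_ ?_⟩
  · have h1 : q * Q + 2 * lam ≤ lam * w + lam * s + 1 :=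
      H.weight_ge_of_le (by omega) hmh hh hlam hlam0 hQ (by omega) hdN.le
    have h2 : (q : ℝ) * Q + 2 * lam ≤ lam * w + lam * s + 1 := by exact_mod_cast h1
    refine le_of_mul_le_mul_right ?_ (by linarith : (0 : ℝ) < lam)
    linarith
  · refine sqrt_lt_of_sq_le hlamR hnQ (by push_cast; positivity) ?_
    have h1 := Real.sq_sqrt (show 0 ≤ (lam : ℝ) * q / 2 by positivity)
    have h2 : (lam : ℝ) * q / 2 ≤ (lam * s) ^ 2 := by
      rw [← h1]; exact pow_le_pow_left₀ (Real.sqrt_nonneg _) hsq 2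
    -- Exactly, `lam * (d + 1) = (lam * s + 1) * Q - 1`, which is at least `lam * s * Q`.
    have h3 : 2 * (lam * s * Q : ℝ) ≤ lam * (2 * ((d + 1 : ℕ) : ℝ)) := by
      push_cast; linarith
    refine le_trans ?_ (pow_le_pow_left₀ (by positivity) h3 2)
    calc 2 * (lam : ℝ) * ((q : ℝ) * (Q : ℝ) ^ 2) = 4 * ((lam : ℝ) * q / 2) * (Q : ℝ) ^ 2 := by ring
      _ ≤ 4 * ((lam : ℝ) * s) ^ 2 * (Q : ℝ) ^ 2 := by gcongr
      _ = _ := by ring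
  · refine sqrt_lt_of_sub_le hlamR hlam2R hqQR hnQ ?_
    rw [mul_comm (lam : ℝ), hx]
    linarith

theorem bounds_of_medium {q m lam n s d h Q : ℕ} (hlam : lam ∣ q - 1)
    (hlam0 : 0 < lam) (hlam2 : 2 * lam + 1 ≤ q) (hs : 1 ≤ s) (hs2 : lam * s + lam + 1 ≤ q)
    (hh : 1 ≤ h) (hmh : m = 2 * h + 1) (hQ : q ^ h = Q) (hqQ : q ≤ Q)
    (hnQ : (lam : ℝ) * n = q * (Q : ℝ) ^ 2 - 1)
    (hd1 : ((q : ℝ) * Q - 1) / lam - Q < ((d + 1 : ℕ) : ℝ))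
    (hd2 : ((d + 1 : ℕ) : ℝ) ≤ ((q : ℝ) * Q - q) / lam + 1) :
    (∀ w Spec, DualSpectrum q m lam (lam * d) w Spec →
      ((q : ℝ) * Q - q) / lam + 2 ≤ w) ∧
      ((q : ℝ) * Q - q) / lam + 2 ≤ 2 * ((d + 1 : ℕ) : ℝ) ∧ √(2 * n) < ((q : ℝ) * Q - q) / lam + 2 := by
  have hlamR : (1 : ℝ) ≤ lam := by exact_mod_cast hlam0
  have hlam2R : 2 * (lam : ℝ) + 1 ≤ q := by exact_mod_cast hlam2
  have hs2R : (lam : ℝ) * s + lam + 1 ≤ q := by exact_mod_cast hs2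
  have hsR : (1 : ℝ) ≤ s := by exact_mod_cast hs
  have hqQR : (q : ℝ) ≤ Q := by exact_mod_cast hqQ
  have hd1R : (q : ℝ) * Q < lam * d + lam + 1 + lam * Q := by
    push_cast at hd1
    field_simp at hd1
    linarith
  have hdR : (lam : ℝ) * d + q ≤ q * Q := by
    push_cast at hd2
    field_simp at hd2
    linarith
  have hd1N : q * Q < lam * d + lam + 1 + lam * Q := by exact_mod_cast hd1R
  have hdN : lam * d + q ≤ q * Q := by exact_mod_cast hdR
  have hx : ((q * Q - q) / lam + 2) * (lam : ℝ) = q * Q - q + 2 * lam := by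
    field_simp
  refine ⟨fun w Spec H => ?_, ?_, ?_⟩
  · have h1 : q * Q + 2 * lam ≤ lam * w + q :=
      H.weight_ge_of_medium (by omega) hmh hh hlam hlam0 (by omega) hQ hdN
    have h2 : (q : ℝ) * Q + 2 * lam ≤ lam * w + q := by exact_mod_cast h1
    refine le_of_mul_le_mul_right ?_ (by linarith : (0 : ℝ) < lam)
    linarith
  · have h3 : (q : ℝ) * Q ≤ lam * d + lam + lam * Q := by
      exact_mod_cast Nat.lt_succ_iff.1 (by linarith : q * Q < (lam * d + lam + lam * Q) + 1)
    have h4 : (2 * (lam : ℝ) + 1) * Q ≤ q * Q := by gcongr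
    refine le_of_mul_le_mul_right ?_ (by linarith : (0 : ℝ) < lam)
    rw [hx]
    push_cast
    linarith
  · refine sqrt_lt_of_sub_le hlamR hlam2R hqQR hnQ ?_
    rw [mul_comm (lam : ℝ), hx]

theorem bounds_of_even {q m lam n d h R : ℕ} (hpp : IsPrimePow q) (hlam : lam ∣ q - 1)
    (hlam0 : 0 < lam) (hlam2 : 2 * lam + 1 ≤ q) (hh : 2 ≤ h) (hmh : m = 2 * h)
    (hR : q ^ h = q * R) (hnR : (lam : ℝ) * n = (q : ℝ) ^ m - 1)
    (hd1 : (q : ℝ) * R - R - 1 < ((d + 1 : ℕ) : ℝ))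
    (hd2 : ((d + 1 : ℕ) : ℝ) ≤ (q : ℝ) * R - q + 1) :
    (∀ w Spec, DualSpectrum q m lam (lam * d) w Spec → 2 * ((d + 1 : ℕ) : ℝ) ≤ w) ∧
      (4 ≤ q → √(2 * n) < 2 * ((d + 1 : ℕ) : ℝ)) := by
  have hlamR : (1 : ℝ) ≤ lam := by exact_mod_cast hlam0
  have hd1N : q * R ≤ d + R + 1 := by
    have h1 : (q : ℝ) * R < d + R + 2 := by push_cast at hd1; linarith
    have h2 : q * R < d + R + 2 := by exact_mod_cast h1
    omega
  have hd2N : d + q ≤ q * R := by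
    have h1 : (d : ℝ) + q ≤ q * R := by push_cast at hd2; linarith
    exact_mod_cast h1
  refine ⟨fun w Spec H => ?_, fun hq4 => ?_⟩
  · have h2 : 2 * (d + 1) ≤ w := by
      rcases Nat.lt_or_ge 1 lam with hl | hl
      · have h3 := H.weight_ge_of_even_of_two_le hpp hmh hh hlam hl hlam2
          (Nat.mul_le_mul_left _ (by rw [hR]; omega))
        rw [hR] at h3
        omega
      · have hl1 : lam = 1 := by omega
        subst hl1
        have h3 := H.weight_ge_of_even (by omega) hmh hh (by rw [hR]; omega)
        rw [pow_succ', hR] at h3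
        have h4 : 3 * (q * R) ≤ q * (q * R) := Nat.mul_le_mul_right _ (by omega)
        omega
    exact_mod_cast h2
  · rw [Real.sqrt_lt' (by positivity)]
    have hq4R : (4 : ℝ) ≤ q := by exact_mod_cast hq4
    have h1 : (lam : ℝ) * n = ((q : ℝ) * R) ^ 2 - 1 := by
      have h2 : (q : ℝ) ^ h = q * R := by exact_mod_cast hR
      rw [hnR, hmh, pow_mul', h2]
    have h2 : (n : ℝ) ≤ lam * n := le_mul_of_one_le_left (by positivity) hlamR
    have h3 : ((q : ℝ) - 1) * R ≤ d + 1 := by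
      have : (q : ℝ) * R ≤ d + R + 1 := by exact_mod_cast hd1N
      linarith
    have h4 : (((q : ℝ) - 1) * R) ^ 2 ≤ ((d : ℝ) + 1) ^ 2 :=
      pow_le_pow_left₀ (mul_nonneg (by linarith) (by positivity)) h3 2
    push_cast
    have h5 : (q : ℝ) ^ 2 * (R : ℝ) ^ 2 ≤ 2 * ((q : ℝ) - 1) ^ 2 * (R : ℝ) ^ 2 := by
      gcongr
      nlinarith
    linarith

theorem bounds_of_primitive {q m n s d h Q : ℕ} (hpp : IsPrimePow q) (hq5 : 5 ≤ q)
    (hs : 1 ≤ s) (hs2 : s + 2 ≤ q) (hh : 1 ≤ h) (hmh : m = 2 * h + 1) (hQ : q ^ h = Q)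
    (hqQ : q ≤ Q) (hnQ : (n : ℝ) = q * (Q : ℝ) ^ 2 - 1)
    (hd1 : (s : ℝ) * Q ≤ ((d + 1 : ℕ) : ℝ))
    (hd2 : ((d + 1 : ℕ) : ℝ) ≤ ((s : ℝ) + 1) * Q - s * (q : ℝ) ^ (h - 1) - 2) :
    (√((q : ℝ) / 2) ≤ s → (s : ℝ) ≤ q / 2 →
      (∀ w Spec, DualSpectrum q m 1 (1 * d) w Spec → 2 * ((d + 1 : ℕ) : ℝ) ≤ w) ∧
        √(2 * n) < 2 * ((d + 1 : ℕ) : ℝ)) ∧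
    ((q : ℝ) / 2 < s → (s : ℝ) < q - 2 →
      (∀ w Spec, DualSpectrum q m 1 (1 * d) w Spec → (q : ℝ) * Q - s + 3 ≤ w) ∧
        (q : ℝ) * Q - s + 3 ≤ 2 * ((d + 1 : ℕ) : ℝ) ∧ √(2 * n) < (q : ℝ) * Q - s + 3) := by
  have hsR : (1 : ℝ) ≤ s := by exact_mod_cast hs
  have hqQR : (q : ℝ) ≤ Q := by exact_mod_cast hqQ
  have hq5R : (5 : ℝ) ≤ q := by exact_mod_cast hq5
  have hdN : 1 * d + 3 + s * q ^ (h - 1) ≤ (s + 1) * Q := by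
    have h1 : (d : ℝ) + 3 + s * (q : ℝ) ^ (h - 1) ≤ (s + 1) * Q := by
      push_cast at hd2; linarith
    have h2 : d + 3 + s * q ^ (h - 1) ≤ (s + 1) * Q := by exact_mod_cast h1
    omega
  have hnQ' : (1 : ℝ) * n = q * (Q : ℝ) ^ 2 - 1 := by rw [one_mul, hnQ]
  refine ⟨fun hsq hs3 => ⟨fun w Spec H => ?_, ?_⟩,
    fun hs3 hs4 => ⟨fun w Spec H => ?_, ?_, ?_⟩⟩
  · have hs3N : 2 * s ≤ q := by
      have h1 : 2 * (s : ℝ) ≤ q := by linarith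
      exact_mod_cast h1
    have h2 := (H.weight_ge_of_primitive hpp hq5 hmh hh hQ (by omega) hdN).1 hs3N
    rw [one_mul] at h2
    exact_mod_cast h2
  · refine sqrt_lt_of_sq_le le_rfl hnQ' (by push_cast; positivity) ?_
    have h1 := Real.sq_sqrt (show 0 ≤ (q : ℝ) / 2 by positivity)
    have h2 : (q : ℝ) / 2 ≤ (s : ℝ) ^ 2 := by
      rw [← h1]; exact pow_le_pow_left₀ (Real.sqrt_nonneg _) hsq 2
    have h3 : 2 * (s * Q : ℝ) ≤ 1 * (2 * ((d + 1 : ℕ) : ℝ)) := by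
      linarith
    refine le_trans ?_ (pow_le_pow_left₀ (by positivity) h3 2)
    calc 2 * (1 : ℝ) * ((q : ℝ) * (Q : ℝ) ^ 2) = 4 * ((q : ℝ) / 2) * (Q : ℝ) ^ 2 := by ring
      _ ≤ 4 * (s : ℝ) ^ 2 * (Q : ℝ) ^ 2 := by gcongr
      _ = _ := by ring
  · have hs3N : q < 2 * s := by
      have h1 : (q : ℝ) < 2 * s := by linarith
      exact_mod_cast h1
    have hs4N : s + 3 ≤ q := by
      have h1 : (s : ℝ) + 2 < q := by linarith
      have h2 : s + 2 < q := by exact_mod_cast h1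
      omega
    have h2 := (H.weight_ge_of_primitive hpp hq5 hmh hh hQ hs4N hdN).2 hs3N
    have h3 : (q : ℝ) * Q + 3 ≤ w + s := by exact_mod_cast h2
    linarith
  · have hs3N : q < 2 * s := by
      have h1 : (q : ℝ) < 2 * s := by linarith
      exact_mod_cast h1
    have h1 : ((q : ℝ) + 1) * Q ≤ 2 * s * Q := by
      have : (q : ℝ) + 1 ≤ 2 * s := by exact_mod_cast hs3N
      gcongr
    push_cast at hd1 ⊢
    linarith
  · refine sqrt_lt_of_sub_le le_rfl (by linarith) hqQR hnQ' ?_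
    linarith

theorem mainTheorem4 {F K : Type*} [Field F] [Fintype F] [DecidableEq F] [Field K] [Algebra F K]
    (q m lam n s δ : ℕ)
    (hq : Fintype.card F = q) (hm : 2 ≤ m) (hK : Nat.card K = q ^ m)
    (hlam : lam ∣ q - 1) (hlam' : lam ≠ q - 1) (hn : n = (q ^ m - 1) / lam)
    (hs : 1 ≤ s) (hs' : s ≤ (q - 1) / lam - 1)
    (hδ : 2 ≤ δ) (hδ' : δ ≤ n)
    (α β : K) (hα : IsPrimitiveRoot α (q ^ m - 1)) (hβ : β = α ^ ((q ^ m - 1) / n))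
    (A : Matrix (Fin 2) (Fin 2) F) (hA : A.det ≠ 0)
    (C : Submodule F (Fin n → F)) (hC : C = bchCode F n β δ)
    (C' : Submodule F (Fin 2 × Fin n → F)) (hC' : C' = matrixProductCode ![C, dualCode C] A) :
    -- `C'` is a `[2n, n]` code
    Module.finrank F C' = n ∧
    -- first case, for every nonsingular `A`
    (Odd m → √(2 * lam * q) + lam * s ≤ (q : ℝ) →
      (δ : ℝ) = ((q : ℝ) ^ ((m + 1) / 2) - q) / lam + s + 1 →
      ((q : ℝ) ^ ((m + 1) / 2) + lam - 1) / lam - s * (q : ℝ) ^ ((m - 1) / 2) ≤ minDist C' ∧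
      √(2 * n) < ((q : ℝ) ^ ((m + 1) / 2) + lam - 1) / lam - s * (q : ℝ) ^ ((m - 1) / 2)) ∧
    -- remaining cases, when both entries of the first row of `A` are nonzero
    ((∀ j, A 0 j ≠ 0) →
      -- second case
      (Odd m → √(lam * q / 2) ≤ (lam * s : ℝ) →
        √(2 * n) / 2 < (δ : ℝ) →
        ((q : ℝ) ^ ((m - 1) / 2) - 1) / lam + (s - 1) * (q : ℝ) ^ ((m - 1) / 2) < δ →
        (δ : ℝ) ≤ ((q : ℝ) ^ ((m - 1) / 2) - 1) / lam + s * (q : ℝ) ^ ((m - 1) / 2) - 1 →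
        min (2 * δ) (minDist (dualCode C)) ≤ minDist C' ∧
        ((q : ℝ) ^ ((m + 1) / 2) - 1) / lam - s + 3 ≤ minDist (dualCode C) ∧
        √(2 * n) < min (2 * δ : ℝ) (((q : ℝ) ^ ((m + 1) / 2) - 1) / lam - s + 3)) ∧
      -- second case, exceptional designed distance
      (Odd m → √(lam * q / 2) ≤ (lam * s : ℝ) →
        (δ : ℝ) = ((q : ℝ) ^ ((m - 1) / 2) - 1) / lam + s * (q : ℝ) ^ ((m - 1) / 2) →
        min (2 * δ) (minDist (dualCode C)) ≤ minDist C' ∧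
        ((q : ℝ) ^ ((m + 1) / 2) - 1) / lam - s + 2 ≤ minDist (dualCode C) ∧
        √(2 * n) < min (2 * δ : ℝ) (((q : ℝ) ^ ((m + 1) / 2) - 1) / lam - s + 2)) ∧
      -- third case
      (Odd m →
        ((q : ℝ) ^ ((m + 1) / 2) - 1) / lam - (q : ℝ) ^ ((m - 1) / 2) < δ →
        (δ : ℝ) ≤ ((q : ℝ) ^ ((m + 1) / 2) - q) / lam + 1 →
        ((q : ℝ) ^ ((m + 1) / 2) - q) / lam + 2 ≤ minDist C' ∧
        √(2 * n) < ((q : ℝ) ^ ((m + 1) / 2) - q) / lam + 2) ∧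
      -- fourth case
      (Even m →
        (q : ℝ) ^ (m / 2) - (q : ℝ) ^ ((m - 2) / 2) - 1 < δ →
        (δ : ℝ) ≤ (q : ℝ) ^ (m / 2) - q + 1 →
        2 * δ ≤ minDist C' ∧ (4 ≤ q → √(2 * n) < (2 * δ : ℝ))) ∧
      -- additional ranges for `lam = 1`, `q ≥ 5`
      (Odd m → 5 ≤ q → lam = 1 →
        (s : ℝ) * (q : ℝ) ^ ((m - 1) / 2) ≤ δ →
        (δ : ℝ) ≤ (s + 1) * (q : ℝ) ^ ((m - 1) / 2) - s * (q : ℝ) ^ ((m - 3) / 2) - 2 →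
        (√(q / 2) ≤ (s : ℝ) → (s : ℝ) ≤ q / 2 →
          2 * δ ≤ minDist C' ∧ √(2 * n) < (2 * δ : ℝ)) ∧
        ((q : ℝ) / 2 < s → (s : ℝ) < q - 2 →
          (q : ℝ) ^ ((m + 1) / 2) - s + 3 ≤ minDist C' ∧
          √(2 * n) < (q : ℝ) ^ ((m + 1) / 2) - s + 3))) := by
  have hq1 : 1 < q := hq ▸ Fintype.one_lt_card
  have hpp : IsPrimePow q := hq ▸ FiniteField.isPrimePow_card F
  have hlam0 : 0 < lam := Nat.pos_of_dvd_of_pos hlam (by omega)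
  have hlam2 : 2 * lam + 1 ≤ q := by
    obtain ⟨c, hc⟩ := hlam
    have hc2 : 2 ≤ c := by
      rcases c with _ | _ | c
      · omega
      · omega
      · omega
    have := Nat.mul_le_mul_left lam hc2
    omega
  have hs2 : lam * s + lam + 1 ≤ q := by
    have h1 : 2 ≤ (q - 1) / lam := by
      rw [Nat.le_div_iff_mul_le hlam0]
      omega
    have h2 := (Nat.mul_le_mul_right lam (show s + 1 ≤ (q - 1) / lam by omega)).trans
      (Nat.div_mul_le_self _ _)
    rw [Nat.succ_mul, mul_comm] at h2
    omega
  have hdvd : lam ∣ q ^ m - 1 := hlam.trans (by simpa using Nat.sub_dvd_pow_sub_pow q 1 m)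
  have hN : q ^ m - 1 = lam * n := by rw [hn, Nat.mul_div_cancel' hdvd]
  have hn0 : 0 < n := by omega
  have hN0 : q ^ m - 1 ≠ 0 := by
    rw [hN]; exact (Nat.mul_pos hlam0 hn0).ne'
  have hβ' : β = α ^ lam := by rw [hβ, hN, Nat.mul_div_cancel _ hn0]
  have : Finite K := Nat.finite_of_card_ne_zero (by rw [hK]; positivity)
  obtain ⟨hrank, hbound, hmin⟩ := matrixProduct_bounds hq hlam hN hN0 hδ hα hA
    (hβ' ▸ hC) hC'
  have hlamR : (1 : ℝ) ≤ lam := by exact_mod_cast hlam0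
  have hlam2R : 2 * (lam : ℝ) + 1 ≤ q := by exact_mod_cast hlam2
  have hs2R : (lam : ℝ) * s + lam + 1 ≤ q := by exact_mod_cast hs2
  have hsR : (1 : ℝ) ≤ s := by exact_mod_cast hs
  have hnR : (lam : ℝ) * n = (q : ℝ) ^ m - 1 := by
    have : q ^ m = lam * n + 1 := by omega
    have : (q : ℝ) ^ m = lam * n + 1 := by exact_mod_cast this
    linarith
  obtain ⟨d, rfl⟩ : ∃ d, δ = d + 1 := ⟨δ - 1, by omega⟩
  rw [Nat.add_sub_cancel] at hbound
  have hodd : Odd m → ∃ h Q : ℕ, 1 ≤ h ∧ m = 2 * h + 1 ∧ q ^ h = Q ∧ q ≤ Q ∧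
      (lam : ℝ) * n = q * (Q : ℝ) ^ 2 - 1 ∧ (q : ℝ) ^ ((m + 1) / 2) = q * Q ∧
      (q : ℝ) ^ ((m - 1) / 2) = Q := by
    rintro ⟨h, rfl⟩
    refine ⟨h, q ^ h, by omega, rfl, rfl, Nat.le_self_pow (by omega) q, ?_, ?_, ?_⟩
    · rw [hnR]; push_cast; ring
    · rw [show (2 * h + 1 + 1) / 2 = h + 1 by omega]; push_cast; ring
    · rw [show (2 * h + 1 - 1) / 2 = h by omega]; push_cast; ring
  refine ⟨hrank, fun hm1 hsq hd => ?_, fun hA0 => ⟨fun hm1 hsq hd1 _ hd3 => ?_,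
    fun hm1 hsq hd => ?_, fun hm1 hd1 hd2 => ?_, ?_, fun hm1 hq5 hl hd1 hd2 => ?_⟩⟩
  · obtain ⟨h, Q, hh, hmh, hQ, hqQ, hnQ, e1, e2⟩ := hodd hm1
    rw [e1] at hd
    rw [e1, e2]
    obtain ⟨h1, h2, h3⟩ := bounds_of_large hlam hlam0 hlam2 hs hs2 hh hmh hQ hqQ hnQ hsq hd
    exact ⟨(hbound _ h1).2.1 h2, h3⟩
  · obtain ⟨h, Q, hh, hmh, hQ, hqQ, hnQ, e1, e2⟩ := hodd hm1
    rw [e2] at hd3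
    rw [e1]
    obtain ⟨h1, h2⟩ := bounds_of_le_sub_one hpp hlam hlam0 hlam2 hs hs2 hh hmh hQ hqQ hnQ hsq
      hd1 hd3
    exact ⟨hmin hA0, (hbound _ h1).1, h2⟩
  · obtain ⟨h, Q, hh, hmh, hQ, hqQ, hnQ, e1, e2⟩ := hodd hm1
    rw [e2] at hd
    rw [e1]
    obtain ⟨h1, h2⟩ := bounds_of_eq hlam hlam0 hlam2 hs hs2 hh hmh hQ hqQ hnQ hsq hd
    exact ⟨hmin hA0, (hbound _ h1).1, h2⟩
  · obtain ⟨h, Q, hh, hmh, hQ, hqQ, hnQ, e1, e2⟩ := hodd hm1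
    rw [e1, e2] at hd1
    rw [e1] at hd2
    rw [e1]
    obtain ⟨h1, h2, h3⟩ := bounds_of_medium hlam hlam0 hlam2 hs hs2 hh hmh hQ hqQ hnQ hd1 hd2
    exact ⟨(hbound _ h1).2.2 hA0 h2, h3⟩
  · rintro ⟨h, hmh⟩ hd1 hd2
    obtain ⟨R, hR⟩ : ∃ R, R = q ^ (h - 1) := ⟨_, rfl⟩
    have e1 : q ^ (m / 2) = q * R := by rw [hR, ← pow_succ']; congr 1; omega
    have e2 : q ^ ((m - 2) / 2) = R := by rw [hR]; congr 1; omega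
    have e3 : q ^ h = q * R := by rw [← e1]; congr 1; omega
    have e1R : (q : ℝ) ^ (m / 2) = q * R := by exact_mod_cast e1
    have e2R : (q : ℝ) ^ ((m - 2) / 2) = R := by exact_mod_cast e2
    rw [e1R, e2R] at hd1
    rw [e1R] at hd2
    -- For `m = 2` the upper limit on the designed distance is `1`, so the range is empty.
    have hh2 : 2 ≤ h := by
      by_contra hcon
      have h1 : h = 1 := by omega
      rw [h1] at hR
      simp only [Nat.sub_self, pow_zero] at hR
      subst hR
      have h2 : ((d + 1 : ℕ) : ℝ) ≤ (1 : ℕ) := by push_cast at hd2 ⊢; linarith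
      have h3 : d + 1 ≤ 1 := by exact_mod_cast h2
      omega
    obtain ⟨h1, h2⟩ := bounds_of_even hpp hlam hlam0 hlam2 hh2 (by omega) e3 hnR hd1 hd2
    refine ⟨?_, h2⟩
    have h3 := (hbound _ h1).2.2 hA0 (le_refl _)
    exact_mod_cast h3
  · obtain ⟨h, Q, hh, hmh, hQ, hqQ, hnQ, e1, e2⟩ := hodd hm1
    subst hl
    rw [e2] at hd1 hd2
    rw [show (m - 3) / 2 = h - 1 by omega] at hd2
    rw [e1]
    obtain ⟨h1, h2⟩ := bounds_of_primitive hpp hq5 hs (by omega) hh hmh hQ hqQ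
      (by simpa using hnQ) hd1 hd2
    refine ⟨fun hsq hs3 => ?_, fun hs3 hs4 => ?_⟩
    · obtain ⟨h3, h4⟩ := h1 hsq hs3
      refine ⟨?_, h4⟩
      have h5 := (hbound _ h3).2.2 hA0 (le_refl _)
      exact_mod_cast h5
    · obtain ⟨h3, h4, h5⟩ := h2 hs3 hs4
      exact ⟨(hbound _ h3).2.2 hA0 h4, h5⟩

end
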